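/- **Setting.** Let $d\ge 2$. On $\ell^1(\mathbb Z^2;\mathbb C)$ let $$H_{\rm Res}(r)=\sum r_{k_1}\bar r_{k_2}r_{k_3}\bar r_{k_4}\cdots r_{k_{2d-1}}\bar r_{k_{2d}},$$ the sum running over all $(k_1,\dots,k_{2d})\in(\mathbb Z^2)^{2d}$ with $\sum_{i}(-1)^ik_i=0$ and $\sum_i(-1)^i|k_i|^2=0$. Its flow is that of $\dot r_k=2\mathrm i\,\partial_{\bar r_k}H_{\rm Res}$, $k\in\mathbb Z^2$. Similarly, the Hamiltonian flow of a function $h$ on $\mathbb C^N$ with respect to $\frac{\mathrm i}{2}\sum_j db_j\wedge d\bar b_j$ is that of $\dot b_j=2\mathrm i\,\partial_{\bar b_j}h$. A set is invariant under a flow if every orbit that meets it stays in it during its whole interval of existence. Put $n=2^{N-1}$. Let $s>1$ and $K\in\mathbb R$. A set $\mathcal S\subset\mathbb Z^2$ is called *acceptable* (for $d,N,s,K$) if: 1. $\mathcal S=\mathcal S_1\cup\dots\cup\mathcal S_N$ is a disjoint union of $N$ generations, each of cardinality $n$. 2. (Norm explosion) $\displaystyle \frac{\sum_{k\in\mathcal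 S_{N-2}}|k|^{2s}}{\sum_{k\in\mathcal S_3}|k|^{2s}}>2^{(N-6)(s-1)}$. 3. The subspace $U_{\mathcal S}=\{r:\ r_k=0\ \forall k\notin\mathcal S,\ r_l=r_j=:b_i\ \forall i,\ \forall l,j\in\mathcal S_i\}$ is invariant under the flow of $H_{\rm Res}$. 4. In the coordinates $b\in\mathbb C^N$ on $U_{\mathcal S}$, the restriction of $H_{\rm Res}$ to $U_{\mathcal S}$ is $n\,h_{\mathcal S}(b)$, and the flow of $H_{\rm Res}$ restricted to $U_{\mathcal S}$ is the Hamiltonian flow, with respect to $\frac{\mathrm i}{2}\sum_jdb_j\wedge d\bar b_j$, of $$h_{\mathcal S}(b)=d!\,n^{d-1}\Big(\sum_{i=1}^N|b_i|^2\Big)^d+n^{d-2}d!\,d(d-1)\Big\{\Big(\sum_{i=1}^N|b_i|^2\Big)^{d-2}\Big[-\frac14\sum_{i=1}^N|b_i|^4+\sum_{i=1}^{N-1}\mathrm{Re}(b_i^2\bar b_{i+1}^2)\Big]+\frac1n\mathcal P\big(b,\bar b,\tfrac1n\big)\Big\},$$ where $\mathcal P$ has the following properties. - (a) $\mathcal P$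 is a polynomial with real coefficients in all its variables, homogeneous of degree $2d$ in $(b,\bar b)$, and all its coefficients are bounded by $K$ in absolute value. - (b) $\mathcal P(b,\bar b,\frac1n)=\mathcal P(\bar b,b,\frac1n)$. - (c) $\mathcal P$ Poisson commutes with $J=\sum_i|b_i|^2$. - (d) All monomials of $\mathcal P$ have even degree in each $(b_i,\bar b_i)$; for all $i$ the subspace $\{b_i=0\}$ is invariant under the flow of $h_{\mathcal S}$. - (e) For $j=1,\dots,N-1$ the subspace of $U_{\mathcal S}$ given by $b_i=0$ for all $i\ne j,j+1$ is invariant under the flow of $H_{\rm Res}$. The pullback of $H_{\rm Res}$ to it is independent of $j$ (up to index translation) and symmetric under the exchange $b_j\leftrightarrow b_{j+1}$. - (f) There are $\chi,\rho$ (real polynomials in $\frac1n$), independent of $i$ and $j$, such that for all $i\ne j$ the monomials of $\mathcal P$ that depend only on $(b_i,\bar b_i),(b_j,\bar b_j)$ and are exactly of degree two in $(b_i,\bar b_i)$ add up to $\chi|b_j|^{2d-2}|b_i|^2$ if $|i-j|\neq1$, and to $\chi|b_j|^{2d-2}|b_i|^2+\rho|b_j|^{2d-4}\mathrm{Re}(b_i^2\bar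 b_j^2)$ if $|i-j|=1$. **Theorem.** For every $d\ge2$ there is a constant $K$ such that for every $s>1$ there is $N_0$ such that for every $N\ge N_0$ there exist infinitely many acceptable sets $\mathcal S\subset\mathbb Z^2$ for $d,N,s,K$. -/

import Mathlib

/-! ### Hamiltonian systems in complex coordinates -/

/-- The derivative `∂H/∂ū` at the point `r` in the coordinate direction `v`: for `u = x + i y` it
is `(1/2) (∂H/∂x + i ∂H/∂y)`. -/
noncomputable def wirtingerBar {E : Type*} [NormedAddCommGroup E] [NormedSpace ℂ E]
    (H : E → ℂ) (v r : E) : ℂ :=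
  (1 / 2 : ℂ) * (deriv (fun t : ℝ => H (r + (t : ℂ) • v)) 0 +
    Complex.I * deriv (fun t : ℝ => H (r + ((t : ℂ) * Complex.I) • v)) 0)

/-- `u` solves on the set `I` of times Hamilton's equations `u̇_k = 2 i ∂H/∂ū_k` of the Hamiltonian
`H` for the symplectic form `(i/2) ∑_k du_k ∧ dū_k`. Here `e k` is the `k`-th coordinate vector of
the phase space `E` and `coord r k` is the `k`-th coordinate of the point `r`. -/
def IsHamiltonianOrbit {E κ : Type*} [NormedAddCommGroup E] [NormedSpace ℂ E]
    (H : E → ℂ) (e : κ → E) (coord : E → κ → ℂ) (u : ℝ → E) (I : Set ℝ) : Prop :=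
  ∀ t ∈ I, ∃ w : E, (∀ k, coord w k = 2 * Complex.I * wirtingerBar H (e k) (u t)) ∧
    HasDerivAt u w t

/-- `U` is invariant under the flow of `H`: an orbit that meets `U` at some time lies in `U` during
its whole (open) interval of existence. -/
def IsFlowInvariant {E κ : Type*} [NormedAddCommGroup E] [NormedSpace ℂ E]
    (H : E → ℂ) (e : κ → E) (coord : E → κ → ℂ) (U : Set E) : Prop :=
  ∀ (T₁ T₂ : ℝ) (u : ℝ → E), IsHamiltonianOrbit H e coord u (Set.Ioo T₁ T₂) →
    ∀ t₀ ∈ Set.Ioo T₁ T₂, u t₀ ∈ U → ∀ t ∈ Set.Ioo T₁ T₂, u t ∈ U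

/-! ### The resonant Hamiltonian on `ℓ¹(ℤ²)` -/

/-- The phase space `ℓ¹(ℤ², ℂ)`. -/
abbrev EllOne : Type := lp (fun _ : ℤ × ℤ => ℂ) 1

/-- The squared Euclidean length `|k|²` of a frequency `k ∈ ℤ²`. -/
def modeNormSq (k : ℤ × ℤ) : ℤ := k.1 ^ 2 + k.2 ^ 2

/-- `(k_1, …, k_{2d})` is a resonance of order `d`; the tuple is indexed from `0`, which changes
the alternating sums only by a global sign. -/
def IsResonance (d : ℕ) (k : Fin (2 * d) → ℤ × ℤ) : Prop :=
  (∑ i : Fin (2 * d), (-1 : ℤ) ^ (i : ℕ) • k i = 0) ∧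
    (∑ i : Fin (2 * d), (-1 : ℤ) ^ (i : ℕ) * modeNormSq (k i) = 0)

/-- The resonant Hamiltonian
`H_Res(r) = ∑ r_{k_1} r̄_{k_2} r_{k_3} r̄_{k_4} ⋯ r_{k_{2d-1}} r̄_{k_{2d}}`, the sum being over all
resonances of order `d`. -/
noncomputable def HRes (d : ℕ) (r : EllOne) : ℂ :=
  ∑' k : {k : Fin (2 * d) → ℤ × ℤ // IsResonance d k},
    ∏ i : Fin (2 * d), if Even (i : ℕ) then r (k.1 i) else (starRingEnd ℂ) (r (k.1 i))

/-- The coordinate vectors of `ℓ¹(ℤ²)`. -/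
noncomputable def modeVector (k : ℤ × ℤ) : EllOne := lp.single 1 k (1 : ℂ)

/-- The `k`-th Fourier coefficient. -/
def modeCoord (r : EllOne) (k : ℤ × ℤ) : ℂ := r k

/-- `r` is an orbit of the resonant Hamiltonian on the set `I` of times. -/
def IsResOrbit (d : ℕ) (r : ℝ → EllOne) (I : Set ℝ) : Prop :=
  IsHamiltonianOrbit (HRes d) modeVector modeCoord r I

/-- Invariance under the flow of the resonant Hamiltonian. -/
def IsResInvariant (d : ℕ) (U : Set EllOne) : Prop :=
  IsFlowInvariant (HRes d) modeVector modeCoord U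

/-! ### Generations

The generations are indexed by `Fin N`, so that `gen i` is the generation number `i + 1`. -/

/-- The common cardinality `n = 2^(N-1)` of the generations. -/
def genCard (N : ℕ) : ℕ := 2 ^ (N - 1)

/-- The space `U_S` of all `r` that vanish outside the union of the generations and are constant
on each generation. -/
def equalModes {N : ℕ} (gen : Fin N → Finset (ℤ × ℤ)) : Set EllOne :=
  {r | (∀ k, (∀ i, k ∉ gen i) → r k = 0) ∧ ∀ i, ∀ l ∈ gen i, ∀ j ∈ gen i, r l = r j}

/-- The coordinates on `U_S`: `b` is sent to the `r` with `r_k = b_i` for all `k` in the `i`-th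
generation and `r_k = 0` for all other `k`. -/
noncomputable def fromGen {N : ℕ} (gen : Fin N → Finset (ℤ × ℤ)) (b : Fin N → ℂ) : EllOne :=
  ∑ i, ∑ k ∈ gen i, lp.single 1 k (b i)

/-- The norm explosion property
`(∑_{k ∈ S_{N-2}} |k|^{2s}) / (∑_{k ∈ S_3} |k|^{2s}) > 2^{(N-6)(s-1)}`. -/
def NormExplosion (N : ℕ) (s : ℝ) (gen : Fin N → Finset (ℤ × ℤ)) : Prop :=
  ∀ i j : Fin N, (i : ℕ) + 1 = N - 2 → (j : ℕ) + 1 = 3 →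
    (2 : ℝ) ^ (((N : ℝ) - 6) * (s - 1)) <
      (∑ k ∈ gen i, (modeNormSq k : ℝ) ^ s) / (∑ k ∈ gen j, (modeNormSq k : ℝ) ^ s)

/-! ### The toy model -/

/-- Real polynomials in `b`, `b̄` and one further variable that stands for `1/n`: polynomials in
the variables `b_i` (`Sum.inl i`) and `b̄_i` (`Sum.inr i`) whose coefficients are real polynomials
in `1/n`. -/
abbrev ToyPoly (N : ℕ) : Type := MvPolynomial (Fin N ⊕ Fin N) (Polynomial ℝ)

namespace ToyPoly

/-- The variable `b_i`. -/
noncomputable def b {N : ℕ} (i : Fin N) : ToyPoly N := MvPolynomial.X (Sum.inl i)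

/-- The variable `b̄_i`. -/
noncomputable def bbar {N : ℕ} (i : Fin N) : ToyPoly N := MvPolynomial.X (Sum.inr i)

/-- The value `P(b, b̄, 1/n)`. -/
noncomputable def value {N : ℕ} (P : ToyPoly N) (z : Fin N → ℂ) : ℂ :=
  MvPolynomial.eval₂ (Polynomial.aeval (R := ℝ) (1 / (genCard N : ℂ))).toRingHom
    (Sum.elim z (fun i => (starRingEnd ℂ) (z i))) P

/-- The Poisson bracket of the form `(i/2) ∑ db_j ∧ db̄_j`, up to a nonzero constant factor. -/
noncomputable def poisson {N : ℕ} (F G : ToyPoly N) : ToyPoly N :=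
  ∑ j, (MvPolynomial.pderiv (Sum.inl j) F * MvPolynomial.pderiv (Sum.inr j) G -
    MvPolynomial.pderiv (Sum.inr j) F * MvPolynomial.pderiv (Sum.inl j) G)

/-- The mass `J = ∑ |b_i|²`. -/
noncomputable def mass (N : ℕ) : ToyPoly N := ∑ i, b i * bbar i

/-- The part of `P` made of the monomials which depend only on `(b_i, b̄_i), (b_j, b̄_j)` and are
exactly of degree two in `(b_i, b̄_i)`. -/
noncomputable def pairPart {N : ℕ} (P : ToyPoly N) (i j : Fin N) : ToyPoly N :=
  ∑ m ∈ P.support with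
      ((∀ l, l ≠ i → l ≠ j → m (Sum.inl l) = 0 ∧ m (Sum.inr l) = 0) ∧
        m (Sum.inl i) + m (Sum.inr i) = 2),
    MvPolynomial.monomial m (MvPolynomial.coeff m P)

end ToyPoly

/-- The toy model Hamiltonian with remainder polynomial `P`,
`d! n^{d-1} J^d + n^{d-2} d! d (d-1) { J^{d-2} [ -(1/4) ∑ |b_i|⁴ + ∑_{i<N} Re (b_i² b̄_{i+1}²) ]
  + (1/n) P(b, b̄, 1/n) }` with `J = ∑ |b_i|²` and `n = 2^(N-1)`; it is used for `d ≥ 2`. -/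
noncomputable def toyHam (d : ℕ) {N : ℕ} (P : ToyPoly N) (z : Fin N → ℂ) : ℂ :=
  (d.factorial : ℂ) * (genCard N : ℂ) ^ (d - 1) * ((∑ i, ‖z i‖ ^ 2 : ℝ) : ℂ) ^ d +
    (genCard N : ℂ) ^ (d - 2) * (d.factorial : ℂ) * (d : ℂ) * ((d : ℂ) - 1) *
      (((∑ i, ‖z i‖ ^ 2 : ℝ) : ℂ) ^ (d - 2) *
          ((-(1 / 4) * ∑ i, ‖z i‖ ^ 4 +
            ∑ p : Fin N × Fin N with (p.1 : ℕ) + 1 = (p.2 : ℕ),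
              (z p.1 ^ 2 * (starRingEnd ℂ) (z p.2) ^ 2).re : ℝ) : ℂ) +
        1 / (genCard N : ℂ) * P.value z)

/-- The coordinate vectors of `ℂ^N`. -/
noncomputable def genVector {N : ℕ} (i : Fin N) : Fin N → ℂ := Pi.single i 1

/-- `z` is an orbit of the Hamiltonian `h` on `ℂ^N`. -/
def IsToyOrbit {N : ℕ} (h : (Fin N → ℂ) → ℂ) (z : ℝ → Fin N → ℂ) (I : Set ℝ) : Prop :=
  IsHamiltonianOrbit h genVector (fun w i => w i) z I

/-- Invariance under the flow of the Hamiltonian `h` on `ℂ^N`. -/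
def IsToyInvariant {N : ℕ} (h : (Fin N → ℂ) → ℂ) (U : Set (Fin N → ℂ)) : Prop :=
  IsFlowInvariant h genVector (fun w i => w i) U

/-- The point of `ℂ^N` with the values `x`, `y` at `j`, `j'` and zero elsewhere. -/
noncomputable def twoModes {N : ℕ} (j j' : Fin N) (x y : ℂ) : Fin N → ℂ :=
  Pi.single j x + Pi.single j' y

/-- The properties of the remainder polynomial `P` of the toy model of the generations `gen`.
The real number `K` bounds the coefficients of `P`. -/
structure IsToyRemainder (d N : ℕ) (K : ℝ) (gen : Fin N → Finset (ℤ × ℤ)) (P : ToyPoly N) :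
    Prop where
  /-- (a) `P` is homogeneous of degree `2d` in `(b, b̄)`. -/
  homogeneous : P.IsHomogeneous (2 * d)
  /-- The real coefficients of `P`, as a polynomial in `(b, b̄, 1/n)`, are bounded by `K`. -/
  bounded : ∀ (m : (Fin N ⊕ Fin N) →₀ ℕ) (q : ℕ), |(MvPolynomial.coeff m P).coeff q| ≤ K
  /-- (b) `P(b, b̄, 1/n) = P(b̄, b, 1/n)`. -/
  real : MvPolynomial.rename Sum.swap P = P
  /-- (c) `P` Poisson commutes with the mass. -/
  gauge : ToyPoly.poisson P (ToyPoly.mass N) = 0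
  /-- (d) All monomials of `P` are of even degree in each `(b_i, b̄_i)`. -/
  even : ∀ m ∈ P.support, ∀ i : Fin N, Even (m (Sum.inl i) + m (Sum.inr i))
  /-- (d) The subspaces `{b_i = 0}` are invariant under the flow of the toy model. -/
  zero_invariant : ∀ i : Fin N, IsToyInvariant (toyHam d P) {z | z i = 0}
  /-- (e) The subspaces of `U_S` where only two consecutive generations are nonzero are invariant
  under the flow of `H_Res`. -/
  pair_invariant : ∀ j j' : Fin N, (j : ℕ) + 1 = j' →
    IsResInvariant d (fromGen gen '' {z | ∀ i, i ≠ j → i ≠ j' → z i = 0})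
  /-- (e) The pullback of `H_Res` to these subspaces does not depend on `j`. -/
  pair_translation : ∀ j j' l l' : Fin N, (j : ℕ) + 1 = j' → (l : ℕ) + 1 = l' → ∀ x y : ℂ,
    HRes d (fromGen gen (twoModes j j' x y)) = HRes d (fromGen gen (twoModes l l' x y))
  /-- (e) The pullback is symmetric under the exchange of the two generations. -/
  pair_symmetric : ∀ j j' : Fin N, (j : ℕ) + 1 = j' → ∀ x y : ℂ,
    HRes d (fromGen gen (twoModes j j' x y)) = HRes d (fromGen gen (twoModes j j' y x))
  /-- (f) The monomials in two generations `i ≠ j` of degree two in `(b_i, b̄_i)` add up to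
  `χ |b_j|^{2d-2} |b_i|²` if `|i - j| ≠ 1`, and to
  `χ |b_j|^{2d-2} |b_i|² + ρ |b_j|^{2d-4} Re (b_i² b̄_j²)` if `|i - j| = 1`, where `χ` and `ρ` do
  not depend on `i`, `j`. -/
  pair_monomials : ∃ χ ρ : Polynomial ℝ, ∀ i j : Fin N, i ≠ j →
    P.pairPart i j =
      MvPolynomial.C χ * (ToyPoly.b j * ToyPoly.bbar j) ^ (d - 1) *
          (ToyPoly.b i * ToyPoly.bbar i) +
        if (i : ℕ) + 1 = j ∨ (j : ℕ) + 1 = i then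
          MvPolynomial.C (Polynomial.C (1 / 2) * ρ) *
            (ToyPoly.b j * ToyPoly.bbar j) ^ (d - 2) *
            (ToyPoly.b i ^ 2 * ToyPoly.bbar j ^ 2 + ToyPoly.bbar i ^ 2 * ToyPoly.b j ^ 2)
        else 0

/-- The set `S ⊂ ℤ²` is acceptable, for the degree `d`, the number `N` of generations and the
Sobolev exponent `s`, with a remainder polynomial whose coefficients are bounded by `K`. -/
def IsAcceptable (d N : ℕ) (s K : ℝ) (S : Set (ℤ × ℤ)) : Prop :=
  ∃ gen : Fin N → Finset (ℤ × ℤ),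
    -- 1. disjoint union of `N` generations of cardinality `2^(N-1)`
    S = (⋃ i, (gen i : Set (ℤ × ℤ))) ∧
    (∀ i j, i ≠ j → Disjoint (gen i) (gen j)) ∧
    (∀ i, (gen i).card = genCard N) ∧
    -- 2. norm explosion
    NormExplosion N s gen ∧
    -- 3. intra-generational equality is preserved by the flow
    IsResInvariant d (equalModes gen) ∧
    -- 4. the restricted flow is the Hamiltonian flow of the toy model; the factor `n` is that
    -- between the restricted symplectic form and `(i/2) ∑ db_j ∧ db̄_j`
    ∃ P : ToyPoly N,
      (∀ (T₁ T₂ : ℝ) (z : ℝ → Fin N → ℂ),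
        IsResOrbit d (fun t => fromGen gen (z t)) (Set.Ioo T₁ T₂) ↔
          IsToyOrbit (toyHam d P) z (Set.Ioo T₁ T₂)) ∧
      (∀ z : Fin N → ℂ, HRes d (fromGen gen z) = (genCard N : ℂ) * toyHam d P z) ∧
      IsToyRemainder d N K gen P

open scoped ENNReal

/-! ### The multilinear form of the resonant Hamiltonian -/

/-! Write M = N − 1, so that n = 2^M. The points of S are labelled by a generation l ∈ {0, …, M} and
a label v in the cube (ℤ/2)^M. The points (m, v), (m, v + e_m) are the parents and (m + 1, v), (m +
1, v + e_m) the children of a nuclear family. Parents and children are to be the two diagonals of a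
rectangle, which makes every family a resonance. The proof has a geometric and a combinatorial half,
which meet in `IsFamilySet`: for coefficients up to 2d the linear relations among the frequencies
are exactly the integer combinations of families, and a frequency that completes 2d − 1 members of S
to a resonance lies in S. Combinations of families are handled in the dual form `IsRelOn`: the
coefficients over each label add up to zero, and the partial sums through generation m are invariant
under v ↦ v + e_m.

Geometry. Children arise from their parents by a rotation about the common centre. The positions of
the first generation and the rational rotation parameters are chosen one at a time. Each of the
finitely many bounded coefficient vectors excludes only finitely many parameters, unless the
families force its relation (`exists_generic_shift`, `finite_not_genericOn_insert`). Hence generic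
rational configurations exist arbitrarily near any prototype with rational coordinates. In the
prototype used here every rotation is by a right angle, and generation l has 2^(M−l) points of
squared length 2^l, the others sitting at 0. Its Sobolev quotient 2^((M−4)(s−1)) exceeds the
required 2^((M−5)(s−1)), and this survives small perturbations (`exists_explosion`). Clearing
denominators and taking integer multiples gives infinitely many sets.

Dynamics. One entry of a resonance is determined by the others, so the gradient of H_Res is locally
Lipschitz on ℓ¹. A subspace cut out by a bounded projection, to which the gradient is tangent, is
then invariant by Grönwall's inequality, without any well-posedness theory. Tangency follows from
three facts: S is closed under completing resonances, translations of the labels preserve relations,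
and every relation has even total coefficient in each generation (`IsRel.even_sum`).

Combinatorics. On U_S the Hamiltonian is the sum of the monomials of all tuples (y, y') whose vector
is a relation. Such a relation matches the labels of y with those of y'. If at most one pair of
labels of y coincides modulo the directions of the families that meet the generations of the tuple,
then the tuple is a pairing, or a pairing except for one family (`IsRel.exists_perm`,
`IsRelOn.isFam_of_quad`). The function `weight` equals 1 on all these tuples and has an explicit sum
(`sum_weight`), which is the leading part of the toy Hamiltonian. For given generations only
O(n^(d−2)) tuples remain, with a constant depending on d alone (`abs_excess_le`). After division by
n^(d−2) d! d(d−1) they form the polynomial `remainder`, whose coefficients are bounded independently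
of N and s. Its structural properties are symmetries of the count `excess`: exchange of r and r̄,
bidegree (d, d), parity, and relabelling of generations and directions. -/

theorem ENNReal.tsum_pi_prod_fin {α : Type*} (n : ℕ) (f : Fin n → α → ℝ≥0∞) :
    ∑' k : Fin n → α, ∏ i, f i (k i) = ∏ i, ∑' a, f i a := by
  induction n with
  | zero => simp [tsum_fintype]
  | succ n ih =>
    rw [← (Fin.consEquiv fun _ => α).tsum_eq, Fin.prod_univ_succ, ← ih]
    simp only [Fin.consEquiv_apply, Fin.prod_univ_succ, Fin.cons_zero, Fin.cons_succ]
    rw [ENNReal.tsum_prod (f := fun a (k : Fin n → α) => f 0 a * ∏ i : Fin n, f i.succ (k i))]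
    simp only [ENNReal.tsum_mul_left, ENNReal.tsum_mul_right]

theorem ENNReal.tsum_pi_prod {ι α : Type*} [Fintype ι] (f : ι → α → ℝ≥0∞) :
    ∑' k : ι → α, ∏ i, f i (k i) = ∏ i, ∑' a, f i a := by
  let e := Fintype.equivFin ι
  rw [← (Equiv.arrowCongr e (Equiv.refl α)).symm.tsum_eq, ← e.symm.prod_comp,
    ← ENNReal.tsum_pi_prod_fin]
  refine tsum_congr fun k => ?_
  rw [← e.symm.prod_comp]
  simp [Equiv.arrowCongr]

theorem enorm_finset_prod {ι : Type*} (s : Finset ι) (f : ι → ℂ) :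
    ‖∏ i ∈ s, f i‖ₑ = ∏ i ∈ s, ‖f i‖ₑ := by
  simp only [enorm_eq_nnnorm, nnnorm_prod, ENNReal.ofNNReal_finsetProd]

theorem EllOne.tsum_enorm (r : EllOne) : ∑' k, ‖r k‖ₑ = ‖r‖ₑ := by
  have h : HasSum (fun k => ‖r k‖) ‖r‖ := by
    have := lp.hasSum_norm (p := 1) (by simp) r
    simpa using this
  rw [← ofReal_norm, ← h.tsum_eq, ENNReal.ofReal_tsum_of_nonneg (fun _ => norm_nonneg _) h.summable]
  simp

theorem EllOne.enorm_apply_le (r : EllOne) (k : ℤ × ℤ) : ‖r k‖ₑ ≤ ‖r‖ₑ :=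
  enorm_le_iff_norm_le.2 (lp.norm_apply_le_norm (by simp) _ _)

theorem IsResonance.ext_off {d : ℕ} {k l : Fin (2 * d) → ℤ × ℤ} (hk : IsResonance d k)
    (hl : IsResonance d l) {i : Fin (2 * d)} (h : ∀ j, j ≠ i → k j = l j) : k = l := by
  have h1 := hk.1.trans hl.1.symm
  rw [← Finset.add_sum_erase _ _ (Finset.mem_univ i),
    ← Finset.add_sum_erase _ _ (Finset.mem_univ i),
    Finset.sum_congr rfl fun j hj => by rw [h j (Finset.ne_of_mem_erase hj)],
    add_left_inj] at h1
  have h2 : k i = l i := by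
    rcases neg_one_pow_eq_or ℤ (i : ℕ) with h | h <;> simpa [h] using h1
  funext j
  by_cases hj : j = i
  · rw [hj, h2]
  · exact h j hj

/-- The momentum condition recovers the deleted entry from the remaining ones. Dropping it is
therefore injective on resonances, and the sum is dominated by an unrestricted one, which
factorizes. All ℓ¹ bounds on `HRes` and its gradient rest on this. -/
theorem tsum_resonance_le {d : ℕ} (i : Fin (2 * d)) (h : Fin (2 * d) → ℤ × ℤ → ℝ≥0∞) :
    ∑' k : {k // IsResonance d k}, ∏ j ∈ Finset.univ.erase i, h j (k.1 j) ≤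
      ∏ j ∈ Finset.univ.erase i, ∑' a, h j a := by
  let φ : {k // IsResonance d k} → {j // j ≠ i} → ℤ × ℤ := fun k j => k.1 j
  have hφ : Function.Injective φ := fun k l hkl =>
    Subtype.ext (k.2.ext_off l.2 (i := i) fun j hj => congrFun hkl ⟨j, hj⟩)
  have := ENNReal.tsum_comp_le_tsum_of_injective hφ
    (fun k : {j // j ≠ i} → ℤ × ℤ => ∏ j : {j // j ≠ i}, h j (k j))
  rw [ENNReal.tsum_pi_prod (fun j : {j // j ≠ i} => h j)] at this
  refine le_trans (le_of_eq (tsum_congr fun k => ?_)) (this.trans (le_of_eq ?_))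
  · exact Finset.prod_subtype _ (by simp) fun j => h j (k.1 j)
  · exact (Finset.prod_subtype _ (by simp) fun j => ∑' a, h j a).symm

theorem tsum_resonance_enorm_le {d : ℕ} (hd : 0 < d) (h : Fin (2 * d) → EllOne) :
    ∑' k : {k // IsResonance d k}, ‖∏ j, h j (k.1 j)‖ₑ ≤ ∏ j, ‖h j‖ₑ := by
  have h0 : 0 < 2 * d := by omega
  let i : Fin (2 * d) := ⟨0, h0⟩
  have h1 : ∀ k : {k // IsResonance d k}, ‖∏ j, h j (k.1 j)‖ₑ ≤
      ‖h i‖ₑ * ∏ j ∈ Finset.univ.erase i, ‖h j (k.1 j)‖ₑ := fun k => by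
    rw [← Finset.mul_prod_erase _ _ (Finset.mem_univ i), enorm_mul, enorm_finset_prod]
    gcongr
    exact EllOne.enorm_apply_le _ _
  refine (ENNReal.tsum_le_tsum h1).trans ?_
  rw [ENNReal.tsum_mul_left, ← Finset.mul_prod_erase _ _ (Finset.mem_univ i)]
  gcongr
  refine (tsum_resonance_le i fun j a => ‖h j a‖ₑ).trans ?_
  simp [EllOne.tsum_enorm]

theorem summable_of_tsum_enorm {α : Type*} {f : α → ℂ} (h : ∑' a, ‖f a‖ₑ ≠ ∞) : Summable f := by
  refine Summable.of_nnnorm ?_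
  rw [← ENNReal.tsum_coe_ne_top_iff_summable]
  exact h

theorem summable_resonance {d : ℕ} (hd : 0 < d) (h : Fin (2 * d) → EllOne) :
    Summable fun k : {k // IsResonance d k} => ∏ j, h j (k.1 j) :=
  summable_of_tsum_enorm ((tsum_resonance_enorm_le hd h).trans_lt
    (ENNReal.prod_lt_top fun _ _ => enorm_lt_top)).ne

theorem prod_update_apply {d : ℕ} (f : Fin (2 * d) → EllOne) (i : Fin (2 * d)) (x : EllOne)
    (k : Fin (2 * d) → ℤ × ℤ) :
    ∏ j, Function.update f i x j (k j) = x (k i) * ∏ j ∈ Finset.univ.erase i, f j (k j) := by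
  rw [← Finset.mul_prod_erase _ _ (Finset.mem_univ i), Function.update_self]
  congr 1
  exact Finset.prod_congr rfl fun j hj => by
    rw [Function.update_of_ne (Finset.ne_of_mem_erase hj)]

/-- The multilinear form with `H_Res(r) = resForm (r, r̄, r, r̄, …)`. -/
noncomputable def resForm (d : ℕ) (hd : 0 < d) :
    ContinuousMultilinearMap ℂ (fun _ : Fin (2 * d) => EllOne) ℂ :=
  MultilinearMap.mkContinuous
    { toFun := fun f => ∑' k : {k // IsResonance d k}, ∏ j, f j (k.1 j)
      map_update_add' := fun {inst} f i x y => by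
        obtain rfl := Subsingleton.elim inst (instDecidableEqFin _)
        rw [← (summable_resonance hd _).tsum_add (summable_resonance hd _)]
        simp only [prod_update_apply, lp.coeFn_add, Pi.add_apply, add_mul]
      map_update_smul' := fun {inst} f i c x => by
        obtain rfl := Subsingleton.elim inst (instDecidableEqFin _)
        rw [smul_eq_mul, ← tsum_mul_left]
        simp only [prod_update_apply, lp.coeFn_smul, Pi.smul_apply, smul_eq_mul, mul_assoc] }
    1 (fun f => by
      have h1 := (enorm_tsum_le_tsum_enorm (f := fun k : {k // IsResonance d k} =>
        ∏ j, f j (k.1 j))).trans (tsum_resonance_enorm_le hd f)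
      have h2 : ∏ j, ‖f j‖ₑ = ENNReal.ofReal (∏ j, ‖f j‖) := by
        rw [ENNReal.ofReal_prod_of_nonneg fun _ _ => norm_nonneg _]
        simp
      rw [h2, ← ofReal_norm, ENNReal.ofReal_le_ofReal_iff (by positivity)] at h1
      rw [one_mul]
      exact h1)

theorem resForm_apply {d : ℕ} (hd : 0 < d) (f : Fin (2 * d) → EllOne) :
    resForm d hd f = ∑' k : {k // IsResonance d k}, ∏ j, f j (k.1 j) := rfl

/-- The arguments `(r, r̄, r, r̄, …)`. -/
noncomputable def slots (d : ℕ) (r : EllOne) : Fin (2 * d) → EllOne :=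
  fun j => if Even (j : ℕ) then r else star r

theorem slots_apply {d : ℕ} (r : EllOne) (j : Fin (2 * d)) (k : ℤ × ℤ) :
    slots d r j k = if Even (j : ℕ) then r k else (starRingEnd ℂ) (r k) := by
  unfold slots; split_ifs <;> rfl

theorem HRes_eq_resForm {d : ℕ} (hd : 0 < d) (r : EllOne) :
    HRes d r = resForm d hd (slots d r) := by
  simp only [resForm_apply, slots_apply]; rfl

theorem slots_add_smul {d : ℕ} (r v : EllOne) (t : ℝ) :
    slots d (r + (t : ℂ) • v) = slots d r + (t : ℂ) • slots d v := by
  funext j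
  simp only [slots, Pi.add_apply, Pi.smul_apply]
  split_ifs
  · rfl
  · rw [star_add, star_smul]; simp

/-- For real t the conjugated slots are affine in t as well, so t can be replaced by a complex
variable and the derivative is that of a multilinear form along a complex line. -/
theorem deriv_HRes {d : ℕ} (hd : 0 < d) (r v : EllOne) :
    deriv (fun t : ℝ => HRes d (r + (t : ℂ) • v)) 0 =
      ∑ i, resForm d hd (Function.update (slots d r) i (slots d v i)) := by
  simp only [HRes_eq_resForm hd, slots_add_smul]
  have h1 : HasDerivAt (fun z : ℂ => resForm d hd (slots d r + z • slots d v))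
      (∑ i, resForm d hd (Function.update (slots d r) i (slots d v i))) ((0 : ℝ) : ℂ) := by
    have h2 : HasDerivAt (fun z : ℂ => slots d r + z • slots d v) (slots d v) ((0 : ℝ) : ℂ) := by
      simpa using ((hasDerivAt_id (((0 : ℝ) : ℂ))).smul_const (slots d v)).const_add (slots d r)
    have h3 := ((resForm d hd).hasFDerivAt (slots d r + ((0 : ℝ) : ℂ) • slots d v)).comp_hasDerivAt
      _ h2
    simpa [Function.comp_def, ContinuousMultilinearMap.linearDeriv_apply] using h3
  exact h1.comp_ofReal.deriv

theorem slots_I_smul {d : ℕ} (v : EllOne) (j : Fin (2 * d)) :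
    slots d (Complex.I • v) j =
      (if Even (j : ℕ) then Complex.I else -Complex.I) • slots d v j := by
  unfold slots
  split_ifs
  · rfl
  · rw [star_smul]; simp

/-- Passing from v to i v multiplies a slot of r by i and a slot of r̄ by −i. In the Wirtinger
combination the former cancel and the latter double. -/
theorem wirtingerBar_HRes {d : ℕ} (hd : 0 < d) (r v : EllOne) :
    wirtingerBar (HRes d) v r =
      ∑ i with ¬ Even (Fin.val i),
        resForm d hd (Function.update (slots d r) i (star v)) := by
  unfold wirtingerBar
  simp only [← smul_smul]
  rw [deriv_HRes hd, deriv_HRes hd, Finset.mul_sum, ← Finset.sum_add_distrib, Finset.mul_sum,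
    Finset.sum_filter]
  refine Finset.sum_congr rfl fun i _ => ?_
  rw [slots_I_smul, ContinuousMultilinearMap.map_update_smul, smul_eq_mul]
  by_cases hi : Even (i : ℕ)
  · simp only [hi, if_true, not_true, if_false]
    linear_combination (1 / 2 : ℂ) *
      resForm d hd (Function.update (slots d r) i (slots d v i)) * Complex.I_mul_I
  · simp only [hi, if_false, not_false_iff, if_true]
    have : slots d v i = star v := by simp [slots, hi]
    rw [this]
    linear_combination -(1 / 2 : ℂ) *
      resForm d hd (Function.update (slots d r) i (star v)) * Complex.I_mul_I

theorem wirtingerBar_HRes_sum {d : ℕ} (hd : 0 < d) {ι : Type*} (s : Finset ι) (v : ι → EllOne)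
    (r : EllOne) :
    wirtingerBar (HRes d) (∑ a ∈ s, v a) r = ∑ a ∈ s, wirtingerBar (HRes d) (v a) r := by
  have h : ∀ i : Fin (2 * d), resForm d hd (Function.update (slots d r) i (star (∑ a ∈ s, v a))) =
      ∑ a ∈ s, resForm d hd (Function.update (slots d r) i (star (v a))) := fun i => by
    rw [star_sum]
    exact map_sum ((resForm d hd).toContinuousLinearMap (slots d r) i) _ _
  simp only [wirtingerBar_HRes hd, h]
  rw [Finset.sum_comm]

theorem star_modeVector (k : ℤ × ℤ) : star (modeVector k) = modeVector k := by
  ext l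
  rw [lp.star_apply, modeVector, lp.single_apply]
  by_cases h : l = k
  · subst h; simp
  · simp [Pi.single_eq_of_ne h]

theorem modeVector_apply (k l : ℤ × ℤ) : modeVector k l = if l = k then 1 else 0 := by
  rw [modeVector, lp.single_apply, Pi.single_apply]

/-- The formula for `∂H_Res/∂r̄_k`. -/
theorem wirtingerBar_HRes_mode {d : ℕ} (hd : 0 < d) (r : EllOne) (k : ℤ × ℤ) :
    wirtingerBar (HRes d) (modeVector k) r =
      ∑ i with ¬ Even (Fin.val i), ∑' l : {l // IsResonance d l},
        modeVector k (l.1 i) * ∏ j ∈ Finset.univ.erase i, slots d r j (l.1 j) := by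
  rw [wirtingerBar_HRes hd, star_modeVector]
  simp only [resForm_apply, prod_update_apply]

/-- Telescoping, with every unchanged factor enlarged to ‖x‖ + ‖y‖. Each summand is then a product
of functions of one entry, as `tsum_resonance_le` requires. -/
theorem enorm_prod_sub_prod_le {ι : Type*} [DecidableEq ι] (s : Finset ι) (x y : ι → ℂ) :
    ‖∏ i ∈ s, x i - ∏ i ∈ s, y i‖ₑ ≤
      ∑ j ∈ s, ∏ i ∈ s, if i = j then ‖x i - y i‖ₑ else ‖x i‖ₑ + ‖y i‖ₑ := by
  induction s using Finset.induction_on with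
  | empty => simp
  | insert a s ha ih =>
    have e : ∏ i ∈ insert a s, x i - ∏ i ∈ insert a s, y i =
        (x a - y a) * ∏ i ∈ s, x i + y a * (∏ i ∈ s, x i - ∏ i ∈ s, y i) := by
      rw [Finset.prod_insert ha, Finset.prod_insert ha]; ring
    rw [e, Finset.sum_insert ha]
    refine (enorm_add_le _ _).trans (add_le_add ?_ ?_)
    · rw [Finset.prod_insert ha, if_pos rfl, enorm_mul, enorm_finset_prod]
      gcongr with i hi
      rw [if_neg (by rintro rfl; exact ha hi)]
      exact le_self_add
    · rw [enorm_mul]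
      refine (mul_le_mul_right ih _).trans ?_
      rw [Finset.mul_sum]
      refine Finset.sum_le_sum fun j hj => ?_
      rw [Finset.prod_insert ha, if_neg (by rintro rfl; exact ha hj)]
      gcongr
      exact le_add_self

theorem enorm_slots_sub {d : ℕ} (u u' : EllOne) (j : Fin (2 * d)) (k : ℤ × ℤ) :
    ‖slots d u j k - slots d u' j k‖ₑ = ‖(u - u') k‖ₑ := by
  rw [slots_apply, slots_apply]
  split_ifs
  · rfl
  · rw [← map_sub]
    exact enorm_eq_iff_norm_eq.2 (RCLike.norm_conj _)

theorem enorm_slots {d : ℕ} (u : EllOne) (j : Fin (2 * d)) (k : ℤ × ℤ) :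
    ‖slots d u j k‖ₑ = ‖u k‖ₑ := by
  rw [slots_apply]
  split_ifs
  · rfl
  · exact enorm_eq_iff_norm_eq.2 (RCLike.norm_conj _)

theorem tsum_prod_sub_prod_le {d : ℕ} (i : Fin (2 * d)) (u u' : EllOne) {R : ℝ≥0∞}
    (hu : ‖u‖ₑ ≤ R) (hu' : ‖u'‖ₑ ≤ R) :
    ∑' l : {l // IsResonance d l}, ‖∏ j ∈ Finset.univ.erase i, slots d u j (l.1 j) -
      ∏ j ∈ Finset.univ.erase i, slots d u' j (l.1 j)‖ₑ ≤
      (2 * d) * (‖u - u'‖ₑ * (R + R) ^ (2 * d - 2)) := by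
  refine (ENNReal.tsum_le_tsum fun l => enorm_prod_sub_prod_le _ _ _).trans ?_
  rw [Summable.tsum_finsetSum fun _ _ => ENNReal.summable]
  have h1 : ∀ j ∈ Finset.univ.erase i, ∑' l : {l // IsResonance d l},
      (∏ m ∈ Finset.univ.erase i, if m = j then ‖slots d u m (l.1 m) - slots d u' m (l.1 m)‖ₑ
        else ‖slots d u m (l.1 m)‖ₑ + ‖slots d u' m (l.1 m)‖ₑ) ≤
      ‖u - u'‖ₑ * (R + R) ^ (2 * d - 2) := fun j hj => by
    simp only [enorm_slots_sub, enorm_slots]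
    refine (tsum_resonance_le i fun m a => if m = j then ‖(u - u') a‖ₑ
      else ‖u a‖ₑ + ‖u' a‖ₑ).trans ?_
    rw [← Finset.mul_prod_erase _ _ hj]
    simp only [if_true, EllOne.tsum_enorm]
    gcongr
    refine (Finset.prod_le_pow_card _ _ (R + R) fun m hm => ?_).trans (le_of_eq ?_)
    · simp only [if_neg (Finset.ne_of_mem_erase hm), ENNReal.tsum_add, EllOne.tsum_enorm]
      gcongr
    · rw [Finset.card_erase_of_mem hj, Finset.card_erase_of_mem (Finset.mem_univ i)]
      simp [Nat.sub_sub]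
  refine (Finset.sum_le_sum h1).trans ?_
  rw [Finset.sum_const, nsmul_eq_mul]
  gcongr
  exact_mod_cast (Finset.card_le_univ _).trans (by simp)

/-- The Lipschitz bound of the gradient in ℓ¹. Summing over k removes the constraint that slot i
equals k, which leaves a sum over resonances of a product difference with slot i deleted. -/
theorem tsum_wirtingerBar_HRes_sub_le {d : ℕ} (hd : 0 < d) (u u' : EllOne) {R : ℝ≥0∞}
    (hu : ‖u‖ₑ ≤ R) (hu' : ‖u'‖ₑ ≤ R) :
    ∑' k, ‖wirtingerBar (HRes d) (modeVector k) u - wirtingerBar (HRes d) (modeVector k) u'‖ₑ ≤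
      (2 * d) * ((2 * d) * (‖u - u'‖ₑ * (R + R) ^ (2 * d - 2))) := by
  have hs : ∀ (r : EllOne) (i : Fin (2 * d)) (k : ℤ × ℤ), Summable fun l : {l // IsResonance d l} =>
      modeVector k (l.1 i) * ∏ j ∈ Finset.univ.erase i, slots d r j (l.1 j) := fun r i k => by
    simpa only [prod_update_apply] using
      summable_resonance hd (Function.update (slots d r) i (modeVector k))
  have h1 : ∀ k, ‖wirtingerBar (HRes d) (modeVector k) u -
      wirtingerBar (HRes d) (modeVector k) u'‖ₑ ≤ ∑ i : Fin (2 * d),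
        ∑' l : {l // IsResonance d l}, (if l.1 i = k then 1 else 0) *
          ‖∏ j ∈ Finset.univ.erase i, slots d u j (l.1 j) -
            ∏ j ∈ Finset.univ.erase i, slots d u' j (l.1 j)‖ₑ := fun k => by
    rw [wirtingerBar_HRes_mode hd, wirtingerBar_HRes_mode hd, ← Finset.sum_sub_distrib]
    refine (enorm_sum_le _ _).trans ((Finset.sum_le_sum fun i _ => ?_).trans
      (Finset.sum_le_sum_of_subset (Finset.filter_subset _ _)))
    rw [← (hs u i k).tsum_sub (hs u' i k)]
    refine enorm_tsum_le_tsum_enorm.trans (ENNReal.tsum_le_tsum fun l => ?_)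
    rw [← mul_sub, enorm_mul, modeVector_apply]
    split_ifs <;> simp
  refine (ENNReal.tsum_le_tsum h1).trans ?_
  rw [Summable.tsum_finsetSum fun _ _ => ENNReal.summable]
  refine (Finset.sum_le_sum fun i _ => ?_).trans (b := ∑ i : Fin (2 * d),
    (2 * d) * (‖u - u'‖ₑ * (R + R) ^ (2 * d - 2))) (le_of_eq (by simp))
  rw [ENNReal.tsum_comm]
  refine le_trans (ENNReal.tsum_le_tsum fun l => ?_) (tsum_prod_sub_prod_le i u u' hu hu')
  rw [ENNReal.tsum_mul_right]
  simp

/-! ### Invariance of subspaces under Hamiltonian flows -/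

section Invariance

variable {E F κ : Type*} [NormedAddCommGroup E] [NormedSpace ℂ E] [NormedAddCommGroup F]
  [NormedSpace ℂ F]

theorem hasDerivAt_clm_comp (L : E →L[ℂ] F) {u : ℝ → E} {w : E} {t : ℝ} (h : HasDerivAt u w t) :
    HasDerivAt (fun s => L (u s)) (L w) t :=
  (L.restrictScalars ℝ).hasFDerivAt.comp_hasDerivAt t h

/-- Grönwall's inequality in both time directions. The constant may depend on the compact
subinterval, so bounds on balls of the phase space suffice. -/
theorem eq_zero_of_deriv_le {T₁ T₂ : ℝ} {v v' : ℝ → E} (h : ∀ t ∈ Set.Ioo T₁ T₂, HasDerivAt v (v' t) t)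
    (hb : ∀ a ∈ Set.Ioo T₁ T₂, ∀ b ∈ Set.Ioo T₁ T₂, ∃ C, ∀ t ∈ Set.Icc a b, ‖v' t‖ ≤ C * ‖v t‖)
    {t₀ : ℝ} (ht₀ : t₀ ∈ Set.Ioo T₁ T₂) (h0 : v t₀ = 0) {t : ℝ} (ht : t ∈ Set.Ioo T₁ T₂) :
    v t = 0 := by
  rcases le_total t₀ t with htt | htt
  · obtain ⟨C, hC⟩ := hb t₀ ht₀ t ht
    have hsub : ∀ x ∈ Set.Icc t₀ t, x ∈ Set.Ioo T₁ T₂ := fun x hx =>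
      ⟨ht₀.1.trans_le hx.1, hx.2.trans_lt ht.2⟩
    exact eq_zero_of_abs_deriv_le_mul_abs_self_of_eq_zero_right (K := C) (f := v) (f' := v')
      (fun x hx => (h x (hsub x hx)).continuousAt.continuousWithinAt)
      (fun x hx => (h x (hsub x (Set.Ico_subset_Icc_self hx))).hasDerivWithinAt) h0
      (fun x hx => hC x (Set.Ico_subset_Icc_self hx)) t ⟨htt, le_rfl⟩
  -- Backward in time the inequality is applied to the reflected curve s ↦ v (−s).
  · obtain ⟨C, hC⟩ := hb t ht t₀ ht₀
    have hsub : ∀ x ∈ Set.Icc (-t₀) (-t), -x ∈ Set.Icc t t₀ := fun x hx =>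
      ⟨by linarith [hx.2], by linarith [hx.1]⟩
    have hsub' : ∀ x ∈ Set.Icc t t₀, x ∈ Set.Ioo T₁ T₂ := fun x hx =>
      ⟨ht.1.trans_le hx.1, hx.2.trans_lt ht₀.2⟩
    have hd : ∀ x ∈ Set.Icc (-t₀) (-t), HasDerivAt (fun s => v (-s)) (-(v' (-x))) x := fun x hx => by
      have := (h _ (hsub' _ (hsub x hx))).scomp x (hasDerivAt_neg x)
      simpa [Function.comp_def] using this
    have := eq_zero_of_abs_deriv_le_mul_abs_self_of_eq_zero_right (K := C) (f := fun s => v (-s))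
      (f' := fun s => -(v' (-s))) (a := -t₀) (b := -t)
      (fun x hx => (hd x hx).continuousAt.continuousWithinAt)
      (fun x hx => (hd x (Set.Ico_subset_Icc_self hx)).hasDerivWithinAt) (by simpa using h0)
      (fun x hx => by
        rw [norm_neg]; exact hC _ (hsub x (Set.Ico_subset_Icc_self hx))) (-t) ⟨by linarith, le_rfl⟩
    simpa using this

/-- The transverse part u − p u of an orbit satisfies a linear differential inequality, because
orbits are bounded on compact time intervals. If it vanishes once, it vanishes throughout. -/
theorem isFlowInvariant_of_projection {H : E → ℂ} {e : κ → E} {coord : E → κ → ℂ} (p : E →L[ℂ] E)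
    (hp : ∀ R : ℝ, ∃ C : ℝ, ∀ u w : E, ‖u‖ ≤ R →
      (∀ k, coord w k = 2 * Complex.I * wirtingerBar H (e k) u) → ‖w - p w‖ ≤ C * ‖u - p u‖) :
    IsFlowInvariant H e coord {u | p u = u} := by
  intro T₁ T₂ u hu t₀ ht₀ h0 t ht
  choose! w hw hd using hu
  have hv : ∀ t ∈ Set.Ioo T₁ T₂, HasDerivAt (fun s => u s - p (u s)) (w t - p (w t)) t :=
    fun t ht => (hd t ht).sub (hasDerivAt_clm_comp p (hd t ht))
  have := eq_zero_of_deriv_le hv (fun a ha b hb => ?_) ht₀ (by simpa [sub_eq_zero] using h0.symm) ht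
  · exact (sub_eq_zero.1 this).symm
  · have hcont : ContinuousOn u (Set.Icc a b) := fun x hx =>
      (hd x ⟨ha.1.trans_le hx.1, hx.2.trans_lt hb.2⟩).continuousAt.continuousWithinAt
    obtain ⟨R, hR⟩ := isCompact_Icc.exists_bound_of_continuousOn hcont
    obtain ⟨C, hC⟩ := hp R
    exact ⟨C, fun x hx => hC _ _ (hR x hx) (hw x ⟨ha.1.trans_le hx.1, hx.2.trans_lt hb.2⟩)⟩

end Invariance

/-! ### The flow on the space of equal modes -/

section EqualModes

variable {N : ℕ} {gen : Fin N → Finset (ℤ × ℤ)}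

theorem fromGen_apply (gen : Fin N → Finset (ℤ × ℤ)) (z : Fin N → ℂ) (k : ℤ × ℤ) :
    fromGen gen z k = ∑ i, if k ∈ gen i then z i else 0 := by
  have h : ∀ i, (∑ l ∈ gen i, lp.single 1 l (z i) : EllOne) k = if k ∈ gen i then z i else 0 :=
    fun i => by
      rw [lp.coeFn_sum, Finset.sum_apply]
      simp only [lp.single_apply, Pi.single_apply]
      simp
  rw [fromGen, lp.coeFn_sum, Finset.sum_apply]
  exact Finset.sum_congr rfl fun i _ => h i

theorem fromGen_apply_of_mem (hdis : ∀ i j, i ≠ j → Disjoint (gen i) (gen j)) (z : Fin N → ℂ)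
    {i : Fin N} {k : ℤ × ℤ} (hk : k ∈ gen i) : fromGen gen z k = z i := by
  rw [fromGen_apply, Finset.sum_eq_single i, if_pos hk]
  · exact fun j _ hj => if_neg fun h => Finset.disjoint_left.1 (hdis j i hj) h hk
  · simp

theorem fromGen_apply_of_notMem (z : Fin N → ℂ) {k : ℤ × ℤ} (hk : ∀ i, k ∉ gen i) :
    fromGen gen z k = 0 := by
  rw [fromGen_apply]
  exact Finset.sum_eq_zero fun i _ => if_neg (hk i)

/-- `fromGen` as a continuous linear map. -/
noncomputable def fromGenL (gen : Fin N → Finset (ℤ × ℤ)) : (Fin N → ℂ) →L[ℂ] EllOne :=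
  LinearMap.toContinuousLinearMap
    { toFun := fromGen gen
      map_add' := fun x y => by
        ext k
        rw [lp.coeFn_add, Pi.add_apply, fromGen_apply, fromGen_apply, fromGen_apply,
          ← Finset.sum_add_distrib]
        exact Finset.sum_congr rfl fun i _ => by split_ifs <;> simp
      map_smul' := fun c x => by
        ext k
        rw [lp.coeFn_smul, Pi.smul_apply, fromGen_apply, fromGen_apply, RingHom.id_apply,
          Finset.smul_sum]
        exact Finset.sum_congr rfl fun i _ => by split_ifs <;> simp }

theorem fromGenL_apply (z : Fin N → ℂ) : fromGenL gen z = fromGen gen z := rfl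

/-- Evaluation of a sequence at finitely many modes. -/
noncomputable def evalModes (rep : Fin N → ℤ × ℤ) : EllOne →L[ℂ] (Fin N → ℂ) :=
  ContinuousLinearMap.pi fun i => lp.evalCLM ℂ (fun _ : ℤ × ℤ => ℂ) 1 (rep i)

theorem evalModes_apply (rep : Fin N → ℤ × ℤ) (r : EllOne) (i : Fin N) :
    evalModes rep r i = r (rep i) := rfl

theorem evalModes_fromGen (hdis : ∀ i j, i ≠ j → Disjoint (gen i) (gen j))
    {rep : Fin N → ℤ × ℤ} (hrep : ∀ i, rep i ∈ gen i) (z : Fin N → ℂ) :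
    evalModes rep (fromGen gen z) = z := by
  funext i
  rw [evalModes_apply, fromGen_apply_of_mem hdis z (hrep i)]

theorem equalModes_eq_range (hdis : ∀ i j, i ≠ j → Disjoint (gen i) (gen j))
    {rep : Fin N → ℤ × ℤ} (hrep : ∀ i, rep i ∈ gen i) :
    equalModes gen = fromGen gen '' {z | ∀ i, i ∉ Set.univ → z i = 0} := by
  ext r
  constructor
  · rintro ⟨h1, h2⟩
    refine ⟨evalModes rep r, by simp, ?_⟩
    ext k
    by_cases hk : ∃ i, k ∈ gen i
    · obtain ⟨i, hi⟩ := hk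
      rw [fromGen_apply_of_mem hdis _ hi, evalModes_apply, h2 i _ (hrep i) _ hi]
    · push Not at hk
      rw [fromGen_apply_of_notMem _ hk, h1 k hk]
  · rintro ⟨z, -, rfl⟩
    exact ⟨fun k hk => fromGen_apply_of_notMem z hk, fun i l hl j hj => by
      rw [fromGen_apply_of_mem hdis z hl, fromGen_apply_of_mem hdis z hj]⟩

open Classical in
-- The hypotheses say that the gradient at a point of the subspace is tangent to it: no component
-- outside the generations of A, equal components within a generation. Lipschitz continuity then
-- bounds the transverse gradient at u by the distance of u from its projection.
theorem isResInvariant_fromGen {d : ℕ} (hd : 0 < d)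
    (hdis : ∀ i j, i ≠ j → Disjoint (gen i) (gen j)) (hne : ∀ i, (gen i).Nonempty)
    (A : Set (Fin N))
    (h0 : ∀ z : Fin N → ℂ, (∀ i, i ∉ A → z i = 0) → ∀ k, (∀ i ∈ A, k ∉ gen i) →
      wirtingerBar (HRes d) (modeVector k) (fromGen gen z) = 0)
    (heq : ∀ (z : Fin N → ℂ) (i : Fin N), ∀ k ∈ gen i, ∀ l ∈ gen i,
      wirtingerBar (HRes d) (modeVector k) (fromGen gen z) =
        wirtingerBar (HRes d) (modeVector l) (fromGen gen z)) :
    IsResInvariant d (fromGen gen '' {z | ∀ i, i ∉ A → z i = 0}) := by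
  choose rep hrep using hne
  let cut : (Fin N → ℂ) →L[ℂ] (Fin N → ℂ) :=
    ContinuousLinearMap.pi fun i => if i ∈ A then ContinuousLinearMap.proj i else 0
  have hcut : ∀ z i, cut z i = if i ∈ A then z i else 0 := fun z i => by
    simp only [cut, ContinuousLinearMap.pi_apply]
    split_ifs <;> rfl
  have hcut' : ∀ z, (∀ i, i ∉ A → z i = 0) → cut z = z := fun z hz => by
    funext i
    rw [hcut]
    split_ifs with hi
    · rfl
    · rw [hz i hi]
  let p : EllOne →L[ℂ] EllOne := (fromGenL gen).comp (cut.comp (evalModes rep))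
  have hp : ∀ u, p u = fromGen gen (cut (evalModes rep u)) := fun u => rfl
  have hpz : ∀ z, (∀ i, i ∉ A → z i = 0) → p (fromGen gen z) = fromGen gen z := fun z hz => by
    rw [hp, evalModes_fromGen hdis hrep, hcut' z hz]
  have hset : fromGen gen '' {z | ∀ i, i ∉ A → z i = 0} = {u | p u = u} := by
    ext u
    constructor
    · rintro ⟨z, hz, rfl⟩
      exact hpz z hz
    · intro hu
      exact ⟨cut (evalModes rep u), fun i hi => by rw [hcut, if_neg hi], hu⟩
  rw [hset]
  refine isFlowInvariant_of_projection p fun R => ?_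
  -- A radius that bounds both u and p u.
  let R' : ℝ := max R (‖p‖ * R)
  refine ⟨(1 + ‖p‖) * (2 * ((2 * d) * ((2 * d) * (R' + R') ^ (2 * d - 2)))), fun u w hu hw => ?_⟩
  have hR : 0 ≤ R' := (norm_nonneg u).trans (hu.trans (le_max_left _ _))
  -- The coordinates of the vector field at the projected point p u, which is tangent to the
  -- subspace.
  set ζ : Fin N → ℂ := fun i => if i ∈ A then
    2 * Complex.I * wirtingerBar (HRes d) (modeVector (rep i)) (p u) else 0 with hζ
  have hζA : ∀ i, i ∉ A → ζ i = 0 := fun i hi => by simp [hζ, hi]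
  have hcoord : ∀ k, fromGen gen ζ k =
      2 * Complex.I * wirtingerBar (HRes d) (modeVector k) (p u) := fun k => by
    by_cases hk : ∃ i ∈ A, k ∈ gen i
    · obtain ⟨i, hiA, hi⟩ := hk
      rw [fromGen_apply_of_mem hdis _ hi]
      simp only [hζ, if_pos hiA]
      rw [hp, heq _ i _ (hrep i) _ hi]
    · push Not at hk
      rw [hp, h0 _ (fun i hi => by rw [hcut, if_neg hi]) k hk, mul_zero]
      by_cases hk' : ∃ i, k ∈ gen i
      · obtain ⟨i, hi⟩ := hk'
        rw [fromGen_apply_of_mem hdis _ hi, hζA i fun hiA => hk i hiA hi]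
      · push Not at hk'
        exact fromGen_apply_of_notMem _ hk'
  have hle : ‖w - fromGen gen ζ‖ₑ ≤
      2 * ((2 * d) * ((2 * d) * (‖u - p u‖ₑ * (ENNReal.ofReal R' + ENNReal.ofReal R') ^
        (2 * d - 2)))) := by
    rw [← EllOne.tsum_enorm]
    have hk : ∀ k, ‖(w - fromGen gen ζ) k‖ₑ = 2 * ‖wirtingerBar (HRes d) (modeVector k) u -
        wirtingerBar (HRes d) (modeVector k) (p u)‖ₑ := fun k => by
      have h2 : w k = 2 * Complex.I * wirtingerBar (HRes d) (modeVector k) u := hw k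
      rw [lp.coeFn_sub, Pi.sub_apply, hcoord, h2, ← mul_sub, enorm_mul, enorm_mul]
      have h3 : ‖(2 : ℂ)‖ₑ = 2 := by
        rw [← ofReal_norm]; simp
      have h4 : ‖Complex.I‖ₑ = 1 := by
        rw [← ofReal_norm]; simp
      rw [h3, h4, mul_one]
    simp only [hk, ENNReal.tsum_mul_left]
    gcongr
    refine tsum_wirtingerBar_HRes_sub_le hd u (p u) ?_ ?_
    · rw [← ofReal_norm]
      exact ENNReal.ofReal_le_ofReal (hu.trans (le_max_left _ _))
    · rw [← ofReal_norm]
      refine ENNReal.ofReal_le_ofReal ((p.le_opNorm u).trans (le_trans ?_ (le_max_right _ _)))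
      gcongr
  have hle' : ‖w - fromGen gen ζ‖ ≤ 2 * ((2 * d) * ((2 * d) * (‖u - p u‖ * (R' + R') ^
        (2 * d - 2)))) := by
    rw [← ENNReal.ofReal_le_ofReal_iff (by positivity), ofReal_norm]
    refine hle.trans (le_of_eq ?_)
    have h2d : (0 : ℝ) ≤ 2 * d := by positivity
    have e2d : ENNReal.ofReal (2 * d) = 2 * d := by
      rw [ENNReal.ofReal_mul (by norm_num)]; simp
    rw [ENNReal.ofReal_mul (by norm_num), ENNReal.ofReal_mul h2d, ENNReal.ofReal_mul h2d,
      ENNReal.ofReal_mul (norm_nonneg _), ENNReal.ofReal_pow (by positivity),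
      ENNReal.ofReal_add hR hR, ofReal_norm, e2d]
    simp
  -- The tangent vector at p u is fixed by p and drops out of w − p w.
  have hw' : w - p w = (w - fromGen gen ζ) - p (w - fromGen gen ζ) := by
    rw [map_sub, hpz ζ hζA]; abel
  calc ‖w - p w‖ ≤ ‖w - fromGen gen ζ‖ + ‖p‖ * ‖w - fromGen gen ζ‖ := by
        rw [hw']
        exact (norm_sub_le _ _).trans (add_le_add le_rfl (p.le_opNorm _))
    _ = (1 + ‖p‖) * ‖w - fromGen gen ζ‖ := by ring
    _ ≤ (1 + ‖p‖) * (2 * ((2 * d) * ((2 * d) * (‖u - p u‖ * (R' + R') ^ (2 * d - 2))))) := by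
        gcongr
    _ = _ := by ring

theorem fromGen_genVector (i : Fin N) :
    fromGen gen (genVector i) = ∑ k ∈ gen i, modeVector k := by
  rw [fromGen, Finset.sum_eq_single i]
  · simp [genVector, modeVector]
  · intro j _ hj
    simp [genVector, Pi.single_eq_of_ne hj]
  · simp

/-- The gradient of the restriction of `H_Res` to the space of equal modes. -/
theorem wirtingerBar_restriction {d : ℕ} (hd : 0 < d) {h : (Fin N → ℂ) → ℂ} {n : ℕ} (hn : n ≠ 0)
    (hcard : ∀ i, (gen i).card = n) (hh : ∀ z, HRes d (fromGen gen z) = n * h z)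
    (heq : ∀ (z : Fin N → ℂ) (i : Fin N), ∀ k ∈ gen i, ∀ l ∈ gen i,
      wirtingerBar (HRes d) (modeVector k) (fromGen gen z) =
        wirtingerBar (HRes d) (modeVector l) (fromGen gen z))
    (z : Fin N → ℂ) {i : Fin N} {k : ℤ × ℤ} (hk : k ∈ gen i) :
    wirtingerBar h (genVector i) z = wirtingerBar (HRes d) (modeVector k) (fromGen gen z) := by
  have hn' : (n : ℂ) ≠ 0 := Nat.cast_ne_zero.2 hn
  -- The derivative along the sum of all modes of one generation is computed twice: through the
  -- restriction, with the factor n of `hh`, and as a sum of n equal partial derivatives. The two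
  -- factors n cancel.
  have h1 : wirtingerBar (HRes d) (fromGen gen (genVector i)) (fromGen gen z) =
      n * wirtingerBar h (genVector i) z := by
    have e : ∀ c : ℂ, HRes d (fromGen gen z + c • fromGen gen (genVector i)) =
        n * h (z + c • genVector i) := fun c => by
      rw [← hh]
      simp only [← fromGenL_apply, map_add, map_smul]
    simp only [wirtingerBar, e, deriv_const_mul_field]
    ring
  have h2 : wirtingerBar (HRes d) (fromGen gen (genVector i)) (fromGen gen z) =
      n * wirtingerBar (HRes d) (modeVector k) (fromGen gen z) := by
    rw [fromGen_genVector, wirtingerBar_HRes_sum hd,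
      Finset.sum_congr rfl fun l hl => heq z i l hl k hk, Finset.sum_const, hcard, nsmul_eq_mul]
  exact mul_left_cancel₀ hn' (h1.symm.trans h2)

/-- The flow of `H_Res` on the space of equal modes is the flow of the restriction. -/
theorem isResOrbit_fromGen_iff {d : ℕ} (hd : 0 < d) {h : (Fin N → ℂ) → ℂ} {n : ℕ} (hn : n ≠ 0)
    (hdis : ∀ i j, i ≠ j → Disjoint (gen i) (gen j))
    (hcard : ∀ i, (gen i).card = n) (hh : ∀ z, HRes d (fromGen gen z) = n * h z)
    (h0 : ∀ z : Fin N → ℂ, ∀ k, (∀ i, k ∉ gen i) →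
      wirtingerBar (HRes d) (modeVector k) (fromGen gen z) = 0)
    (heq : ∀ (z : Fin N → ℂ) (i : Fin N), ∀ k ∈ gen i, ∀ l ∈ gen i,
      wirtingerBar (HRes d) (modeVector k) (fromGen gen z) =
        wirtingerBar (HRes d) (modeVector l) (fromGen gen z))
    (I : Set ℝ) (z : ℝ → Fin N → ℂ) :
    IsResOrbit d (fun t => fromGen gen (z t)) I ↔ IsToyOrbit h z I := by
  have hne : ∀ i, (gen i).Nonempty := fun i => by
    rw [← Finset.card_ne_zero, hcard]; exact hn
  choose rep hrep using hne
  have hgrad := fun z i k => wirtingerBar_restriction hd hn hcard hh heq z (i := i) (k := k)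
  constructor
  · intro hz t ht
    obtain ⟨w, hw, hder⟩ := hz t ht
    refine ⟨evalModes rep w, fun i => ?_, ?_⟩
    · rw [hgrad _ _ _ (hrep i)]
      exact hw (rep i)
    · have := hasDerivAt_clm_comp (evalModes rep) hder
      simpa only [evalModes_fromGen hdis hrep] using this
  · intro hz t ht
    obtain ⟨w, hw, hder⟩ := hz t ht
    refine ⟨fromGen gen w, fun k => ?_, hasDerivAt_clm_comp (fromGenL gen) hder⟩
    by_cases hk : ∃ i, k ∈ gen i
    · obtain ⟨i, hi⟩ := hk
      rw [← hgrad _ _ _ hi, ← hw]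
      exact fromGen_apply_of_mem hdis w hi
    · push Not at hk
      rw [h0 _ k hk, mul_zero]
      exact fromGen_apply_of_notMem w hk

theorem isToyInvariant_of_isResInvariant {d : ℕ} {h : (Fin N → ℂ) → ℂ} {A : Set (Fin N)}
    (hdis : ∀ i j, i ≠ j → Disjoint (gen i) (gen j)) (hne : ∀ i, (gen i).Nonempty)
    (horb : ∀ (I : Set ℝ) (z : ℝ → Fin N → ℂ),
      IsResOrbit d (fun t => fromGen gen (z t)) I ↔ IsToyOrbit h z I)
    (hinv : IsResInvariant d (fromGen gen '' {z | ∀ i, i ∉ A → z i = 0})) :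
    IsToyInvariant h {z | ∀ i, i ∉ A → z i = 0} := by
  intro T₁ T₂ z hz t₀ ht₀ h0 t ht
  choose rep hrep using hne
  obtain ⟨z', hz', he⟩ := hinv T₁ T₂ _ ((horb _ z).2 hz) t₀ ht₀ ⟨_, h0, rfl⟩ t ht
  have := congrArg (evalModes rep) he
  rw [evalModes_fromGen hdis hrep, evalModes_fromGen hdis hrep] at this
  rw [← this]
  exact hz'

end EqualModes

/-! ### The relations of the family structure -/

/-- The labels of the members of one generation. -/
abbrev Cube (M : ℕ) : Type := Fin M → ZMod 2

/-- The abstract points: a generation and a label. The points `(m, v)`, `(m, v + dir m)` are the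
parents, `(m + 1, v)`, `(m + 1, v + dir m)` the children of a nuclear family. -/
abbrev Pt (M : ℕ) : Type := Fin (M + 1) × Cube M

/-- The direction in which the families of the `m`-th generation extend. -/
def dir {M : ℕ} (m : Fin M) : Cube M := Pi.single m 1

theorem add_dir_ne {M : ℕ} (v : Cube M) (m : Fin M) : v + dir m ≠ v := by
  intro h
  have := congrFun h m
  simp [dir] at this

theorem Cube.add_self {M : ℕ} (v : Cube M) : v + v = 0 :=
  funext fun _ => CharTwo.add_self_eq_zero _

theorem add_dir_add_dir {M : ℕ} (v : Cube M) (m : Fin M) : v + dir m + dir m = v := by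
  rw [add_assoc, Cube.add_self, add_zero]

theorem dir_injective {M : ℕ} : Function.Injective (dir (M := M)) := fun a b h => by
  by_contra hab
  have := congrFun h a
  simp [dir, Pi.single_eq_of_ne hab] at this

/-- The sum of the coefficients of the generations up to the `m`-th. -/
def psum {M : ℕ} (μ : Pt M → ℤ) (m : ℕ) (v : Cube M) : ℤ :=
  ∑ l : Fin (M + 1) with l.1 ≤ m, μ (l, v)

/-- The families whose generation lies in `I` allow `μ` as a combination of families. -/
def IsRelOn {M : ℕ} (I : Set (Fin M)) (μ : Pt M → ℤ) : Prop :=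
  (∀ m ∈ I, ∀ v, psum μ m (v + dir m) = psum μ m v) ∧ ∀ v, ∑ l, μ (l, v) = 0

/-- `μ` is an integer combination of families. -/
def IsRel {M : ℕ} (μ : Pt M → ℤ) : Prop := IsRelOn Set.univ μ

section Rel

variable {M : ℕ}

theorem psum_add (μ ν : Pt M → ℤ) (m : ℕ) (v : Cube M) :
    psum (μ + ν) m v = psum μ m v + psum ν m v := by
  simp [psum, Finset.sum_add_distrib]

theorem psum_smul (c : ℤ) (μ : Pt M → ℤ) (m : ℕ) (v : Cube M) :
    psum (c • μ) m v = c * psum μ m v := by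
  simp [psum, Finset.mul_sum]

theorem psum_single (x : Pt M) (m : ℕ) (v : Cube M) :
    psum (Pi.single x 1) m v = if x.1.1 ≤ m ∧ x.2 = v then 1 else 0 := by
  rw [psum, Finset.sum_filter, Finset.sum_eq_single x.1]
  · by_cases hm : x.1.1 ≤ m <;> by_cases hv : x.2 = v
    · subst hv; simp [hm]
    · have : (x.1, v) ≠ x := fun h => hv (by rw [← h])
      simp [hm, hv, Pi.single_eq_of_ne this]
    · simp [hm]
    · simp [hm]
  · intro l _ hl
    have : (l, v) ≠ x := fun h => hl (by rw [← h])
    simp [Pi.single_eq_of_ne this]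
  · simp

theorem sum_single_fiber (x : Pt M) (v : Cube M) :
    ∑ l, (Pi.single x 1 : Pt M → ℤ) (l, v) = if x.2 = v then 1 else 0 := by
  have := psum_single x M v
  rw [psum, Finset.filter_true_of_mem fun l _ => Nat.lt_succ_iff.1 l.2] at this
  rw [this]
  simp [Nat.lt_succ_iff.1 x.1.2]

theorem IsRel.add {μ ν : Pt M → ℤ} (hμ : IsRel μ) (hν : IsRel ν) : IsRel (μ + ν) :=
  ⟨fun m hm v => by rw [psum_add, psum_add, hμ.1 m hm, hν.1 m hm],
    fun v => by simp [Finset.sum_add_distrib, hμ.2, hν.2]⟩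

theorem IsRel.smul {μ : Pt M → ℤ} (hμ : IsRel μ) (c : ℤ) : IsRel (c • μ) :=
  ⟨fun m hm v => by rw [psum_smul, psum_smul, hμ.1 m hm],
    fun v => by simp [← Finset.mul_sum, hμ.2]⟩

theorem IsRel.of_smul {μ : Pt M → ℤ} {c : ℤ} (hc : c ≠ 0) (hμ : IsRel (c • μ)) : IsRel μ := by
  refine ⟨fun m hm v => ?_, fun v => ?_⟩
  · have := hμ.1 m hm v
    rw [psum_smul, psum_smul] at this
    exact mul_left_cancel₀ hc this
  · have := hμ.2 v
    simp only [Pi.smul_apply, smul_eq_mul, ← Finset.mul_sum] at this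
    exact (mul_eq_zero.1 this).resolve_left hc

theorem IsRel.neg {μ : Pt M → ℤ} (hμ : IsRel μ) : IsRel (-μ) := by
  simpa using hμ.smul (-1)

theorem IsRel.sub {μ ν : Pt M → ℤ} (hμ : IsRel μ) (hν : IsRel ν) : IsRel (μ - ν) := by
  rw [sub_eq_add_neg]; exact hμ.add hν.neg

theorem isRel_zero : IsRel (0 : Pt M → ℤ) := ⟨fun _ _ _ => by simp [psum], fun _ => by simp⟩

/-- The relation of the family of `(m, v)`. -/
def family (m : Fin M) (v : Cube M) : Pt M → ℤ :=
  Pi.single (m.castSucc, v) 1 + Pi.single (m.castSucc, v + dir m) 1 -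
    Pi.single (m.succ, v) 1 - Pi.single (m.succ, v + dir m) 1

theorem isRel_family (m : Fin M) (v : Cube M) : IsRel (family m v) := by
  have hs : ∀ μ ν : Pt M → ℤ, ∀ k v, psum (μ - ν) k v = psum μ k v - psum ν k v :=
    fun μ ν k v => by simp [psum]
  refine ⟨fun k _ w => ?_, fun w => ?_⟩
  · simp only [family, hs, psum_add, psum_single, Fin.val_castSucc, Fin.val_succ]
    by_cases hk : (m : ℕ) + 1 ≤ k
    · simp [hk, show (m : ℕ) ≤ k by omega]
    · by_cases hk' : (m : ℕ) ≤ k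
      · obtain rfl : m = k := Fin.ext (by omega)
        have h1 : v = w + dir m ↔ v + dir m = w := by
          constructor <;> rintro rfl <;> rw [add_dir_add_dir]
        have h2 : v + dir m = w + dir m ↔ v = w := add_left_inj _
        simp only [h1, h2]
        simp
        ring
      · simp [hk, hk']
  · simp only [family, Pi.sub_apply, Pi.add_apply, Finset.sum_sub_distrib, Finset.sum_add_distrib,
      sum_single_fiber]
    ring

theorem sum_by_parts {A : Type*} [CommRing A] (M : ℕ) (a : Fin (M + 1) → A) (φ : Fin (M + 1) → A) :
    ∑ l, a l * φ l = ∑ m : Fin M, (∑ l with l.1 ≤ m.1, a l) * (φ m.castSucc - φ m.succ) +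
      (∑ l, a l) * φ (Fin.last M) := by
  induction M with
  | zero => simp
  | succ M ih =>
    have h : ∀ m : Fin (M + 1), ∑ l : Fin (M + 2) with l.1 ≤ m.1, a l =
        ∑ l : Fin (M + 1) with l.1 ≤ m.1, a (Fin.castSucc l) := fun m => by
      rw [Finset.sum_filter, Finset.sum_filter, Fin.sum_univ_castSucc]
      simp [show ¬ M + 1 ≤ m.1 by omega]
    rw [Fin.sum_univ_castSucc, ih (fun l => a (Fin.castSucc l)) fun l => φ (Fin.castSucc l)]
    simp only [h]
    rw [Fin.sum_univ_castSucc (n := M)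
      (fun m : Fin (M + 1) => (∑ l : Fin (M + 1) with l.1 ≤ m.1, a l.castSucc) *
        (φ m.castSucc - φ m.succ))]
    rw [Fin.sum_univ_castSucc a]
    have h2 : ∑ l : Fin (M + 1) with l.1 ≤ (Fin.last M).1, a l.castSucc =
        ∑ l : Fin (M + 1), a l.castSucc := by
      rw [Finset.filter_true_of_mem]
      exact fun l _ => Nat.lt_succ_iff.1 l.2
    rw [h2]
    simp only [Fin.val_castSucc, Fin.succ_castSucc, Fin.succ_last]
    ring

/-- One factor is even and the other odd under the shift by `dir m`. -/
theorem sum_mul_eq_zero {A : Type*} [CommRing A] [CharZero A] [NoZeroDivisors A] {m : Fin M}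
    {s h : Cube M → A} (hs : ∀ v, s (v + dir m) = s v) (hh : ∀ v, h v + h (v + dir m) = 0) :
    ∑ v, s v * h v = 0 := by
  have h1 : ∑ v, s v * h v = ∑ v, s (v + dir m) * h (v + dir m) :=
    (Equiv.sum_comp (Equiv.addRight (dir m)) fun v => s v * h v).symm
  have h2 : ∑ v, s v * h v + ∑ v, s v * h v = 0 := by
    nth_rw 2 [h1]
    rw [← Finset.sum_add_distrib]
    exact Finset.sum_eq_zero fun v _ => by rw [hs, ← mul_add, hh, mul_zero]
  exact add_self_eq_zero.1 h2

/-- A function with the family relation is annihilated by all relations. -/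
theorem IsRel.sum_eq_zero {A : Type*} [CommRing A] [CharZero A] [NoZeroDivisors A] {μ : Pt M → ℤ}
    (hμ : IsRel μ) {φ : Pt M → A} (hφ : ∀ (m : Fin M) v, φ (m.castSucc, v) +
      φ (m.castSucc, v + dir m) = φ (m.succ, v) + φ (m.succ, v + dir m)) :
    ∑ x, (μ x : A) * φ x = 0 := by
  rw [Fintype.sum_prod_type_right]
  -- Abel summation over the generations at a fixed label; the boundary term vanishes with the
  -- total. The partial sums are then even and the differences of φ odd under v ↦ v + e_m.
  have h : ∀ v, ∑ l, (μ (l, v) : A) * φ (l, v) =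
      ∑ m : Fin M, (psum μ m v : A) * (φ (m.castSucc, v) - φ (m.succ, v)) := fun v => by
    rw [sum_by_parts M (fun l => (μ (l, v) : A)) fun l => φ (l, v)]
    have := hμ.2 v
    rw [← Int.cast_sum, this]
    simp [psum]
  simp only [h]
  rw [Finset.sum_comm]
  refine Finset.sum_eq_zero fun m _ => sum_mul_eq_zero (m := m)
    (s := fun v => (psum μ m v : A)) (fun v => ?_) fun v => ?_
  · rw [hμ.1 m (Set.mem_univ m)]
  · linear_combination hφ m v

/-- A partial sum through generation m takes equal values on the couples v, v + e_m, hence has even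
total; the last one is zero. One generation is the difference of two consecutive partial sums. -/
theorem IsRel.even_sum {μ : Pt M → ℤ} (hμ : IsRel μ) (l : Fin (M + 1)) :
    Even (∑ v, μ (l, v)) := by
  have hp : ∀ m : Fin M, Even (∑ v, psum μ m v) := fun m => by
    rw [← ZMod.intCast_eq_zero_iff_even]
    push_cast
    refine Finset.sum_involution (fun v _ => v + dir m) (fun v _ => ?_)
      (fun v _ _ => add_dir_ne v m) (fun _ _ => Finset.mem_univ _)
      fun v _ => add_dir_add_dir v m
    rw [hμ.1 m (Set.mem_univ m), CharTwo.add_self_eq_zero]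
  have hp' : ∀ k : ℕ, k ≤ M → Even (∑ v, psum μ k v) := fun k hk => by
    rcases hk.lt_or_eq with hk | rfl
    · exact hp ⟨k, hk⟩
    · have : ∀ v, psum μ k v = 0 := fun v => by
        rw [psum, Finset.filter_true_of_mem fun l _ => Nat.lt_succ_iff.1 l.2, hμ.2]
      simp [this]
  obtain ⟨l, hl⟩ := l
  rcases l with _ | l
  · have : ∀ v, psum μ 0 v = μ (⟨0, hl⟩, v) := fun v => by
      rw [psum, Finset.sum_eq_single ⟨0, hl⟩]
      · intro b hb hb'
        simp only [Finset.mem_filter] at hb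
        exact absurd (Fin.ext (by simpa using hb.2)) hb'
      · simp
    simpa [this] using hp' 0 (by omega)
  · have : ∀ v, psum μ (l + 1) v = psum μ l v + μ (⟨l + 1, hl⟩, v) := fun v => by
      rw [psum, psum]
      refine Eq.trans ?_ ((Finset.sum_insert (s := Finset.univ.filter fun i : Fin (M + 1) => i.1 ≤ l)
        (a := ⟨l + 1, hl⟩) (f := fun i : Fin (M + 1) => μ (i, v)) (by simp)).trans (add_comm _ _))
      refine Finset.sum_congr ?_ fun _ _ => rfl
      ext i
      simp only [Finset.mem_filter, Finset.mem_univ, true_and, Finset.mem_insert, Fin.ext_iff]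
      omega
    have h1 := hp' (l + 1) (by omega)
    simp only [this, Finset.sum_add_distrib] at h1
    exact (Int.even_add.1 h1).1 (hp' l (by omega))

/-! ### Short relations -/

/-- The first generation of a nonzero relation and the last one are unions of couples. -/
theorem IsRelOn.extremal {I : Set (Fin M)} {μ : Pt M → ℤ} (hμ : IsRelOn I μ) (h0 : μ ≠ 0)
    (hI : ∀ m v, (μ (Fin.castSucc m, v) ≠ 0 ∨ μ (m.succ, v) ≠ 0) → m ∈ I) :
    ∃ a b : Fin M, a ≤ b ∧ (∃ v, μ (a.castSucc, v) ≠ 0) ∧ (∃ v, μ (b.succ, v) ≠ 0) ∧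
      (∀ v, μ (a.castSucc, v + dir a) = μ (a.castSucc, v)) ∧
      (∀ v, μ (b.succ, v + dir b) = μ (b.succ, v)) := by
  classical
  let T : Finset (Fin (M + 1)) := Finset.univ.filter fun l => ∃ v, μ (l, v) ≠ 0
  have hT : T.Nonempty := by
    obtain ⟨⟨l, v⟩, hx⟩ := Function.ne_iff.1 h0
    exact ⟨l, by simp only [T, Finset.mem_filter]; exact ⟨Finset.mem_univ _, v, hx⟩⟩
  have hmin := T.min'_mem hT
  have hmax := T.max'_mem hT
  set i := T.min' hT with hi
  set j := T.max' hT with hj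
  have hlo : ∀ l < i, ∀ v, μ (l, v) = 0 := fun l hl v => by
    by_contra h
    have : l ∈ T := by simp only [T, Finset.mem_filter]; exact ⟨Finset.mem_univ _, v, h⟩
    exact absurd (T.min'_le l this) (not_le.2 hl)
  have hhi : ∀ l > j, ∀ v, μ (l, v) = 0 := fun l hl v => by
    by_contra h
    have : l ∈ T := by simp only [T, Finset.mem_filter]; exact ⟨Finset.mem_univ _, v, h⟩
    exact absurd (T.le_max' l this) (not_le.2 hl)
  obtain ⟨vi, hvi⟩ := (Finset.mem_filter.1 hmin).2
  obtain ⟨vj, hvj⟩ := (Finset.mem_filter.1 hmax).2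
  -- If only one generation were occupied, the sum over the label `vi` would be a single nonzero
  -- term.
  have hij : i < j := by
    rcases (T.min'_le j hmax).lt_or_eq with h | h
    · exact h
    · exfalso
      have h' : i = j := h
      have := hμ.2 vi
      rw [Finset.sum_eq_single i] at this
      · exact hvi this
      · intro l _ hl
        rcases lt_or_gt_of_ne hl with hl | hl
        · exact hlo l hl _
        · exact hhi l (h' ▸ hl) _
      · simp
  obtain ⟨a, ha⟩ : ∃ a : Fin M, a.castSucc = i :=
    ⟨⟨i, by have := j.2; have : (i : ℕ) < j := hij; omega⟩, rfl⟩
  obtain ⟨b, hb⟩ : ∃ b : Fin M, b.succ = j :=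
    ⟨⟨j - 1, by have := j.2; have : (i : ℕ) < j := hij; omega⟩,
      Fin.ext (by have : (i : ℕ) < j := hij; simp; omega)⟩
  have hab : a ≤ b := by
    have h1 : (i : ℕ) < j := hij
    rw [← ha, ← hb] at h1
    simp only [Fin.val_castSucc, Fin.val_succ] at h1
    exact Fin.le_def.2 (by omega)
  refine ⟨a, b, hab, ⟨vi, by rwa [ha]⟩, ⟨vj, by rwa [hb]⟩, fun v => ?_, fun v => ?_⟩
  · have h1 : ∀ v, psum μ a v = μ (a.castSucc, v) := fun v => by
      rw [psum, Finset.sum_eq_single a.castSucc]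
      · intro l hl hla
        refine hlo l ?_ v
        rw [← ha]
        exact lt_of_le_of_ne (Fin.le_def.2 (Finset.mem_filter.1 hl).2) hla
      · simp
    rw [← h1, ← h1]
    exact hμ.1 a (hI a vi (Or.inl (by rwa [ha]))) v
  -- Nothing lies above the last occupied generation, so the partial sum just below it is minus its
  -- coefficients, the total being zero.
  · have h1 : ∀ v, psum μ b v = -μ (b.succ, v) := fun v => by
      have h2 := hμ.2 v
      rw [← Finset.sum_filter_add_sum_filter_not _ (fun l : Fin (M + 1) => l.1 ≤ b.1)] at h2
      rw [Finset.sum_eq_single b.succ (s := Finset.univ.filter fun l : Fin (M + 1) => ¬ l.1 ≤ b.1)]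
        at h2
      · rw [psum]; linarith
      · intro l hl hlb
        refine hhi l ?_ v
        rw [← hb]
        refine lt_of_le_of_ne (Fin.le_def.2 ?_) (Ne.symm hlb)
        have := (Finset.mem_filter.1 hl).2
        rw [Fin.val_succ]; omega
      · simp
    have := hμ.1 b (hI b vj (Or.inr (by rwa [hb]))) v
    rw [h1, h1] at this
    linarith

/-- By `IsRelOn.extremal` the lowest generation of a nonzero relation contains two points with equal
coefficients, whereas here the two coefficients have opposite signs. -/
theorem IsRelOn.eq_of_two {I : Set (Fin M)} {x x' : Pt M}
    (hμ : IsRelOn I (Pi.single x 1 - Pi.single x' 1))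
    (hI : ∀ m : Fin M, (∃ z ∈ ({x, x'} : Set (Pt M)), z.1 = m.castSucc ∨ z.1 = m.succ) → m ∈ I) :
    x = x' := by
  by_contra hne
  have hval : ∀ z : Pt M, (Pi.single x 1 - Pi.single x' 1 : Pt M → ℤ) z =
      (if z = x then 1 else 0) - if z = x' then 1 else 0 := fun z => by
    simp [Pi.single_apply]
  have hsupp : ∀ z : Pt M, (Pi.single x 1 - Pi.single x' 1 : Pt M → ℤ) z ≠ 0 → z = x ∨ z = x' :=
    fun z hz => by
      rw [hval] at hz
      by_contra h
      push Not at h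
      simp [h.1, h.2] at hz
  obtain ⟨a, b, -, ⟨v, hv⟩, -, h1, -⟩ := hμ.extremal
    (fun h => by
      have := congrFun h x
      rw [hval] at this
      simp [hne] at this)
    (fun m v h => hI m <| by
      rcases h with h | h
      · exact ⟨_, by simpa using hsupp _ h, Or.inl rfl⟩
      · exact ⟨_, by simpa using hsupp _ h, Or.inr rfl⟩)
  have hv' := hv
  rw [← h1] at hv'
  have hd : ((a.castSucc, v + dir a) : Pt M) ≠ (a.castSucc, v) := fun h =>
    add_dir_ne v a (congrArg Prod.snd h)
  have h1v := h1 v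
  rw [hval, hval] at h1v
  rcases hsupp _ hv with e | e <;> rcases hsupp _ hv' with e' | e'
  · exact hd (e'.trans e.symm)
  · rw [e, e'] at h1v
    simp [hne, Ne.symm hne] at h1v
  · rw [e, e'] at h1v
    simp [hne, Ne.symm hne] at h1v
  · exact hd (e'.trans e.symm)

/-- `a, b` are the parents and `c, e` the children of a family. -/
def IsFam (a b c e : Pt M) : Prop :=
  ∃ (m : Fin M) (v : Cube M), a = (m.castSucc, v) ∧ b = (m.castSucc, v + dir m) ∧
    ((c = (m.succ, v) ∧ e = (m.succ, v + dir m)) ∨ (c = (m.succ, v + dir m) ∧ e = (m.succ, v)))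

/-- The vector of the quadruple `a, b; c, e`. -/
def quad (a b c e : Pt M) : Pt M → ℤ :=
  Pi.single a 1 + Pi.single b 1 - Pi.single c 1 - Pi.single e 1

theorem quad_apply (a b c e z : Pt M) : quad a b c e z =
    (if z = a then 1 else 0) + (if z = b then 1 else 0) - (if z = c then 1 else 0) -
      (if z = e then 1 else 0) := by
  simp [quad, Pi.single_apply]

theorem quad_swap (a b c e : Pt M) : quad c e a b = -quad a b c e := by
  unfold quad; abel

theorem IsFam.isRel {a b c e : Pt M} (h : IsFam a b c e) : IsRel (quad a b c e) := by
  obtain ⟨m, v, rfl, rfl, ⟨rfl, rfl⟩ | ⟨rfl, rfl⟩⟩ := h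
  · exact isRel_family m v
  · have := isRel_family m v
    unfold family at this
    unfold quad
    rwa [sub_right_comm]

theorem IsFam.quad_ne_zero {a b c e : Pt M} (h : IsFam a b c e) : quad a b c e ≠ 0 := by
  intro h0
  have := congrFun h0 a
  obtain ⟨m, v, rfl, rfl, ⟨rfl, rfl⟩ | ⟨rfl, rfl⟩⟩ := h <;>
  · rw [quad_apply] at this
    have h1 : m.castSucc ≠ m.succ := (Fin.castSucc_lt_succ).ne
    simp [h1, Ne.symm (add_dir_ne v m)] at this

theorem pair_eq_of_quad_pos {a b c e z z' : Pt M} (hne : z' ≠ z) (h : 0 < quad a b c e z)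
    (h' : 0 < quad a b c e z') : ({a, b} : Set (Pt M)) = {z, z'} := by
  rw [quad_apply] at h h'
  rw [Set.pair_eq_pair_iff]
  have h1 : z = a ∨ z = b := by
    by_contra hz
    push Not at hz
    rw [if_neg hz.1, if_neg hz.2] at h
    split_ifs at h <;> omega
  have h2 : z' = a ∨ z' = b := by
    by_contra hz
    push Not at hz
    rw [if_neg hz.1, if_neg hz.2] at h'
    split_ifs at h' <;> omega
  rcases h1 with rfl | rfl <;> rcases h2 with rfl | rfl <;> simp_all

/-- The lowest and the highest occupied generation each contain a couple with equal coefficients, so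
each couple is one of the pairs {a, b}, {c, e}. The vanishing sums over the labels force both
couples to have the same two labels, hence the same direction, and they belong to one family. -/
theorem IsRelOn.isFam_of_quad {I : Set (Fin M)} {a b c e : Pt M}
    (hμ : IsRelOn I (quad a b c e)) (h0 : quad a b c e ≠ 0)
    (hI : ∀ m : Fin M, (∃ z ∈ ({a, b, c, e} : Set (Pt M)), z.1 = m.castSucc ∨ z.1 = m.succ) →
      m ∈ I) :
    IsFam a b c e ∨ IsFam c e a b := by
  have hsupp : ∀ z : Pt M, quad a b c e z ≠ 0 → z = a ∨ z = b ∨ z = c ∨ z = e := fun z hz => by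
    rw [quad_apply] at hz
    by_contra h
    push Not at h
    simp [h.1, h.2] at hz
  obtain ⟨α, β, hαβ, ⟨v, hv⟩, ⟨u, hu⟩, h1, h2⟩ := hμ.extremal h0 (fun m v h => hI m <| by
      rcases h with h | h
      · exact ⟨_, by simpa using hsupp _ h, Or.inl rfl⟩
      · exact ⟨_, by simpa using hsupp _ h, Or.inr rfl⟩)
  have h1v := h1 v
  have h2u := h2 u
  have hdv : v + dir α ≠ v := add_dir_ne v α
  have hdu : u + dir β ≠ u := add_dir_ne u β
  have hne : ∀ w w' : Cube M, ((α.castSucc, w) : Pt M) ≠ (β.succ, w') := fun w w' h => by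
    have : (α : ℕ) = β + 1 := by simpa using congrArg (fun z : Pt M => z.1.1) h
    have : (α : ℕ) ≤ β := hαβ
    omega
  have hn1 : ((α.castSucc, v + dir α) : Pt M) ≠ (α.castSucc, v) := fun h =>
    hdv (congrArg Prod.snd h)
  have hn2 : ((β.succ, u + dir β) : Pt M) ≠ (β.succ, u) := fun h => hdu (congrArg Prod.snd h)
  have key : ({a, b} : Set (Pt M)) = {(α.castSucc, v), (α.castSucc, v + dir α)} ∧
      ({c, e} : Set (Pt M)) = {(β.succ, u), (β.succ, u + dir β)} ∨
      ({c, e} : Set (Pt M)) = {(α.castSucc, v), (α.castSucc, v + dir α)} ∧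
      ({a, b} : Set (Pt M)) = {(β.succ, u), (β.succ, u + dir β)} := by
    have pos : ∀ z z' : Pt M, z' ≠ z → quad a b c e z' = quad a b c e z → quad a b c e z ≠ 0 →
        (0 < quad a b c e z ∧ ({a, b} : Set (Pt M)) = {z, z'}) ∨
          (quad a b c e z < 0 ∧ ({c, e} : Set (Pt M)) = {z, z'}) := fun z z' hz h h0 => by
      rcases lt_or_gt_of_ne h0 with hl | hl
      · refine Or.inr ⟨hl, ?_⟩
        apply pair_eq_of_quad_pos hz (c := a) (e := b) <;> rw [quad_swap, Pi.neg_apply] <;> omega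
      · exact Or.inl ⟨hl, pair_eq_of_quad_pos hz hl (by omega)⟩
    have hdisj : ∀ x y : Pt M, ({x, y} : Set (Pt M)) = {(α.castSucc, v), (α.castSucc, v + dir α)} →
        ({x, y} : Set (Pt M)) = {(β.succ, u), (β.succ, u + dir β)} → False := fun x y h h' => by
      have hx : x ∈ ({(α.castSucc, v), (α.castSucc, v + dir α)} : Set (Pt M)) := by
        rw [← h]; simp
      have hx' : x ∈ ({(β.succ, u), (β.succ, u + dir β)} : Set (Pt M)) := by
        rw [← h']; simp
      rcases hx with rfl | rfl <;> rcases hx' with h | h <;> exact hne _ _ h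
    rcases pos _ _ hn1 h1v hv with ⟨-, p1⟩ | ⟨-, p1⟩ <;>
      rcases pos _ _ hn2 h2u hu with ⟨-, p2⟩ | ⟨-, p2⟩
    · exact (hdisj _ _ p1 p2).elim
    · exact Or.inl ⟨p1, p2⟩
    · exact Or.inr ⟨p1, p2⟩
    · exact (hdisj _ _ p1 p2).elim
  have hfib : ∀ w, (if a.2 = w then 1 else 0) + (if b.2 = w then 1 else 0) -
      (if c.2 = w then 1 else 0) - (if e.2 = w then (1 : ℤ) else 0) = 0 := fun w => by
    have := hμ.2 w
    simpa only [quad, Pi.sub_apply, Pi.add_apply, Finset.sum_sub_distrib, Finset.sum_add_distrib,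
      sum_single_fiber] using this
  have fin : ∀ {a b c e : Pt M},
      (∀ w, (if a.2 = w then 1 else 0) + (if b.2 = w then 1 else 0) -
      (if c.2 = w then 1 else 0) - (if e.2 = w then (1 : ℤ) else 0) = 0) →
      ({a, b} : Set (Pt M)) = {(α.castSucc, v), (α.castSucc, v + dir α)} →
      ({c, e} : Set (Pt M)) = {(β.succ, u), (β.succ, u + dir β)} → IsFam a b c e := by
    intro a b c e hf hab hce
    rw [Set.pair_eq_pair_iff] at hab hce
    -- The two labels of the positive pair must cancel against those of the negative pair. Their
    -- difference then identifies the directions α and β.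
    have e1 : ({v, v + dir α} : Set (Cube M)) = {u, u + dir β} := by
      have f1 := hf v
      have f2 := hf (v + dir α)
      rw [Set.pair_eq_pair_iff]
      rcases hab with ⟨rfl, rfl⟩ | ⟨rfl, rfl⟩ <;> rcases hce with ⟨rfl, rfl⟩ | ⟨rfl, rfl⟩ <;>
      · simp only at f1 f2
        clear hf
        grind
    have e2 : α = β := by
      apply dir_injective
      rw [Set.pair_eq_pair_iff] at e1
      rcases e1 with ⟨rfl, h⟩ | ⟨rfl, h⟩
      · exact add_left_cancel h
      · rw [add_assoc] at h
        have h' : dir β + dir α = 0 := by simpa using h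
        rw [← Cube.add_self (dir β)] at h'
        exact add_left_cancel h'
    subst e2
    rw [Set.pair_eq_pair_iff] at e1
    rcases hab with ⟨rfl, rfl⟩ | ⟨rfl, rfl⟩
    · refine ⟨α, v, rfl, rfl, ?_⟩
      rcases e1 with ⟨rfl, -⟩ | ⟨rfl, -⟩
      · exact hce
      · rw [add_dir_add_dir]; tauto
    · refine ⟨α, v + dir α, rfl, by rw [add_dir_add_dir], ?_⟩
      rw [add_dir_add_dir]
      rcases e1 with ⟨rfl, -⟩ | ⟨rfl, -⟩
      · tauto
      · rw [add_dir_add_dir]; tauto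
  rcases key with ⟨k1, k2⟩ | ⟨k1, k2⟩
  · exact Or.inl (fin hfib k1 k2)
  · refine Or.inr (fin (fun w => ?_) k1 k2)
    have := hfib w
    linarith

end Rel

/-! ### Tuples and their relation vectors -/

theorem exists_perm_of_count {ι β : Type*} [Fintype ι] [DecidableEq β] {f g : ι → β}
    (h : ∀ b, ∑ j, ((if f j = b then 1 else 0) - if g j = b then 1 else 0 : ℤ) = 0) :
    ∃ σ : Equiv.Perm ι, ∀ j, f j = g (σ j) := by
  have hc : ∀ b, Nonempty ({j // f j = b} ≃ {j // g j = b}) := fun b => by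
    rw [← Fintype.card_eq, Fintype.card_subtype, Fintype.card_subtype]
    have := h b
    rw [Finset.sum_sub_distrib, Finset.sum_boole, Finset.sum_boole, sub_eq_zero] at this
    exact_mod_cast this
  have e := fun b => Classical.choice (hc b)
  exact ⟨Equiv.ofFiberEquiv e, fun j => (Equiv.ofFiberEquiv_map e j).symm⟩

/-- `f` takes no value twice except possibly one value at `p` and `q`. -/
def CoincideAt {ι β : Type*} (f : ι → β) (p q : ι) : Prop :=
  ∀ i j, i ≠ j → f i = f j → (i = p ∧ j = q) ∨ (i = q ∧ j = p)

theorem injective_or_coincideAt {d : ℕ} {β : Type*} [DecidableEq β] (f : Fin d → β)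
    (h : d ≤ (Finset.univ.image f).card + 1) :
    Function.Injective f ∨ ∃ p q, p ≠ q ∧ f p = f q ∧ CoincideAt f p q := by
  by_cases hf : Function.Injective f
  · exact Or.inl hf
  right
  simp only [Function.Injective, not_forall] at hf
  obtain ⟨p, q, hpq, hne⟩ := hf
  -- Deleting q does not change the image, so at least d − 1 values are taken on d − 1 positions and
  -- f is injective there. The same holds for p, so every coincidence involves both p and q.
  have inj : ∀ p q, p ≠ q → f p = f q → Set.InjOn f (Finset.univ.erase q : Finset (Fin d)) := by
    intro p q hne hpq
    rw [← Finset.card_image_iff]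
    have : (Finset.univ.erase q).image f = Finset.univ.image f := by
      refine Finset.Subset.antisymm (Finset.image_subset_image (Finset.erase_subset _ _)) ?_
      intro b hb
      obtain ⟨j, -, rfl⟩ := Finset.mem_image.1 hb
      by_cases hj : j = q
      · exact Finset.mem_image.2 ⟨p, by simp [hne], by rw [hj, hpq]⟩
      · exact Finset.mem_image.2 ⟨j, by simp [hj], rfl⟩
    rw [this, Finset.card_erase_of_mem (Finset.mem_univ q), Finset.card_fin]
    refine le_antisymm ?_ (by omega)
    rw [← this]
    exact Finset.card_image_le.trans (by simp)
  refine ⟨p, q, hne, hpq, fun i j hij hfij => ?_⟩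
  have h1 : i = q ∨ j = q := by
    by_contra hn
    push Not at hn
    exact hij (inj p q hne hpq (by simp [hn.1]) (by simp [hn.2]) hfij)
  have h2 : i = p ∨ j = p := by
    by_contra hn
    push Not at hn
    exact hij (inj q p (Ne.symm hne) hpq.symm (by simp [hn.1]) (by simp [hn.2]) hfij)
  rcases h1 with rfl | rfl <;> rcases h2 with h | h <;> simp_all

theorem eq_one_or_swap {ι : Type*} [DecidableEq ι] {σ : Equiv.Perm ι} {p q : ι}
    (h : ∀ j, j ≠ p → j ≠ q → σ j = j) : σ = 1 ∨ σ = Equiv.swap p q := by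
  have hp : σ p = p ∨ σ p = q := by
    by_contra hn
    push Not at hn
    exact hn.1 (σ.injective (h _ hn.1 hn.2))
  have hq : σ q = p ∨ σ q = q := by
    by_contra hn
    push Not at hn
    exact hn.2 (σ.injective (h _ hn.1 hn.2))
  by_cases hpq : p = q
  · subst hpq
    left
    ext j
    by_cases hj : j = p
    · subst hj; simpa using hp
    · exact h j hj hj
  rcases hp with hp | hp
  · left
    ext j
    by_cases hj : j = p
    · subst hj; exact hp
    by_cases hj' : j = q
    · subst hj'
      rcases hq with hq | hq
      · exact absurd (σ.injective (hp.trans hq.symm)) hpq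
      · exact hq
    · exact h j hj hj'
  · right
    ext j
    by_cases hj : j = p
    · subst hj; rw [hp, Equiv.swap_apply_left]
    by_cases hj' : j = q
    · subst hj'
      rw [Equiv.swap_apply_right]
      rcases hq with hq | hq
      · exact hq
      · exact absurd (σ.injective (hp.trans hq.symm)) hpq
    · rw [h j hj hj', Equiv.swap_apply_of_ne_of_ne hj hj']

section Tuples

variable {M d : ℕ}

/-- The relation vector of the tuple with the points `y` at the positions of `r` and the points
`y'` at the positions of `r̄`. -/
def vec (y y' : Fin d → Pt M) : Pt M → ℤ := ∑ j, (Pi.single (y j) 1 - Pi.single (y' j) 1)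

theorem vec_apply (y y' : Fin d → Pt M) (z : Pt M) :
    vec y y' z = ∑ j, ((if y j = z then 1 else 0) - if y' j = z then 1 else 0) := by
  simp only [vec, Finset.sum_apply, Pi.sub_apply, Pi.single_apply, eq_comm]

theorem vec_comp_perm (y y' : Fin d → Pt M) (σ : Equiv.Perm (Fin d)) :
    vec y (y' ∘ σ) = vec y y' := by
  simp only [vec, Finset.sum_sub_distrib]
  congr 1
  exact Equiv.sum_comp σ fun j => (Pi.single (y' j) 1 : Pt M → ℤ)

theorem vec_swap (y y' : Fin d → Pt M) : vec y' y = -vec y y' := by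
  simp only [vec, ← Finset.sum_neg_distrib, neg_sub]

theorem vec_eq_zero_iff {y y' : Fin d → Pt M} :
    vec y y' = 0 ↔ ∃ σ : Equiv.Perm (Fin d), ∀ j, y j = y' (σ j) := by
  constructor
  · intro h
    exact exists_perm_of_count fun b => by rw [← vec_apply, h, Pi.zero_apply]
  · rintro ⟨σ, h⟩
    rw [← vec_comp_perm _ _ σ, show y' ∘ σ = y from funext fun j => (h j).symm]
    simp [vec]

theorem sum_vec_fiber (y y' : Fin d → Pt M) (v : Cube M) :
    ∑ l, vec y y' (l, v) = ∑ j, ((if (y j).2 = v then 1 else 0) - if (y' j).2 = v then 1 else 0) := by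
  simp only [vec, Finset.sum_apply, Pi.sub_apply]
  rw [Finset.sum_comm]
  simp only [Finset.sum_sub_distrib, sum_single_fiber]

theorem vec_eq_quad {y y' : Fin d → Pt M} {p q : Fin d} (hpq : p ≠ q)
    (h : ∀ j, j ≠ p → j ≠ q → y j = y' j) : vec y y' = quad (y p) (y q) (y' p) (y' q) := by
  rw [vec, ← Finset.add_sum_erase _ _ (Finset.mem_univ p),
    ← Finset.add_sum_erase _ _ (show q ∈ Finset.univ.erase p by simp [Ne.symm hpq]),
    Finset.sum_eq_zero, quad]
  · abel
  · intro j hj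
    simp only [Finset.mem_erase, Finset.mem_univ, and_true] at hj
    rw [h j hj.2 hj.1, sub_self]

/-- The label `v` up to the directions in `I`. -/
def coarse (I : Finset (Fin M)) (v : Cube M) : Cube M := fun m => if m ∈ I then 0 else v m

theorem coarse_add_dir {I : Finset (Fin M)} {m : Fin M} (hm : m ∈ I) (v : Cube M) :
    coarse I (v + dir m) = coarse I v := by
  funext k
  simp only [coarse]
  split_ifs with hk
  · rfl
  · have : k ≠ m := by rintro rfl; exact hk hm
    simp [dir, Pi.single_eq_of_ne this]

/-- A class of labels modulo the directions in I is stable under the shifts from I, so cutting a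
relation down to one class keeps the conditions for these directions. The other directions are lost,
which is why relations relative to a set I are needed. -/
theorem IsRel.restrict {μ : Pt M → ℤ} (h : IsRel μ) (I : Finset (Fin M)) (c : Cube M) :
    IsRelOn (I : Set (Fin M)) (fun x => if coarse I x.2 = c then μ x else 0) := by
  refine ⟨fun m hm v => ?_, fun v => ?_⟩
  · simp only [psum]
    by_cases hc : coarse I v = c
    · simpa only [psum, coarse_add_dir hm, hc, if_true] using h.1 m (Set.mem_univ m) v
    · simp only [coarse_add_dir hm, hc, if_false]
  · by_cases hc : coarse I v = c
    · simpa only [hc, if_true] using h.2 v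
    · simp only [hc, if_false, Finset.sum_const_zero]

/-- `I` contains the directions of all families that meet the generations of the tuple. -/
def Covers (I : Finset (Fin M)) (y : Fin d → Pt M) : Prop :=
  ∀ (m : Fin M) (j : Fin d), ((y j).1 = m.castSucc ∨ (y j).1 = m.succ) → m ∈ I

/-- A resonant tuple of which at most two labels coincide up to the directions of its families is
trivial, or becomes trivial after removal of four points. -/
theorem IsRel.exists_perm {y y' : Fin d → Pt M} (h : IsRel (vec y y')) {I : Finset (Fin M)}
    (hy : Covers I y) (hy' : Covers I y') :
    ∃ σ : Equiv.Perm (Fin d), (∀ j, (y j).2 = (y' (σ j)).2) ∧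
      ∀ j, (∀ i, i ≠ j → coarse I (y i).2 ≠ coarse I (y j).2) → y j = y' (σ j) := by
  obtain ⟨σ, hσ⟩ := exists_perm_of_count (f := fun j => (y j).2) (g := fun j => (y' j).2)
    fun v => by rw [← sum_vec_fiber, h.2]
  refine ⟨σ, hσ, fun j hj => ?_⟩
  -- In the class of `y j` only `y j` and its partner `y' (σ j)` survive, and a relation of two
  -- points with opposite signs is trivial.
  have h1 := (vec_comp_perm y y' σ ▸ h).restrict I (coarse I (y j).2)
  refine IsRelOn.eq_of_two (I := I) ?_ ?_
  · convert h1 using 1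
    funext z
    split_ifs with hz
    · rw [vec_apply, Finset.sum_eq_single j]
      · simp [Pi.single_apply, eq_comm]
      · intro i _ hij
        have h2 : y i ≠ z := by rintro rfl; exact hj i hij hz
        have h3 : y' (σ i) ≠ z := by
          rintro rfl
          rw [← hσ i] at hz
          exact hj i hij hz
        simp [h2, h3]
      · simp
    · have h2 : z ≠ y j := by rintro rfl; exact hz rfl
      have h3 : z ≠ y' (σ j) := by
        rintro rfl
        rw [← hσ j] at hz
        exact hz rfl
      simp [h2, h3]
  · rintro m ⟨z, rfl | rfl, hz⟩
    · exact hy m j hz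
    · exact hy' m (σ j) hz

theorem IsFam.coarse_eq {I : Finset (Fin M)} {a b c e : Pt M} (h : IsFam a b c e)
    (hI : ∀ m : Fin M, (a.1 = m.castSucc ∨ a.1 = m.succ) → m ∈ I) :
    coarse I a.2 = coarse I b.2 := by
  obtain ⟨m, v, rfl, rfl, -⟩ := h
  exact (coarse_add_dir (hI m (Or.inl rfl)) v).symm

theorem IsFam.coarse_eq' {I : Finset (Fin M)} {a b c e : Pt M} (h : IsFam c e a b)
    (hI : ∀ m : Fin M, (a.1 = m.castSucc ∨ a.1 = m.succ) → m ∈ I) :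
    coarse I a.2 = coarse I b.2 := by
  obtain ⟨m, v, rfl, rfl, ⟨rfl, rfl⟩ | ⟨rfl, rfl⟩⟩ := h
  · exact (coarse_add_dir (hI m (Or.inr rfl)) v).symm
  · exact coarse_add_dir (hI m (Or.inr rfl)) v

theorem IsRel.isFam_of_quad {a b c e : Pt M} (h : IsRel (quad a b c e)) (h0 : quad a b c e ≠ 0) :
    IsFam a b c e ∨ IsFam c e a b :=
  IsRelOn.isFam_of_quad h h0 fun _ _ => Set.mem_univ _

/-! ### The weights of the leading part -/

open Classical in
/-- The pairings of a tuple. -/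
noncomputable def pairings (y y' : Fin d → Pt M) : Finset (Equiv.Perm (Fin d)) :=
  Finset.univ.filter fun σ => ∀ j, y j = y' (σ j)

open Classical in
/-- The pairings of a tuple with a double point. -/
noncomputable def doubles (y y' : Fin d → Pt M) : Finset (Equiv.Perm (Fin d) × Fin d × Fin d) :=
  Finset.univ.filter fun s => s.2.1 ≠ s.2.2 ∧ (∀ j, y j = y' (s.1 j)) ∧ y s.2.1 = y s.2.2

open Classical in
/-- The pairings of a tuple up to two points. -/
noncomputable def nearPairings (y y' : Fin d → Pt M) :
    Finset (Equiv.Perm (Fin d) × Fin d × Fin d) :=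
  Finset.univ.filter fun s => s.2.1 ≠ s.2.2 ∧ ∀ j, j ≠ s.2.1 → j ≠ s.2.2 → y j = y' (s.1 j)

open Classical in
/-- The weight of a tuple in the leading part of the restricted Hamiltonian. -/
noncomputable def weight (y y' : Fin d → Pt M) : ℝ :=
  (pairings y y').card - 1 / 4 * (doubles y y').card +
    if IsRel (vec y y') ∧ vec y y' ≠ 0 then 1 / 4 * ((nearPairings y y').card : ℝ) else 0

theorem weight_comp_perm (y y' : Fin d → Pt M) (τ : Equiv.Perm (Fin d)) :
    weight y (y' ∘ τ) = weight y y' := by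
  classical
  have h1 : (pairings y (y' ∘ τ)).card = (pairings y y').card :=
    Finset.card_bij (fun σ _ => τ * σ) (fun σ hσ => by simpa [pairings] using hσ)
      (fun _ _ _ _ h => mul_left_cancel h)
      fun σ hσ => ⟨τ⁻¹ * σ, by simpa [pairings] using hσ, by simp⟩
  have h2 : (doubles y (y' ∘ τ)).card = (doubles y y').card :=
    Finset.card_bij (fun s _ => (τ * s.1, s.2)) (fun σ hσ => by simpa [doubles] using hσ)
      (fun _ _ _ _ h => by simpa [Prod.ext_iff] using h)
      fun s hs => ⟨(τ⁻¹ * s.1, s.2), by simpa [doubles] using hs, by simp⟩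
  have h3 : (nearPairings y (y' ∘ τ)).card = (nearPairings y y').card :=
    Finset.card_bij (fun s _ => (τ * s.1, s.2)) (fun σ hσ => by simpa [nearPairings] using hσ)
      (fun _ _ _ _ h => by simpa [Prod.ext_iff] using h)
      fun s hs => ⟨(τ⁻¹ * s.1, s.2), by simpa [nearPairings] using hs, by simp⟩
  simp only [weight, h1, h2, h3, vec_comp_perm]

theorem pairings_eq_empty {y y' : Fin d → Pt M} (h : vec y y' ≠ 0) : pairings y y' = ∅ := by
  rw [Finset.eq_empty_iff_forall_notMem]
  intro σ hσ
  exact h (vec_eq_zero_iff.2 ⟨σ, by simpa [pairings] using hσ⟩)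

theorem doubles_eq_empty {y y' : Fin d → Pt M} (h : vec y y' ≠ 0) : doubles y y' = ∅ := by
  rw [Finset.eq_empty_iff_forall_notMem]
  intro s hs
  exact h (vec_eq_zero_iff.2 ⟨s.1, (Finset.mem_filter.1 hs).2.2.1⟩)

theorem weight_of_vec_eq_zero {y y' : Fin d → Pt M} (h : vec y y' = 0) :
    weight y y' = (pairings y y').card - 1 / 4 * (doubles y y').card := by
  simp [weight, h]

theorem weight_of_not_isRel {y y' : Fin d → Pt M} (h : ¬ IsRel (vec y y')) : weight y y' = 0 := by
  have h0 : vec y y' ≠ 0 := fun h0 => h (h0 ▸ isRel_zero)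
  simp [weight, pairings_eq_empty h0, doubles_eq_empty h0, h]

/-- Distinct points have one pairing and no double point. If exactly two points agree, there are 2
pairings and 2 · 2 doubles, and 2 − 4/4 = 1. -/
theorem weight_self {y : Fin d → Pt M} {p q : Fin d} (hpq : p ≠ q) (h : CoincideAt y p q) :
    weight y y = 1 := by
  classical
  rw [weight_of_vec_eq_zero (vec_eq_zero_iff.2 ⟨1, fun _ => rfl⟩)]
  by_cases he : y p = y q
  · have h1 : pairings y y = {1, Equiv.swap p q} := by
      ext σ
      simp only [pairings, Finset.mem_filter, Finset.mem_univ, true_and, Finset.mem_insert,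
        Finset.mem_singleton]
      constructor
      · intro hσ
        refine eq_one_or_swap fun j hjp hjq => ?_
        by_contra hj
        rcases h j (σ j) (Ne.symm hj) (hσ j) with ⟨e, -⟩ | ⟨e, -⟩
        · exact hjp e
        · exact hjq e
      · rintro (rfl | rfl) j
        · rfl
        · by_cases hj : j = p
          · rw [hj, Equiv.swap_apply_left, he]
          by_cases hj' : j = q
          · rw [hj', Equiv.swap_apply_right, he]
          rw [Equiv.swap_apply_of_ne_of_ne hj hj']
    have h2 : doubles y y = {1, Equiv.swap p q} ×ˢ ({(p, q), (q, p)} : Finset (Fin d × Fin d)) := by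
      rw [← h1]
      ext ⟨σ, i, j⟩
      simp only [doubles, pairings, Finset.mem_filter, Finset.mem_univ, true_and,
        Finset.mem_product, Finset.mem_insert, Finset.mem_singleton, Prod.mk.injEq]
      constructor
      · rintro ⟨a, b, c⟩
        exact ⟨b, h i j a c⟩
      · rintro ⟨b, ⟨rfl, rfl⟩ | ⟨rfl, rfl⟩⟩
        · exact ⟨hpq, b, he⟩
        · exact ⟨Ne.symm hpq, b, he.symm⟩
    have hne : (1 : Equiv.Perm (Fin d)) ≠ Equiv.swap p q := fun e => hpq (by
      have := congrArg (fun τ : Equiv.Perm (Fin d) => τ p) e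
      simpa using this)
    rw [h2, h1, Finset.card_product, Finset.card_pair hne,
      Finset.card_pair (by simp [hpq])]
    norm_num
  · have hinj : Function.Injective y := fun i j hij => by
      by_contra hne
      rcases h i j hne hij with ⟨rfl, rfl⟩ | ⟨rfl, rfl⟩
      · exact he hij
      · exact he hij.symm
    have h1 : pairings y y = {1} := by
      ext σ
      simp only [pairings, Finset.mem_filter, Finset.mem_univ, true_and, Finset.mem_singleton]
      constructor
      · intro hσ
        ext j
        rw [← hinj (hσ j)]; rfl
      · rintro rfl j
        rfl
    have h2 : doubles y y = ∅ := by
      rw [Finset.eq_empty_iff_forall_notMem]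
      rintro ⟨σ, i, j⟩ hs
      have hs' : i ≠ j ∧ (∀ k, y k = y (σ k)) ∧ y i = y j := by simpa [doubles] using hs
      exact hs'.1 (hinj hs'.2.2)
    simp [h1, h2]

/-- The leading weights count the nonexceptional resonant tuples correctly. -/
theorem weight_eq_one {y y' : Fin d → Pt M} (hd : 2 ≤ d) (h : IsRel (vec y y'))
    {I : Finset (Fin M)} (hy : Covers I y) (hy' : Covers I y')
    (hc : d ≤ (Finset.univ.image fun j => coarse I (y j).2).card + 1) : weight y y' = 1 := by
  classical
  obtain ⟨σ, hσ, hu⟩ := h.exists_perm hy hy'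
  obtain ⟨p, q, hpq, hco⟩ : ∃ p q, p ≠ q ∧ CoincideAt (fun j => coarse I (y j).2) p q := by
    rcases injective_or_coincideAt _ hc with hinj | ⟨p, q, hpq, -, hco⟩
    · exact ⟨⟨0, by omega⟩, ⟨1, by omega⟩, by simp [Fin.ext_iff],
        fun i j hij e => absurd (hinj e) hij⟩
    · exact ⟨p, q, hpq, hco⟩
  rw [← weight_comp_perm y y' σ]
  rw [← vec_comp_perm y y' σ] at h
  have hoff : ∀ j, j ≠ p → j ≠ q → y j = (y' ∘ σ) j := fun j hjp hjq => hu j fun i hij e => by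
    rcases hco i j hij e with ⟨-, rfl⟩ | ⟨-, rfl⟩
    · exact hjq rfl
    · exact hjp rfl
  have hlab : ∀ j, (y j).2 = ((y' ∘ σ) j).2 := hσ
  generalize y' ∘ σ = y'' at h hoff hlab
  clear hu hσ
  by_cases h0 : vec y y'' = 0
  · obtain ⟨τ, hτ⟩ := vec_eq_zero_iff.1 h0
    rw [← weight_comp_perm y y'' τ, show y'' ∘ τ = y from funext fun j => (hτ j).symm]
    exact weight_self hpq fun i j hij e => hco i j hij (by simp only [e])
  · rw [weight, pairings_eq_empty h0, doubles_eq_empty h0, if_pos ⟨h, h0⟩]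
    -- For a tuple with one genuine family the near pairings are the 2 orders on p, q combined with
    -- the 2 orderings of the pair, so that 4/4 = 1.
    have hB : nearPairings y y'' = {1, Equiv.swap p q} ×ˢ ({(p, q), (q, p)} : Finset (Fin d × Fin d)) := by
      ext ⟨τ, a, b⟩
      simp only [nearPairings, Finset.mem_filter, Finset.mem_univ, true_and,
        Finset.mem_product, Finset.mem_insert, Finset.mem_singleton, Prod.mk.injEq]
      constructor
      · rintro ⟨hab, hoff'⟩
        have hq : vec y y'' = quad (y a) (y b) (y'' (τ a)) (y'' (τ b)) := by
          rw [← vec_comp_perm y y'' τ]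
          exact vec_eq_quad hab hoff'
        -- The two unmatched points form the parents or the children of a family, so their labels
        -- agree modulo the directions in I; hence they are the coinciding pair p, q.
        have hab' : coarse I (y a).2 = coarse I (y b).2 := by
          rcases (hq ▸ h).isFam_of_quad (hq ▸ h0) with hf | hf
          · exact hf.coarse_eq fun m hm => hy m a hm
          · exact hf.coarse_eq' fun m hm => hy m a hm
        have hset := hco a b hab hab'
        refine ⟨eq_one_or_swap fun j hjp hjq => ?_, hset⟩
        have h1 : y j = y'' (τ j) := by
          rcases hset with ⟨rfl, rfl⟩ | ⟨rfl, rfl⟩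
          · exact hoff' j hjp hjq
          · exact hoff' j hjq hjp
        by_contra hj
        have h2 : coarse I (y j).2 = coarse I (y (τ j)).2 := by rw [h1, hlab]
        rcases hco j (τ j) (Ne.symm hj) h2 with ⟨e, -⟩ | ⟨e, -⟩
        · exact hjp e
        · exact hjq e
      · rintro ⟨hτ, hab⟩
        have hfix : ∀ j, j ≠ p → j ≠ q → τ j = j := fun j hjp hjq => by
          rcases hτ with rfl | rfl
          · rfl
          · exact Equiv.swap_apply_of_ne_of_ne hjp hjq
        rcases hab with ⟨rfl, rfl⟩ | ⟨rfl, rfl⟩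
        · exact ⟨hpq, fun j hjp hjq => by rw [hfix j hjp hjq]; exact hoff j hjp hjq⟩
        · exact ⟨Ne.symm hpq, fun j hjq hjp => by rw [hfix j hjp hjq]; exact hoff j hjp hjq⟩
    have hne : (1 : Equiv.Perm (Fin d)) ≠ Equiv.swap p q := fun e => hpq (by
      have := congrArg (fun τ : Equiv.Perm (Fin d) => τ p) e
      simpa using this)
    rw [hB, Finset.card_product, Finset.card_pair hne, Finset.card_pair (by simp [hpq])]
    norm_num

theorem abs_weight_le (y y' : Fin d → Pt M) : |weight y y'| ≤ d.factorial * (1 + d ^ 2) := by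
  classical
  have hP : Fintype.card (Equiv.Perm (Fin d)) = d.factorial := by
    rw [Fintype.card_perm, Fintype.card_fin]
  have hT : Fintype.card (Equiv.Perm (Fin d) × Fin d × Fin d) = d.factorial * d ^ 2 := by
    rw [Fintype.card_prod, Fintype.card_prod, hP, Fintype.card_fin, sq]
  have h1 : ((pairings y y').card : ℝ) ≤ d.factorial := by
    exact_mod_cast hP ▸ Finset.card_le_univ _
  have h2 : ((doubles y y').card : ℝ) ≤ d.factorial * d ^ 2 := by
    exact_mod_cast hT ▸ Finset.card_le_univ _
  have h3 : ((nearPairings y y').card : ℝ) ≤ d.factorial * d ^ 2 := by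
    exact_mod_cast hT ▸ Finset.card_le_univ _
  have h1' : (0 : ℝ) ≤ (pairings y y').card := by positivity
  have h2' : (0 : ℝ) ≤ (doubles y y').card := by positivity
  have h3' : (0 : ℝ) ≤ (nearPairings y y').card := by positivity
  rw [weight, abs_le]
  split_ifs <;> constructor <;> nlinarith

end Tuples

/-! ### The sum of the weights -/

section WeightSum

variable {M d : ℕ}

theorem sum_diag {X : Type*} [Fintype X] [DecidableEq X] (h : X × X → ℂ) :
    ∑ x : X × X, (if x.1 = x.2 then h x else 0) = ∑ a, h (a, a) := by
  rw [Fintype.sum_prod_type]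
  simp

/-- All positions but p and q are restricted to the diagonal, so the sum factorizes into a weighted
double sum and d − 2 diagonal sums. -/
theorem sum_off_pair {X : Type*} [Fintype X] [DecidableEq X] {d : ℕ} {p q : Fin d} (hpq : p ≠ q)
    (K : X × X → X × X → ℂ) (h : X × X → ℂ) :
    ∑ x : Fin d → X × X, (if ∀ j, j ≠ p → j ≠ q → (x j).1 = (x j).2 then
      K (x p) (x q) * ∏ j, h (x j) else 0) =
      (∑ s, ∑ t, K s t * (h s * h t)) * (∑ a, h (a, a)) ^ (d - 2) := by
  let F : X × X → X × X → Fin d → X × X → ℂ := fun s t j x =>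
    if j = p then (if x = s then h x else 0) else if j = q then (if x = t then h x else 0) else
      if x.1 = x.2 then h x else 0
  have hsplit : ∀ f : Fin d → ℂ, ∏ j, f j = f p * (f q * ∏ j ∈ (Finset.univ.erase p).erase q, f j) :=
    fun f => by
      rw [Finset.mul_prod_erase _ _ (by simp [Ne.symm hpq]),
        Finset.mul_prod_erase _ _ (Finset.mem_univ p)]
  have hcard : ((Finset.univ.erase p).erase q).card = d - 2 := by
    rw [Finset.card_erase_of_mem (by simp [Ne.symm hpq]),
      Finset.card_erase_of_mem (Finset.mem_univ p), Finset.card_fin]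
    omega
  have hdiag := sum_diag h
  have h1 : ∀ s t, ∑ x : Fin d → X × X, ∏ j, F s t j (x j) =
      h s * (h t * (∑ a, h (a, a)) ^ (d - 2)) := fun s t => by
    rw [← Fintype.piFinset_univ, ← Finset.prod_univ_sum, hsplit]
    congr 1
    · simp [F]
    congr 1
    · simp [F, Ne.symm hpq]
    · rw [← hcard, ← hdiag]
      refine Finset.prod_eq_pow_card fun j hj => ?_
      simp only [Finset.mem_erase, Finset.mem_univ, and_true] at hj
      simp only [F, if_neg hj.1, if_neg hj.2]
  have h2 : ∀ x : Fin d → X × X, (if ∀ j, j ≠ p → j ≠ q → (x j).1 = (x j).2 then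
      K (x p) (x q) * ∏ j, h (x j) else 0) = ∑ s, ∑ t, K s t * ∏ j, F s t j (x j) := fun x => by
    have e : ∀ s t, ∏ j, F s t j (x j) = if x p = s then (if x q = t then
        (if ∀ j, j ≠ p → j ≠ q → (x j).1 = (x j).2 then ∏ j, h (x j) else 0) else 0) else 0 :=
      fun s t => by
        rw [hsplit, hsplit fun j => h (x j)]
        have e1 : ∏ j ∈ (Finset.univ.erase p).erase q, F s t j (x j) =
            ∏ j ∈ (Finset.univ.erase p).erase q, if (x j).1 = (x j).2 then h (x j) else 0 :=
          Finset.prod_congr rfl fun j hj => by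
            simp only [Finset.mem_erase, Finset.mem_univ, and_true] at hj
            simp only [F, if_neg hj.1, if_neg hj.2]
        have e2 : (∀ j ∈ (Finset.univ.erase p).erase q, (x j).1 = (x j).2) ↔
            ∀ j, j ≠ p → j ≠ q → (x j).1 = (x j).2 := by
          simp only [Finset.mem_erase, Finset.mem_univ, and_true]
          exact ⟨fun H j a b => H j ⟨b, a⟩, fun H j ab => H j ab.2 ab.1⟩
        rw [e1, Finset.prod_ite_zero]
        simp only [e2, F, if_true, if_neg (Ne.symm hpq)]
        split_ifs <;> simp
    simp only [e]
    simp
  simp only [h2]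
  rw [Finset.sum_comm, Finset.sum_mul]
  refine Finset.sum_congr rfl fun s _ => ?_
  rw [Finset.sum_comm, Finset.sum_mul]
  refine Finset.sum_congr rfl fun t _ => ?_
  rw [← Finset.mul_sum, h1]
  ring

open Classical in
/-- The contribution of one ordering to the weight. -/
noncomputable def weightTerm (y z : Fin d → Pt M) : ℂ :=
  (if ∀ j, y j = z j then 1 else 0) + 1 / 4 * ∑ p, ∑ q, if p ≠ q then
    (if ∀ j, j ≠ p → j ≠ q → y j = z j then
      (if IsRel (quad (y p) (y q) (z p) (z q)) ∧ quad (y p) (y q) (z p) (z q) ≠ 0 then 1 else 0) -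
        (if y p = y q ∧ y p = z p ∧ y q = z q then 1 else 0) else 0) else 0

/-- Each of the three counts is a sum over σ. Off the positions p, q the vector of the tuple
cancels, so the relation condition concerns a quadruple only; this decouples the sum over tuples. -/
theorem weight_eq_sum (y y' : Fin d → Pt M) :
    (weight y y' : ℂ) = ∑ σ : Equiv.Perm (Fin d), weightTerm y (y' ∘ σ) := by
  classical
  have h1 : ((pairings y y').card : ℂ) =
      ∑ σ : Equiv.Perm (Fin d), if ∀ j, y j = (y' ∘ σ) j then 1 else 0 := by
    rw [Finset.sum_boole]; simp [pairings]
  have h2 : ((doubles y y').card : ℂ) = ∑ σ : Equiv.Perm (Fin d), ∑ p, ∑ q, if p ≠ q then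
      (if ∀ j, j ≠ p → j ≠ q → y j = (y' ∘ σ) j then
        (if y p = y q ∧ y p = (y' ∘ σ) p ∧ y q = (y' ∘ σ) q then 1 else 0) else 0) else 0 := by
    have e : ((doubles y y').card : ℂ) = ∑ s : Equiv.Perm (Fin d) × Fin d × Fin d,
        if s.2.1 ≠ s.2.2 ∧ (∀ j, y j = y' (s.1 j)) ∧ y s.2.1 = y s.2.2 then 1 else 0 := by
      rw [Finset.sum_boole]; rfl
    rw [e, Fintype.sum_prod_type]
    refine Finset.sum_congr rfl fun σ _ => ?_
    rw [Fintype.sum_prod_type]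
    refine Finset.sum_congr rfl fun p _ => Finset.sum_congr rfl fun q _ => ?_
    simp only [← ite_and]
    refine if_congr ?_ rfl rfl
    simp only [Function.comp_apply]
    constructor
    · rintro ⟨a, b, c⟩
      exact ⟨a, fun j _ _ => b j, c, b p, b q⟩
    · rintro ⟨a, b, c, e, f⟩
      refine ⟨a, fun j => ?_, c⟩
      by_cases hp : j = p
      · rw [hp, e]
      by_cases hq : j = q
      · rw [hq, f]
      exact b j hp hq
  have h3 : (if IsRel (vec y y') ∧ vec y y' ≠ 0 then ((nearPairings y y').card : ℂ) else 0) =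
      ∑ σ : Equiv.Perm (Fin d), ∑ p, ∑ q, if p ≠ q then
      (if ∀ j, j ≠ p → j ≠ q → y j = (y' ∘ σ) j then
        (if IsRel (quad (y p) (y q) ((y' ∘ σ) p) ((y' ∘ σ) q)) ∧
          quad (y p) (y q) ((y' ∘ σ) p) ((y' ∘ σ) q) ≠ 0 then 1 else 0) else 0) else 0 := by
    have e : ∀ (σ : Equiv.Perm (Fin d)) p q, (if p ≠ q then
      (if ∀ j, j ≠ p → j ≠ q → y j = (y' ∘ σ) j then
        (if IsRel (quad (y p) (y q) ((y' ∘ σ) p) ((y' ∘ σ) q)) ∧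
          quad (y p) (y q) ((y' ∘ σ) p) ((y' ∘ σ) q) ≠ 0 then (1 : ℂ) else 0) else 0) else 0) =
        if IsRel (vec y y') ∧ vec y y' ≠ 0 then
          (if p ≠ q ∧ ∀ j, j ≠ p → j ≠ q → y j = y' (σ j) then 1 else 0) else 0 := fun σ p q => by
      by_cases hpq : p ≠ q
      · by_cases ho : ∀ j, j ≠ p → j ≠ q → y j = (y' ∘ σ) j
        · rw [if_pos hpq, if_pos ho, ← vec_eq_quad hpq ho, vec_comp_perm,
            if_pos (show p ≠ q ∧ ∀ j, j ≠ p → j ≠ q → y j = y' (σ j) from ⟨hpq, ho⟩)]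
        · rw [if_pos hpq, if_neg ho, if_neg fun H : p ≠ q ∧ ∀ j, j ≠ p → j ≠ q → y j = y' (σ j) => ho H.2,
            ite_self]
      · simp [hpq]
    simp only [e]
    split_ifs
    · simp only [← Fintype.sum_prod_type']
      rw [Finset.sum_boole, nearPairings]
    · simp
  have h4 : (weight y y' : ℂ) = (pairings y y').card - 1 / 4 * (doubles y y').card +
      1 / 4 * if IsRel (vec y y') ∧ vec y y' ≠ 0 then ((nearPairings y y').card : ℂ) else 0 := by
    rw [weight]
    split_ifs <;> push_cast <;> ring
  rw [h4, h1, h2, h3]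
  simp only [weightTerm, Finset.sum_add_distrib, ← Finset.mul_sum]
  rw [sub_add, ← mul_sub, sub_eq_add_neg, ← mul_neg, neg_sub, ← Finset.sum_sub_distrib]
  congr 3
  funext σ
  rw [← Finset.sum_sub_distrib]
  refine Finset.sum_congr rfl fun p _ => ?_
  rw [← Finset.sum_sub_distrib]
  refine Finset.sum_congr rfl fun q _ => ?_
  split_ifs <;> simp

theorem sum_comp_perm {X : Type*} [Fintype X] [DecidableEq X] (Φ : (Fin d → X) → (Fin d → X) → ℂ)
    (u c : X → ℂ) :
    ∑ y : Fin d → X, ∑ y' : Fin d → X, (∑ σ : Equiv.Perm (Fin d), Φ y (y' ∘ σ)) *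
      ((∏ j, u (y j)) * ∏ j, c (y' j)) =
    d.factorial * ∑ y : Fin d → X, ∑ y' : Fin d → X, Φ y y' *
      ((∏ j, u (y j)) * ∏ j, c (y' j)) := by
  have h : ∀ (y : Fin d → X) (σ : Equiv.Perm (Fin d)), ∑ y' : Fin d → X, Φ y (y' ∘ σ) *
      ((∏ j, u (y j)) * ∏ j, c (y' j)) =
      ∑ y' : Fin d → X, Φ y y' * ((∏ j, u (y j)) * ∏ j, c (y' j)) := fun y σ => by
    rw [← Equiv.sum_comp (Equiv.arrowCongr σ (Equiv.refl X))]
    refine Finset.sum_congr rfl fun y' _ => ?_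
    have e : (Equiv.arrowCongr σ (Equiv.refl X) y') ∘ σ = y' := by ext; simp
    rw [e]
    congr 2
    exact Equiv.prod_comp σ.symm fun j => c (y' j)
  simp only [Finset.sum_mul]
  rw [Finset.mul_sum]
  refine Finset.sum_congr rfl fun y _ => ?_
  rw [Finset.sum_comm]
  simp only [h]
  rw [Finset.sum_const, Finset.card_univ, Fintype.card_perm, Fintype.card_fin, nsmul_eq_mul]

open Classical in
-- A quadruple is parametrized by its first parent and the order of its children. As v runs over all
-- labels, each family occurs once for either order of the parents.
theorem sum_isFam (G : Pt M → Pt M → Pt M → Pt M → ℂ) :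
    ∑ s : Pt M × Pt M, ∑ t : Pt M × Pt M, (if IsFam s.1 t.1 s.2 t.2 then G s.1 t.1 s.2 t.2 else 0) =
      ∑ m : Fin M, ∑ v : Cube M,
        (G (m.castSucc, v) (m.castSucc, v + dir m) (m.succ, v) (m.succ, v + dir m) +
          G (m.castSucc, v) (m.castSucc, v + dir m) (m.succ, v + dir m) (m.succ, v)) := by
  let f : (Fin M × Cube M) × Bool → (Pt M × Pt M) × (Pt M × Pt M) := fun x =>
    if x.2 then (((x.1.1.castSucc, x.1.2), (x.1.1.succ, x.1.2)),
      ((x.1.1.castSucc, x.1.2 + dir x.1.1), (x.1.1.succ, x.1.2 + dir x.1.1)))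
    else (((x.1.1.castSucc, x.1.2), (x.1.1.succ, x.1.2 + dir x.1.1)),
      ((x.1.1.castSucc, x.1.2 + dir x.1.1), (x.1.1.succ, x.1.2)))
  have hf : Function.Injective f := by
    rintro ⟨⟨m, v⟩, b⟩ ⟨⟨m', v'⟩, b'⟩ h
    have h1 : ((m.castSucc, v) : Pt M) = (m'.castSucc, v') := by
      have := congrArg (fun x => x.1.1) h
      cases b <;> cases b' <;> exact this
    obtain ⟨hm, rfl⟩ := Prod.ext_iff.1 h1
    obtain rfl := Fin.castSucc_injective _ hm
    have h2 := congrArg (fun x => x.1.2.2) h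
    cases b <;> cases b'
    · rfl
    · exact absurd h2 (add_dir_ne v m)
    · exact absurd h2.symm (add_dir_ne v m)
    · rfl
  rw [← Fintype.sum_prod_type' (f := fun s t : Pt M × Pt M =>
    if IsFam s.1 t.1 s.2 t.2 then G s.1 t.1 s.2 t.2 else 0), ← Finset.sum_filter]
  have himg : (Finset.univ.filter fun x : (Pt M × Pt M) × (Pt M × Pt M) =>
      IsFam x.1.1 x.2.1 x.1.2 x.2.2) = Finset.univ.image f := by
    ext ⟨⟨a, c⟩, ⟨b, e⟩⟩
    simp only [Finset.mem_filter, Finset.mem_univ, true_and, Finset.mem_image]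
    constructor
    · rintro ⟨m, v, rfl, rfl, ⟨rfl, rfl⟩ | ⟨rfl, rfl⟩⟩
      · exact ⟨((m, v), true), rfl⟩
      · exact ⟨((m, v), false), rfl⟩
    · rintro ⟨⟨⟨m, v⟩, b⟩, hx⟩
      refine ⟨m, v, ?_⟩
      cases b <;> simp only [f, if_true, Bool.false_eq_true, if_false, Prod.mk.injEq] at hx <;>
        simp [← hx.1.1, ← hx.1.2, ← hx.2.1, ← hx.2.2]
  rw [himg, Finset.sum_image hf.injOn, Fintype.sum_prod_type, Fintype.sum_prod_type]
  simp [f]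

theorem IsFam.not_swap {a b c e : Pt M} (h : IsFam a b c e) : ¬ IsFam c e a b := by
  rintro ⟨m', v', rfl, rfl, h'⟩
  obtain ⟨m, v, rfl, rfl, h⟩ := h
  have e1 : (m' : ℕ) = m + 1 := by
    rcases h with ⟨h, -⟩ | ⟨h, -⟩ <;> simpa using congrArg (fun x : Pt M => x.1.1) h
  have e2 : (m : ℕ) = m' + 1 := by
    rcases h' with ⟨h, -⟩ | ⟨h, -⟩ <;> simpa using congrArg (fun x : Pt M => x.1.1) h
  omega

theorem Cube.card (M : ℕ) : Fintype.card (Cube M) = 2 ^ M := by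
  simp [Cube, ZMod.card]

/-- The leading part of the restricted Hamiltonian. -/
theorem sum_weight (hd : 2 ≤ d) (u c : Fin (M + 1) → ℂ) :
    ∑ y : Fin d → Pt M, ∑ y' : Fin d → Pt M, (weight y y' : ℂ) *
      ((∏ j, u (y j).1) * ∏ j, c (y' j).1) =
    d.factorial * ((2 ^ M * ∑ l, u l * c l) ^ d +
      1 / 4 * (d * (d - 1)) * (2 ^ M * (2 * ∑ m : Fin M, ((u m.castSucc * c m.succ) ^ 2 +
        (c m.castSucc * u m.succ) ^ 2) - ∑ l, (u l * c l) ^ 2)) *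
          (2 ^ M * ∑ l, u l * c l) ^ (d - 2)) := by
  classical
  simp only [weight_eq_sum]
  rw [sum_comp_perm weightTerm (fun x : Pt M => u x.1) fun x => c x.1]
  congr 1
  have hdiag : ∀ f : Fin (M + 1) → ℂ, ∑ a : Pt M, f a.1 = 2 ^ M * ∑ l, f l := fun f => by
    rw [Fintype.sum_prod_type, Finset.mul_sum]
    simp
  let h : Pt M × Pt M → ℂ := fun s => u s.1.1 * c s.2.1
  let K : Pt M × Pt M → Pt M × Pt M → ℂ := fun s t =>
    (if IsRel (quad s.1 t.1 s.2 t.2) ∧ quad s.1 t.1 s.2 t.2 ≠ 0 then 1 else 0) -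
      (if s.1 = t.1 ∧ s.1 = s.2 ∧ t.1 = t.2 then 1 else 0)
  have hh : ∑ a, h (a, a) = 2 ^ M * ∑ l, u l * c l := hdiag fun l => u l * c l
  -- Per pair of consecutive generations there are 2^M ordered couples of parents and 2 orders of
  -- the children, with either the parents or the children in the slots of r. The subtracted part is
  -- the fourfold coincidence of a single point.
  have hK : ∑ s, ∑ t, K s t * (h s * h t) = 2 ^ M * (2 * ∑ m : Fin M,
      ((u m.castSucc * c m.succ) ^ 2 + (c m.castSucc * u m.succ) ^ 2) - ∑ l, (u l * c l) ^ 2) := by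
    have e1 : ∀ s t, K s t * (h s * h t) =
        (if IsFam s.1 t.1 s.2 t.2 then u s.1.1 * c s.2.1 * (u t.1.1 * c t.2.1) else 0) +
        (if IsFam s.2 t.2 s.1 t.1 then u s.1.1 * c s.2.1 * (u t.1.1 * c t.2.1) else 0) -
        (if s.1 = t.1 ∧ s.1 = s.2 ∧ t.1 = t.2 then u s.1.1 * c s.2.1 * (u t.1.1 * c t.2.1) else 0) :=
      fun s t => by
        have e2 : (if IsRel (quad s.1 t.1 s.2 t.2) ∧ quad s.1 t.1 s.2 t.2 ≠ 0 then (1 : ℂ) else 0) =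
            (if IsFam s.1 t.1 s.2 t.2 then 1 else 0) + (if IsFam s.2 t.2 s.1 t.1 then 1 else 0) := by
          by_cases h1 : IsFam s.1 t.1 s.2 t.2
          · simp [h1, h1.isRel, h1.quad_ne_zero, h1.not_swap]
          · by_cases h2 : IsFam s.2 t.2 s.1 t.1
            · have h3 : quad s.1 t.1 s.2 t.2 = -quad s.2 t.2 s.1 t.1 := quad_swap _ _ _ _
              rw [if_pos, if_neg h1, if_pos h2, zero_add]
              rw [h3]
              exact ⟨h2.isRel.neg, neg_ne_zero.2 h2.quad_ne_zero⟩
            · rw [if_neg, if_neg h1, if_neg h2, add_zero]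
              rintro ⟨h3, h4⟩
              rcases h3.isFam_of_quad h4 with h5 | h5
              · exact h1 h5
              · exact h2 h5
        simp only [K, h, e2]
        split_ifs <;> ring
    have s1 : ∑ s : Pt M × Pt M, ∑ t : Pt M × Pt M,
        (if IsFam s.1 t.1 s.2 t.2 then u s.1.1 * c s.2.1 * (u t.1.1 * c t.2.1) else 0) =
        2 ^ M * (2 * ∑ m : Fin M, (u m.castSucc * c m.succ) ^ 2) := by
      rw [sum_isFam fun a b c' e => u a.1 * c c'.1 * (u b.1 * c e.1)]
      simp only [Finset.sum_const, Finset.card_univ, Cube.card, Finset.mul_sum, nsmul_eq_mul]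
      exact Finset.sum_congr rfl fun m _ => by push_cast; ring
    have s2 : ∑ s : Pt M × Pt M, ∑ t : Pt M × Pt M,
        (if IsFam s.2 t.2 s.1 t.1 then u s.1.1 * c s.2.1 * (u t.1.1 * c t.2.1) else 0) =
        2 ^ M * (2 * ∑ m : Fin M, (c m.castSucc * u m.succ) ^ 2) := by
      have e : ∀ f : Pt M × Pt M → Pt M × Pt M → ℂ, ∑ s, ∑ t, f s t =
          ∑ s : Pt M × Pt M, ∑ t : Pt M × Pt M, f s.swap t.swap := fun f => by
        rw [← Equiv.sum_comp (Equiv.prodComm (Pt M) (Pt M))]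
        refine Finset.sum_congr rfl fun s _ => ?_
        rw [← Equiv.sum_comp (Equiv.prodComm (Pt M) (Pt M))]
        rfl
      rw [e]
      simp only [Prod.fst_swap, Prod.snd_swap]
      rw [sum_isFam fun a b c' e => u c'.1 * c a.1 * (u e.1 * c b.1)]
      simp only [Finset.sum_const, Finset.card_univ, Cube.card, Finset.mul_sum, nsmul_eq_mul]
      exact Finset.sum_congr rfl fun m _ => by push_cast; ring
    have s3 : ∑ s : Pt M × Pt M, ∑ t : Pt M × Pt M, (if s.1 = t.1 ∧ s.1 = s.2 ∧ t.1 = t.2 then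
        u s.1.1 * c s.2.1 * (u t.1.1 * c t.2.1) else 0) = 2 ^ M * ∑ l, (u l * c l) ^ 2 := by
      rw [← hdiag fun l => (u l * c l) ^ 2, Fintype.sum_prod_type]
      refine Finset.sum_congr rfl fun a _ => ?_
      rw [Finset.sum_eq_single a, Finset.sum_eq_single (a, a)]
      · simp; ring
      · rintro ⟨b, b'⟩ _ hb
        rw [if_neg]
        rintro ⟨rfl, -, h⟩
        have h' : a = b' := h
        exact hb (by rw [← h'])
      · simp
      · intro b _ hb
        refine Finset.sum_eq_zero fun t _ => ?_
        rw [if_neg]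
        rintro ⟨-, h, -⟩
        exact hb h.symm
      · simp
    simp only [e1, Finset.sum_sub_distrib, Finset.sum_add_distrib, s1, s2, s3]
    ring
  have hx : ∀ Φ : (Fin d → Pt M) → (Fin d → Pt M) → ℂ,
      ∑ y : Fin d → Pt M, ∑ z : Fin d → Pt M, Φ y z * ((∏ j, u (y j).1) * ∏ j, c (z j).1) =
      ∑ x : Fin d → Pt M × Pt M, Φ (fun j => (x j).1) (fun j => (x j).2) * ∏ j, h (x j) := fun Φ => by
    rw [← Fintype.sum_prod_type' (f := fun y z : Fin d → Pt M =>
      Φ y z * ((∏ j, u (y j).1) * ∏ j, c (z j).1)),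
      ← Equiv.sum_comp (Equiv.arrowProdEquivProdArrow (Fin d) (fun _ => Pt M) fun _ => Pt M)]
    refine Finset.sum_congr rfl fun x _ => ?_
    simp only [h, Finset.prod_mul_distrib]
    rfl
  rw [hx]
  simp only [weightTerm, add_mul, Finset.sum_add_distrib]
  congr 1
  · rw [← hh]
    rw [← sum_diag h, Fintype.sum_pow]
    refine Finset.sum_congr rfl fun x _ => ?_
    rw [Finset.prod_ite_zero]
    simp
  · have e : ∀ p q : Fin d, ∑ x : Fin d → Pt M × Pt M, (if p ≠ q then
        (if ∀ j, j ≠ p → j ≠ q → (x j).1 = (x j).2 then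
          (if IsRel (quad (x p).1 (x q).1 (x p).2 (x q).2) ∧
            quad (x p).1 (x q).1 (x p).2 (x q).2 ≠ 0 then 1 else 0) -
          (if (x p).1 = (x q).1 ∧ (x p).1 = (x p).2 ∧ (x q).1 = (x q).2 then 1 else 0)
            else 0) else 0) * ∏ j, h (x j) =
        if p ≠ q then (∑ s, ∑ t, K s t * (h s * h t)) * (∑ a, h (a, a)) ^ (d - 2) else 0 :=
      fun p q => by
        split_ifs with hpq
        · rw [← sum_off_pair hpq]
          refine Finset.sum_congr rfl fun x _ => ?_
          rw [ite_mul, zero_mul]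
        · simp
    simp only [mul_assoc, ← Finset.mul_sum, Finset.sum_mul]
    rw [Finset.sum_comm]
    simp only [Finset.sum_comm (s := (Finset.univ : Finset (Fin d → Pt M × Pt M))), e]
    rw [hK, hh]
    have hoff : ∀ C : ℂ, ∑ p : Fin d, ∑ q : Fin d, (if p ≠ q then C else 0) = d * (d - 1) * C :=
      fun C => by
        have e1 : ∀ p : Fin d, ∑ q : Fin d, (if p ≠ q then C else 0) = (d - 1) * C := fun p => by
          rw [← Finset.sum_filter, Finset.sum_const, nsmul_eq_mul]
          congr 1
          have : (Finset.univ.filter fun q => p ≠ q) = Finset.univ.erase p := by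
            ext; simp [eq_comm]
          rw [this, Finset.card_erase_of_mem (Finset.mem_univ p), Finset.card_fin,
            Nat.cast_sub (by omega), Nat.cast_one]
        simp only [e1, Finset.sum_const, Finset.card_fin, nsmul_eq_mul, mul_assoc]
    rw [hoff]
    simp only [Finset.sum_add_distrib]
    ring

end WeightSum

/-! ### The remainder of the leading part -/

section Excess

variable {M d : ℕ}

/-- The tuple with the generations `α` and the labels `v`. -/
def pts (α : Fin d → Fin (M + 1)) (v : Fin d → Cube M) : Fin d → Pt M := fun j => (α j, v j)

open Classical in
/-- The deviation of a tuple from the leading part. -/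
noncomputable def defect (y y' : Fin d → Pt M) : ℝ :=
  (if IsRel (vec y y') then 1 else 0) - weight y y'

/-- The number of resonant tuples with given generations, up to the leading part. -/
noncomputable def excess (α β : Fin d → Fin (M + 1)) : ℝ :=
  ∑ v : Fin d → Cube M, ∑ v' : Fin d → Cube M, defect (pts α v) (pts β v')

open Classical in
/-- The directions of the families that meet the generations of `α` and `β`. -/
noncomputable def directions (α β : Fin d → Fin (M + 1)) : Finset (Fin M) :=
  Finset.univ.filter fun m => ∃ j, (α j = m.castSucc ∨ α j = m.succ) ∨ β j = m.castSucc ∨ β j = m.succ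

theorem card_directions_le (α β : Fin d → Fin (M + 1)) : (directions α β).card ≤ 4 * d := by
  classical
  let F : Fin (M + 1) → Finset (Fin M) := fun l =>
    Finset.univ.filter fun m => l = m.castSucc ∨ l = m.succ
  have hF : ∀ l, (F l).card ≤ 2 := fun l => by
    simp only [F, Finset.filter_or]
    refine (Finset.card_union_le _ _).trans ?_
    have h1 : (Finset.univ.filter fun m : Fin M => l = m.castSucc).card ≤ 1 :=
      Finset.card_le_one.2 fun a ha b hb => Fin.castSucc_injective _
        ((Finset.mem_filter.1 ha).2.symm.trans (Finset.mem_filter.1 hb).2)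
    have h2 : (Finset.univ.filter fun m : Fin M => l = m.succ).card ≤ 1 :=
      Finset.card_le_one.2 fun a ha b hb => Fin.succ_injective _
        ((Finset.mem_filter.1 ha).2.symm.trans (Finset.mem_filter.1 hb).2)
    omega
  have hsub : directions α β ⊆ Finset.univ.biUnion fun j => F (α j) ∪ F (β j) := fun m hm => by
    obtain ⟨j, hj⟩ := (Finset.mem_filter.1 hm).2
    simp only [F, Finset.mem_biUnion, Finset.mem_union, Finset.mem_filter, Finset.mem_univ,
      true_and]
    exact ⟨j, hj⟩
  refine (Finset.card_le_card hsub).trans (Finset.card_biUnion_le.trans ?_)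
  refine (Finset.sum_le_card_nsmul _ _ 4 fun j _ => ?_).trans (by simp [mul_comm])
  exact (Finset.card_union_le _ _).trans (by linarith [hF (α j), hF (β j)])

open Classical in
/-- Few tuples of labels have many coincidences. -/
theorem card_coincident_le (I : Finset (Fin M)) :
    (Finset.univ.filter fun v : Fin d → Cube M =>
      (Finset.univ.image fun j => coarse I (v j)).card ≤ d - 2).card ≤
      (d - 2) ^ d * (2 ^ M) ^ (d - 2) * (2 ^ I.card) ^ d := by
  let W : Finset (Cube M) := Fintype.piFinset fun m => if m ∈ I then Finset.univ else {0}
  have hW : W.card = 2 ^ I.card := by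
    rw [Fintype.card_piFinset, ← Finset.prod_const]
    have : ∀ m, (if m ∈ I then (Finset.univ : Finset (ZMod 2)) else {0}).card =
        if m ∈ I then 2 else 1 := fun m => by split_ifs <;> simp [ZMod.card]
    simp only [this, Finset.prod_ite_mem, Finset.univ_inter]
  -- A tuple with at most d − 2 classes is encoded by the class of each entry, the representatives
  -- of the classes, and offsets supported in I. The three factors of the bound count these data.
  -- For d = 2 the bound is 0.
  let f : (Fin d → Fin (d - 2)) × (Fin (d - 2) → Cube M) × (Fin d → W) → Fin d → Cube M :=
    fun x j => x.2.1 (x.1 j) + x.2.2 j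
  have hsub : (Finset.univ.filter fun v : Fin d → Cube M =>
      (Finset.univ.image fun j => coarse I (v j)).card ≤ d - 2) ⊆ Finset.univ.image f := by
    intro v hv
    have hv := (Finset.mem_filter.1 hv).2
    set T := Finset.univ.image fun j => coarse I (v j) with hT
    obtain ⟨e⟩ : Nonempty (T ↪ Fin (d - 2)) := by
      rw [Function.Embedding.nonempty_iff_card_le, Fintype.card_coe, Fintype.card_fin]
      exact hv
    have hm : ∀ j, coarse I (v j) ∈ T := fun j => Finset.mem_image.2 ⟨j, Finset.mem_univ _, rfl⟩
    refine Finset.mem_image.2 ⟨(fun j => e ⟨_, hm j⟩, Function.extend e Subtype.val 0,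
      fun j => ⟨v j - coarse I (v j), ?_⟩), Finset.mem_univ _, ?_⟩
    · refine Fintype.mem_piFinset.2 fun m => ?_
      by_cases hmI : m ∈ I <;> simp [coarse, hmI]
    · funext j
      simp only [f, e.injective.extend_apply]
      abel
  refine (Finset.card_le_card hsub).trans (Finset.card_image_le.trans (le_of_eq ?_))
  simp [Finset.card_univ, Fintype.card_prod, hW, mul_assoc, ZMod.card]

/-- The bound of the remainder, independent of the number of generations. -/
noncomputable def excessBound (d : ℕ) : ℝ :=
  (1 + d.factorial * (1 + d ^ 2)) * (d.factorial * ((d - 2 : ℕ) ^ d * (2 ^ (4 * d)) ^ d))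

theorem abs_excess_le (hd : 2 ≤ d) (α β : Fin d → Fin (M + 1)) :
    |excess α β| ≤ excessBound d * (2 ^ M) ^ (d - 2) := by
  classical
  set I := directions α β with hI
  have hα : ∀ v, Covers I (pts α v) := fun v m j h =>
    Finset.mem_filter.2 ⟨Finset.mem_univ _, j, Or.inl h⟩
  have hβ : ∀ v, Covers I (pts β v) := fun v m j h =>
    Finset.mem_filter.2 ⟨Finset.mem_univ _, j, Or.inr h⟩
  set E := Finset.univ.filter fun v : Fin d → Cube M =>
    (Finset.univ.image fun j => coarse I (v j)).card ≤ d - 2 with hE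
  set C : ℝ := 1 + d.factorial * (1 + d ^ 2) with hC
  have hC0 : 0 ≤ C := by positivity
  -- A defect can occur only for labels v with at most d − 2 classes and for v' a reordering of v.
  -- This leaves at most d! choices of v' for each v, and C bounds a single defect.
  have hdef : ∀ v v', |defect (pts α v) (pts β v')| ≤
      ∑ σ : Equiv.Perm (Fin d), if v ∈ E ∧ v' = v ∘ σ then C else 0 := fun v v' => by
    have hnn : 0 ≤ ∑ σ : Equiv.Perm (Fin d), if v ∈ E ∧ v' = v ∘ σ then C else 0 :=
      Finset.sum_nonneg fun σ _ => by split_ifs <;> simp [hC0]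
    by_cases hr : IsRel (vec (pts α v) (pts β v'))
    · by_cases hv : v ∈ E
      · obtain ⟨σ, hσ, -⟩ := hr.exists_perm (hα v) (hβ v')
        have hσ' : v' = v ∘ σ.symm := by
          funext j
          have := hσ (σ.symm j)
          simp only [pts, Equiv.apply_symm_apply] at this
          exact this.symm
        refine le_trans ?_ (Finset.single_le_sum (f := fun σ : Equiv.Perm (Fin d) =>
          if v ∈ E ∧ v' = v ∘ σ then C else 0) (fun σ _ => by split_ifs <;> simp [hC0])
          (Finset.mem_univ σ.symm))
        simp only [if_pos (And.intro hv hσ')]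
        rw [defect, if_pos hr]
        refine (abs_sub _ _).trans ?_
        rw [abs_one]
        linarith [abs_weight_le (pts α v) (pts β v')]
      · rw [defect, if_pos hr, weight_eq_one hd hr (hα v) (hβ v'), sub_self, abs_zero]
        · exact hnn
        · have : ¬ (Finset.univ.image fun j => coarse I (v j)).card ≤ d - 2 := fun h =>
            hv (Finset.mem_filter.2 ⟨Finset.mem_univ _, h⟩)
          simp only [pts]
          omega
    · rw [defect, if_neg hr, weight_of_not_isRel hr, sub_self, abs_zero]
      exact hnn
  calc |excess α β| ≤ ∑ v, ∑ v', |defect (pts α v) (pts β v')| :=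
        (Finset.abs_sum_le_sum_abs _ _).trans
          (Finset.sum_le_sum fun v _ => Finset.abs_sum_le_sum_abs _ _)
    _ ≤ ∑ v : Fin d → Cube M, ∑ v', ∑ σ : Equiv.Perm (Fin d),
          if v ∈ E ∧ v' = v ∘ σ then C else 0 :=
        Finset.sum_le_sum fun v _ => Finset.sum_le_sum fun v' _ => hdef v v'
    _ = ∑ v : Fin d → Cube M, if v ∈ E then d.factorial * C else 0 := by
        refine Finset.sum_congr rfl fun v _ => ?_
        rw [Finset.sum_comm]
        by_cases hv : v ∈ E
        · simp [hv, Fintype.card_perm]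
        · simp [hv]
    _ = E.card * (d.factorial * C) := by
        rw [Finset.sum_ite_mem, Finset.univ_inter, Finset.sum_const, nsmul_eq_mul]
    _ ≤ ((d - 2 : ℕ) ^ d * (2 ^ M) ^ (d - 2) * (2 ^ (4 * d)) ^ d) * (d.factorial * C) := by
        gcongr
        have h1 := card_coincident_le (d := d) I
        have h2 : (2 ^ I.card) ^ d ≤ (2 ^ (4 * d)) ^ d := by
          gcongr
          · norm_num
          · exact card_directions_le α β
        have h3 := h1.trans (Nat.mul_le_mul_left _ h2)
        exact_mod_cast h3
    _ = excessBound d * (2 ^ M) ^ (d - 2) := by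
        rw [excessBound, hC]; ring

/-! ### Symmetries of the remainder -/

theorem vec_map_apply {Θ : Pt M → Pt M} (hΘ : Function.Injective Θ) (y y' : Fin d → Pt M)
    (z : Pt M) : vec (Θ ∘ y) (Θ ∘ y') (Θ z) = vec y y' z := by
  simp only [vec_apply, Function.comp_apply, hΘ.eq_iff]

theorem vec_map_eq_zero_iff {Θ : Pt M → Pt M} (hΘ : Function.Injective Θ) (y y' : Fin d → Pt M) :
    vec (Θ ∘ y) (Θ ∘ y') = 0 ↔ vec y y' = 0 := by
  simp only [vec_eq_zero_iff, Function.comp_apply, hΘ.eq_iff]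

/-- Apart from the relation condition, the defect depends only on which points coincide, and
injections preserve this. -/
theorem defect_map {Θ : Pt M → Pt M} (hΘ : Function.Injective Θ) {y y' : Fin d → Pt M}
    (h : IsRel (vec (Θ ∘ y) (Θ ∘ y')) ↔ IsRel (vec y y')) :
    defect (Θ ∘ y) (Θ ∘ y') = defect y y' := by
  have h1 : pairings (Θ ∘ y) (Θ ∘ y') = pairings y y' := by
    simp only [pairings, Function.comp_apply, hΘ.eq_iff]
  have h2 : doubles (Θ ∘ y) (Θ ∘ y') = doubles y y' := by
    simp only [doubles, Function.comp_apply, hΘ.eq_iff]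
  have h3 : nearPairings (Θ ∘ y) (Θ ∘ y') = nearPairings y y' := by
    simp only [nearPairings, Function.comp_apply, hΘ.eq_iff]
  have h4 := vec_map_eq_zero_iff hΘ y y'
  simp only [defect, weight, h1, h2, h3]
  split_ifs <;> first | rfl | (exfalso; tauto)

theorem card_swap_aux {d : ℕ} {X : Type*} (y y' : Fin d → X) (σ : Equiv.Perm (Fin d)) :
    (∀ j, y' j = y (σ j)) ↔ ∀ j, y j = y' (σ.symm j) :=
  ⟨fun h j => by rw [h, Equiv.apply_symm_apply],
    fun h j => by rw [h, Equiv.symm_apply_apply]⟩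

/-- Pairings are inverted, and the distinguished positions p, q are carried along by σ. -/
theorem weight_swap (y y' : Fin d → Pt M) : weight y' y = weight y y' := by
  classical
  have h1 : (pairings y' y).card = (pairings y y').card :=
    Finset.card_bij (fun σ _ => σ.symm)
      (fun σ hσ => by simpa [pairings, card_swap_aux y y'] using hσ)
      (fun _ _ _ _ h => Equiv.symm_bijective.injective h)
      fun σ hσ => ⟨σ.symm, by simpa [pairings, card_swap_aux y y'] using hσ, σ.symm_symm⟩
  have h2 : (doubles y' y).card = (doubles y y').card := by
    refine Finset.card_bij (fun s _ => (s.1.symm, s.1 s.2.1, s.1 s.2.2)) ?_ ?_ ?_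
    · rintro ⟨σ, p, q⟩ hs
      simp only [doubles, Finset.mem_filter, Finset.mem_univ, true_and] at hs ⊢
      refine ⟨σ.injective.ne hs.1, (card_swap_aux y y' σ).1 hs.2.1, ?_⟩
      rw [← hs.2.1, ← hs.2.1, hs.2.2]
    · rintro ⟨σ, p, q⟩ _ ⟨σ', p', q'⟩ _ h
      simp only [Prod.mk.injEq] at h
      obtain ⟨h0, h1, h2⟩ := h
      obtain rfl := Equiv.symm_bijective.injective h0
      rw [σ.injective h1, σ.injective h2]
    · rintro ⟨σ, p, q⟩ hs
      simp only [doubles, Finset.mem_filter, Finset.mem_univ, true_and] at hs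
      refine ⟨(σ.symm, σ p, σ q), ?_, by simp⟩
      simp only [doubles, Finset.mem_filter, Finset.mem_univ, true_and]
      refine ⟨σ.injective.ne hs.1, (card_swap_aux y' y σ).1 hs.2.1, ?_⟩
      rw [← hs.2.1, ← hs.2.1, hs.2.2]
  have h3 : (nearPairings y' y).card = (nearPairings y y').card := by
    have key : ∀ (y y' : Fin d → Pt M) (σ : Equiv.Perm (Fin d)) (p q : Fin d),
        (∀ j, j ≠ p → j ≠ q → y' j = y (σ j)) →
        ∀ j, j ≠ σ p → j ≠ σ q → y j = y' (σ.symm j) := fun y y' σ p q h j hp hq => by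
      rw [h, Equiv.apply_symm_apply]
      · rintro rfl; exact hp (by simp)
      · rintro rfl; exact hq (by simp)
    refine Finset.card_bij (fun s _ => (s.1.symm, s.1 s.2.1, s.1 s.2.2)) ?_ ?_ ?_
    · rintro ⟨σ, p, q⟩ hs
      simp only [nearPairings, Finset.mem_filter, Finset.mem_univ, true_and] at hs ⊢
      exact ⟨σ.injective.ne hs.1, key y y' σ p q hs.2⟩
    · rintro ⟨σ, p, q⟩ _ ⟨σ', p', q'⟩ _ h
      simp only [Prod.mk.injEq] at h
      obtain ⟨h0, h1, h2⟩ := h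
      obtain rfl := Equiv.symm_bijective.injective h0
      rw [σ.injective h1, σ.injective h2]
    · rintro ⟨σ, p, q⟩ hs
      simp only [nearPairings, Finset.mem_filter, Finset.mem_univ, true_and] at hs
      refine ⟨(σ.symm, σ p, σ q), ?_, by simp⟩
      simp only [nearPairings, Finset.mem_filter, Finset.mem_univ, true_and]
      exact ⟨σ.injective.ne hs.1, key y' y σ p q hs.2⟩
  have h4 : IsRel (vec y' y) ↔ IsRel (vec y y') := by
    rw [vec_swap y y']
    exact ⟨fun h => by simpa using h.neg, fun h => h.neg⟩
  have h5 : vec y' y = 0 ↔ vec y y' = 0 := by rw [vec_swap y y', neg_eq_zero]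
  by_cases hr : IsRel (vec y y') <;> by_cases h0 : vec y y' = 0 <;>
    simp [weight, h1, h2, h3, h4, h5, hr, h0]

theorem defect_swap (y y' : Fin d → Pt M) : defect y' y = defect y y' := by
  have h4 : IsRel (vec y' y) ↔ IsRel (vec y y') := by
    rw [vec_swap y y']
    exact ⟨fun h => by simpa using h.neg, fun h => h.neg⟩
  by_cases hr : IsRel (vec y y') <;> simp [defect, weight_swap, h4, hr]

theorem excess_swap (α β : Fin d → Fin (M + 1)) : excess β α = excess α β := by
  rw [excess, excess, Finset.sum_comm]
  simp only [defect_swap]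

/-- A map of points that acts on generations and on labels. -/
def actPt (π : Equiv.Perm (Fin (M + 1))) (η : Equiv.Perm (Cube M)) (x : Pt M) : Pt M := (π x.1, η x.2)

theorem actPt_injective (π : Equiv.Perm (Fin (M + 1))) (η : Equiv.Perm (Cube M)) :
    Function.Injective (actPt π η) := fun _ _ h =>
  Prod.ext (π.injective (congrArg Prod.fst h)) (η.injective (congrArg Prod.snd h))

theorem excess_map {π : Equiv.Perm (Fin (M + 1))} (η : Equiv.Perm (Cube M))
    {α β : Fin d → Fin (M + 1)}
    (h : ∀ v v', IsRel (vec (actPt π η ∘ pts α v) (actPt π η ∘ pts β v')) ↔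
      IsRel (vec (pts α v) (pts β v'))) :
    excess (π ∘ α) (π ∘ β) = excess α β := by
  let Φ : Equiv.Perm (Fin d → Cube M) := Equiv.arrowCongr (Equiv.refl (Fin d)) η
  have hΦ : ∀ (γ : Fin d → Fin (M + 1)) v, pts (π ∘ γ) (Φ v) = actPt π η ∘ pts γ v :=
    fun γ v => rfl
  symm
  refine Fintype.sum_equiv Φ _ _ fun v => Fintype.sum_equiv Φ _ _ fun v' => ?_
  rw [hΦ, hΦ, defect_map (actPt_injective π η) (h v v')]

theorem vec_pts_apply (α β : Fin d → Fin (M + 1)) (v v' : Fin d → Cube M) (l : Fin (M + 1))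
    (w : Cube M) : vec (pts α v) (pts β v') (l, w) =
      ∑ j, ((if α j = l ∧ v j = w then 1 else 0) - if β j = l ∧ v' j = w then 1 else 0) := by
  simp only [vec_apply, pts, Prod.mk.injEq]

theorem vec_pts_eq_zero {α β : Fin d → Fin (M + 1)} (v v' : Fin d → Cube M) {l : Fin (M + 1)}
    (hα : ∀ j, α j ≠ l) (hβ : ∀ j, β j ≠ l) (w : Cube M) : vec (pts α v) (pts β v') (l, w) = 0 := by
  simp [vec_pts_apply, hα, hβ]

/-- A relation in which one of two generations occurs only twice, with opposite signs, is
trivial. -/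
theorem isRel_vec_iff_of_single {α β : Fin d → Fin (M + 1)} {i j : Fin (M + 1)}
    (hα : ∀ k, α k = i ∨ α k = j) (hβ : ∀ k, β k = i ∨ β k = j)
    {p q : Fin d} (hp : ∀ k, α k = i ↔ k = p) (hq : ∀ k, β k = i ↔ k = q) (v v' : Fin d → Cube M) :
    IsRel (vec (pts α v) (pts β v')) ↔ vec (pts α v) (pts β v') = 0 := by
  refine ⟨fun h => ?_, fun h => h ▸ isRel_zero⟩
  by_contra h0
  obtain ⟨a, b, hab, ⟨w, hw⟩, ⟨w', hw'⟩, h1, h2⟩ := IsRelOn.extremal h h0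
    (fun _ _ _ => Set.mem_univ _)
  have hval : ∀ w, vec (pts α v) (pts β v') (i, w) =
      (if v p = w then 1 else 0) - if v' q = w then 1 else 0 := fun w => by
    rw [vec_pts_apply, Finset.sum_sub_distrib]
    simp only [hp, hq, ite_and]
    simp
  -- Generation i carries a difference of two point masses. Unless it is zero, its values on the
  -- couple w, w + e_m cannot be equal and nonzero. So i is neither the first nor the last occupied
  -- generation, although only i and j are available.
  have hcontra : ∀ (m : Fin M) w, vec (pts α v) (pts β v') (i, w) ≠ 0 →
      vec (pts α v) (pts β v') (i, w + dir m) = vec (pts α v) (pts β v') (i, w) → False := by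
    intro m w h0 h
    have hd := add_dir_ne w m
    rw [hval] at h0
    rw [hval, hval] at h
    by_cases e1 : v p = w <;> by_cases e2 : v' q = w <;> by_cases e3 : v p = w + dir m <;>
      by_cases e4 : v' q = w + dir m <;> simp_all
  have hsupp : ∀ l w, vec (pts α v) (pts β v') (l, w) ≠ 0 → l = i ∨ l = j := fun l w hl => by
    by_contra hn
    push Not at hn
    refine hl (vec_pts_eq_zero v v' (fun k => ?_) (fun k => ?_) w)
    · rcases hα k with e | e <;> rw [e]
      · exact Ne.symm hn.1
      · exact Ne.symm hn.2
    · rcases hβ k with e | e <;> rw [e]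
      · exact Ne.symm hn.1
      · exact Ne.symm hn.2
  have hne : a.castSucc ≠ b.succ := (Fin.castSucc_lt_succ_iff.2 hab).ne
  rcases hsupp _ _ hw with e | e
  · rw [e] at hw h1
    exact hcontra a w hw (h1 w)
  · rcases hsupp _ _ hw' with e' | e'
    · rw [e'] at hw' h2
      exact hcontra b w' hw' (h2 w')
    · exact hne (e.trans e'.symm)

/-- Here resonances are mere coincidences of points, which every permutation of the generations
preserves, consecutive or not. This makes χ the same for all pairs. -/
theorem excess_map_of_single (π : Equiv.Perm (Fin (M + 1))) {α β : Fin d → Fin (M + 1)}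
    {i j : Fin (M + 1)} (hα : ∀ k, α k = i ∨ α k = j) (hβ : ∀ k, β k = i ∨ β k = j)
    {p q : Fin d} (hp : ∀ k, α k = i ↔ k = p) (hq : ∀ k, β k = i ↔ k = q) :
    excess (π ∘ α) (π ∘ β) = excess α β := by
  refine excess_map 1 fun v v' => ?_
  rw [isRel_vec_iff_of_single hα hβ hp hq, ← vec_map_eq_zero_iff (actPt_injective π 1)]
  exact isRel_vec_iff_of_single (α := π ∘ α) (β := π ∘ β) (i := π i) (j := π j)
    (fun k => (hα k).imp (congrArg π) (congrArg π)) (fun k => (hβ k).imp (congrArg π) (congrArg π))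
    (p := p) (q := q) (fun k => by simp [hp]) (fun k => by simp [hq]) v v'

/-- Consecutive generations, in any order, with the direction of the families between them. -/
def Adjacent (m : Fin M) (i j : Fin (M + 1)) : Prop :=
  (i = m.castSucc ∧ j = m.succ) ∨ (i = m.succ ∧ j = m.castSucc)

/-- All partial sums vanish except the one between the two generations, which is ± the coefficients
on i. The resulting description is symmetric in i and j because the two are opposite, and it
mentions the position of the pair only through the direction m. -/
theorem isRel_iff_of_adjacent {m : Fin M} {i j : Fin (M + 1)} (h : Adjacent m i j) {μ : Pt M → ℤ}
    (hμ : ∀ l, l ≠ i → l ≠ j → ∀ v, μ (l, v) = 0) :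
    IsRel μ ↔ (∀ v, μ (i, v + dir m) = μ (i, v)) ∧ ∀ v, μ (i, v) + μ (j, v) = 0 := by
  have hij : i ≠ j := by
    have h1 : m.castSucc ≠ m.succ := (Fin.castSucc_lt_succ).ne
    rcases h with ⟨rfl, rfl⟩ | ⟨rfl, rfl⟩
    · exact h1
    · exact Ne.symm h1
  have htot : ∀ v, ∑ l, μ (l, v) = μ (i, v) + μ (j, v) := fun v =>
    Fintype.sum_eq_add i j hij fun l hl => hμ l hl.1 hl.2 v
  have hps : ∀ (k : ℕ) v, psum μ k v = (if i.1 ≤ k then μ (i, v) else 0) +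
      if j.1 ≤ k then μ (j, v) else 0 := fun k v => by
    rw [psum, Finset.sum_filter]
    exact Fintype.sum_eq_add i j hij fun l hl => by simp [hμ l hl.1 hl.2 v]
  have hm : ∀ v, μ (i, v) + μ (j, v) = 0 → ∀ k : Fin M, k ≠ m → psum μ k v = 0 := by
    intro v hv k hk
    have hk' : (k : ℕ) ≠ m := fun e => hk (Fin.ext e)
    rw [hps]
    have hle : i.1 ≤ k ↔ j.1 ≤ k := by
      rcases h with ⟨rfl, rfl⟩ | ⟨rfl, rfl⟩ <;> simp only [Fin.val_castSucc, Fin.val_succ] <;> omega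
    by_cases e : j.1 ≤ k
    · simp [hle, e, hv]
    · simp [hle, e]
  have hmm : ∀ v, μ (i, v) + μ (j, v) = 0 →
      psum μ m v = μ (i, v) ∨ psum μ m v = -μ (i, v) := by
    intro v hv
    rw [hps]
    rcases h with ⟨rfl, rfl⟩ | ⟨rfl, rfl⟩
    · left; simp
    · right
      simp only [Fin.val_succ, Fin.val_castSucc, le_refl, if_true]
      rw [if_neg (by omega)]
      linarith
  have hmm' : ∀ v v', μ (i, v) + μ (j, v) = 0 → μ (i, v') + μ (j, v') = 0 →
      (psum μ m v' = psum μ m v ↔ μ (i, v') = μ (i, v)) := by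
    intro v v' hv hv'
    rw [hps, hps]
    rcases h with ⟨rfl, rfl⟩ | ⟨rfl, rfl⟩
    · simp
    · simp only [Fin.val_succ, Fin.val_castSucc, le_refl, if_true]
      rw [if_neg (by omega), if_neg (by omega)]
      constructor <;> intro <;> linarith
  constructor
  · intro hr
    have h2 : ∀ v, μ (i, v) + μ (j, v) = 0 := fun v => by rw [← htot, hr.2]
    exact ⟨fun v => (hmm' _ _ (h2 _) (h2 _)).1 (hr.1 m (Set.mem_univ m) v), h2⟩
  · rintro ⟨h1, h2⟩
    refine ⟨fun k _ v => ?_, fun v => by rw [htot, h2]⟩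
    by_cases hk : k = m
    · subst hk
      exact (hmm' _ _ (h2 _) (h2 _)).2 (h1 v)
    · rw [hm _ (h2 _) k hk, hm _ (h2 _) k hk]

/-- The permutation of the labels that exchanges two directions. -/
def swapDir (a b : Fin M) : Equiv.Perm (Cube M) :=
  Equiv.arrowCongr (Equiv.swap a b) (Equiv.refl (ZMod 2))

theorem swapDir_add_dir (a b : Fin M) (v : Cube M) :
    swapDir a b (v + dir a) = swapDir a b v + dir b := by
  funext k
  simp only [swapDir, Equiv.arrowCongr_apply, Equiv.coe_refl, Function.comp_apply, id_eq,
    Equiv.symm_swap, Pi.add_apply, dir, add_right_inj]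
  by_cases hk : k = b
  · subst hk; simp
  · rw [Pi.single_eq_of_ne hk, Pi.single_eq_of_ne]
    rwa [Ne, Equiv.swap_apply_eq_iff, Equiv.swap_apply_left]

/-- Resonances among two consecutive generations do not depend on the pair of generations. -/
theorem isRel_vec_map_adjacent {m m' : Fin M} {i j : Fin (M + 1)} {π : Equiv.Perm (Fin (M + 1))}
    (h : Adjacent m i j) (h' : Adjacent m' (π i) (π j)) {α β : Fin d → Fin (M + 1)}
    (hα : ∀ k, α k = i ∨ α k = j) (hβ : ∀ k, β k = i ∨ β k = j) (v v' : Fin d → Cube M) :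
    IsRel (vec (actPt π (swapDir m m') ∘ pts α v) (actPt π (swapDir m m') ∘ pts β v')) ↔
      IsRel (vec (pts α v) (pts β v')) := by
  set η := swapDir m m' with hη
  have key : ∀ (l : Fin (M + 1)) (w : Cube M), vec (actPt π η ∘ pts α v) (actPt π η ∘ pts β v')
      (π l, η w) = vec (pts α v) (pts β v') (l, w) := fun l w =>
    vec_map_apply (actPt_injective π η) _ _ (l, w)
  have hz : ∀ l, l ≠ i → l ≠ j → (∀ k, α k ≠ l) ∧ ∀ k, β k ≠ l := fun l hi hj =>
    ⟨fun k => by rcases hα k with e | e <;> rw [e] <;> [exact hi.symm; exact hj.symm],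
      fun k => by rcases hβ k with e | e <;> rw [e] <;> [exact hi.symm; exact hj.symm]⟩
  rw [isRel_iff_of_adjacent h fun l hi hj w => vec_pts_eq_zero v v' (hz l hi hj).1 (hz l hi hj).2 w,
    isRel_iff_of_adjacent h' fun l hi hj w => ?_]
  · constructor
    · rintro ⟨h1, h2⟩
      exact ⟨fun w => by rw [← key, ← key, swapDir_add_dir, h1],
        fun w => by rw [← key, ← key, h2]⟩
    · rintro ⟨h1, h2⟩
      refine ⟨fun w => ?_, fun w => ?_⟩
      · obtain ⟨w, rfl⟩ := η.surjective w
        rw [← swapDir_add_dir, key, key, h1]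
      · obtain ⟨w, rfl⟩ := η.surjective w
        rw [key, key, h2]
  · obtain ⟨l, rfl⟩ := π.surjective l
    obtain ⟨w, rfl⟩ := η.surjective w
    rw [key]
    have hi' : l ≠ i := fun e => hi (by rw [e])
    have hj' : l ≠ j := fun e => hj (by rw [e])
    exact vec_pts_eq_zero v v' (hz l hi' hj').1 (hz l hi' hj').2 w

theorem excess_map_adjacent {m m' : Fin M} {i j : Fin (M + 1)} {π : Equiv.Perm (Fin (M + 1))}
    (h : Adjacent m i j) (h' : Adjacent m' (π i) (π j)) {α β : Fin d → Fin (M + 1)}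
    (hα : ∀ k, α k = i ∨ α k = j) (hβ : ∀ k, β k = i ∨ β k = j) :
    excess (π ∘ α) (π ∘ β) = excess α β :=
  excess_map (swapDir m m') (isRel_vec_map_adjacent h h' hα hβ)

/-- Two generations that are not consecutive have no resonance of degree two in one of them. -/
theorem not_isRel_of_not_adjacent {α β : Fin d → Fin (M + 1)} {i j : Fin (M + 1)}
    (hadj : ∀ m, ¬ Adjacent m i j)
    (hα : ∀ k, α k = i ∨ α k = j) (hβ : ∀ k, β k = j)
    {p q : Fin d} (hpq : p ≠ q) (hp : ∀ k, α k = i ↔ k = p ∨ k = q) (hij : i ≠ j)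
    (v v' : Fin d → Cube M) :
    ¬ IsRel (vec (pts α v) (pts β v')) := by
  intro h
  have hβi : ∀ k, β k ≠ i := fun k e => hij (e.symm.trans (hβ k))
  have hval : ∀ w, vec (pts α v) (pts β v') (i, w) =
      (if v p = w then 1 else 0) + if v q = w then 1 else 0 := fun w => by
    rw [vec_pts_apply]
    have : ∀ k, ((if α k = i ∧ v k = w then 1 else 0) - if β k = i ∧ v' k = w then 1 else 0 : ℤ) =
        if k = p then (if v k = w then 1 else 0) else if k = q then (if v k = w then 1 else 0)
          else 0 := fun k => by
      simp only [hβi, false_and, if_false, sub_zero, hp]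
      split_ifs <;> simp_all
    simp only [this]
    rw [Fintype.sum_eq_add p q hpq fun k hk => by simp [hk.1, hk.2]]
    simp [Ne.symm hpq]
  have hsupp : ∀ l w, vec (pts α v) (pts β v') (l, w) ≠ 0 → l = i ∨ l = j := fun l w hl => by
    by_contra hn
    push Not at hn
    refine hl (vec_pts_eq_zero v v' (fun k => ?_) (fun k => ?_) w)
    · rcases hα k with e | e <;> rw [e]
      · exact Ne.symm hn.1
      · exact Ne.symm hn.2
    · rw [hβ k]; exact Ne.symm hn.2
  have h0 : vec (pts α v) (pts β v') ≠ 0 := fun h0 => by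
    have h1 := congrFun h0 (i, v p)
    rw [hval, if_pos rfl, Pi.zero_apply] at h1
    split_ifs at h1 <;> omega
  obtain ⟨a, b, hab, ⟨w, hw⟩, ⟨w', hw'⟩, h1, h2⟩ := IsRelOn.extremal h h0
    (fun _ _ _ => Set.mem_univ _)
  have hne : a.castSucc ≠ b.succ := (Fin.castSucc_lt_succ_iff.2 hab).ne
  have htot : ∀ w, vec (pts α v) (pts β v') (i, w) + vec (pts α v) (pts β v') (j, w) = 0 :=
    fun w => by
      rw [← h.2 w]
      refine (Fintype.sum_eq_add (f := fun l => vec (pts α v) (pts β v') (l, w)) i j hij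
        fun l hl => ?_).symm
      by_contra hl'
      rcases hsupp l w hl' with e | e
      · exact hl.1 e
      · exact hl.2 e
  -- As the coefficients on j are minus those on i, the invariances of the first and of the last
  -- occupied generation both pass to i. Their directions differ because i and j are not
  -- consecutive.
  have hinv : (∀ w, vec (pts α v) (pts β v') (i, w + dir a) = vec (pts α v) (pts β v') (i, w)) ∧
      (∀ w, vec (pts α v) (pts β v') (i, w + dir b) = vec (pts α v) (pts β v') (i, w)) ∧ a ≠ b := by
    rcases hsupp _ _ hw with e | e <;> rcases hsupp _ _ hw' with e' | e'
    · exact absurd (e.trans e'.symm) hne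
    · rw [e] at h1
      rw [e'] at h2
      refine ⟨h1, fun w => ?_, ?_⟩
      · linarith [h2 w, htot w, htot (w + dir b)]
      · rintro rfl
        exact hadj a (Or.inl ⟨e.symm, e'.symm⟩)
    · rw [e] at h1
      rw [e'] at h2
      refine ⟨fun w => ?_, h2, ?_⟩
      · linarith [h1 w, htot w, htot (w + dir a)]
      · rintro rfl
        exact hadj a (Or.inr ⟨e'.symm, e.symm⟩)
    · exact absurd (e.trans e'.symm) hne
  obtain ⟨ia, ib, hab'⟩ := hinv
  -- Invariance in two directions would put mass at the three distinct labels v p, v p + e_a, v p +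
  -- e_b, but generation i carries only two point masses.
  have ja := ia (v p)
  have jb := ib (v p)
  rw [hval, hval] at ja jb
  have na := add_dir_ne (v p) a
  have nb := add_dir_ne (v p) b
  have nab : v p + dir a ≠ v p + dir b := fun e => hab' (dir_injective (add_left_cancel e))
  by_cases e1 : v q = v p + dir a <;> by_cases e2 : v q = v p + dir b <;>
    by_cases e3 : v q = v p <;> simp_all

theorem excess_eq_zero_of_not_isRel {α β : Fin d → Fin (M + 1)}
    (h : ∀ v v', ¬ IsRel (vec (pts α v) (pts β v'))) : excess α β = 0 :=
  Finset.sum_eq_zero fun v _ => Finset.sum_eq_zero fun v' _ => by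
    simp [defect, h v v', weight_of_not_isRel (h v v')]

theorem even_of_isRel {y y' : Fin d → Pt M} (h : IsRel (vec y y')) (l : Fin (M + 1)) :
    Even (∑ j, ((if (y j).1 = l then 1 else 0) + if (y' j).1 = l then 1 else 0)) := by
  have h1 := h.even_sum l
  have h2 : ∑ v, vec y y' (l, v) = ∑ j, ((if (y j).1 = l then 1 else 0) -
      if (y' j).1 = l then 1 else 0) := by
    simp only [vec_apply]
    rw [Finset.sum_comm]
    refine Finset.sum_congr rfl fun j _ => ?_
    rw [Finset.sum_sub_distrib]
    have : ∀ x : Pt M, ∑ v, (if x = (l, v) then (1 : ℤ) else 0) = if x.1 = l then 1 else 0 :=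
      fun x => by
        by_cases hx : x.1 = l
        · simp [Prod.ext_iff, hx]
        · simp [Prod.ext_iff, hx]
    rw [this, this]
  rw [h2] at h1
  have h3 : ((∑ j, ((if (y j).1 = l then 1 else 0) + if (y' j).1 = l then 1 else 0) : ℕ) : ℤ) =
      ∑ j, ((if (y j).1 = l then 1 else 0) - if (y' j).1 = l then 1 else 0) +
        2 * ∑ j, if (y' j).1 = l then 1 else 0 := by
    push_cast
    rw [Finset.mul_sum, ← Finset.sum_add_distrib]
    exact Finset.sum_congr rfl fun j _ => by ring
  rw [← Int.even_coe_nat, h3]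
  exact h1.add (even_two_mul _)

theorem even_of_excess_ne_zero {α β : Fin d → Fin (M + 1)} (h : excess α β ≠ 0)
    (l : Fin (M + 1)) : Even (∑ j, ((if α j = l then 1 else 0) + if β j = l then 1 else 0)) := by
  by_contra hn
  exact h (excess_eq_zero_of_not_isRel fun v v' hr => hn (even_of_isRel hr l))

end Excess

/-! ### The remainder polynomial -/

section Remainder

open MvPolynomial

variable {M d : ℕ}

/-- The exponents of the monomial `∏ j, b (α j) * b̄ (β j)`. -/
noncomputable def expo (α β : Fin d → Fin (M + 1)) : (Fin (M + 1) ⊕ Fin (M + 1)) →₀ ℕ :=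
  ∑ j, (Finsupp.single (Sum.inl (α j)) 1 + Finsupp.single (Sum.inr (β j)) 1)

theorem expo_inl (α β : Fin d → Fin (M + 1)) (l : Fin (M + 1)) :
    expo α β (Sum.inl l) = (Finset.univ.filter fun j => α j = l).card := by
  simp [expo, Finsupp.finsetSum_apply, Finsupp.single_apply, Finset.sum_boole]

theorem expo_inr (α β : Fin d → Fin (M + 1)) (l : Fin (M + 1)) :
    expo α β (Sum.inr l) = (Finset.univ.filter fun j => β j = l).card := by
  simp [expo, Finsupp.finsetSum_apply, Finsupp.single_apply, Finset.sum_boole]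

theorem expo_map (π : Equiv.Perm (Fin (M + 1))) (α β : Fin d → Fin (M + 1)) :
    expo (π ∘ α) (π ∘ β) = (expo α β).mapDomain (Sum.map π π) := by
  simp [expo, Finsupp.mapDomain_finsetSum, Finsupp.mapDomain_add, Finsupp.mapDomain_single]

theorem expo_swap (α β : Fin d → Fin (M + 1)) :
    expo β α = (expo α β).mapDomain Sum.swap := by
  simp [expo, Finsupp.mapDomain_finsetSum, Finsupp.mapDomain_add, Finsupp.mapDomain_single,
    add_comm]

/-- The coefficients of the remainder, before like monomials are collected. -/
noncomputable def remCoeff (α β : Fin d → Fin (M + 1)) : ℝ :=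
  excess α β / ((2 ^ M) ^ (d - 2) * (d.factorial * (d * (d - 1))))

/-- The remainder polynomial. -/
noncomputable def remainder (d M : ℕ) : ToyPoly (M + 1) :=
  ∑ α : Fin d → Fin (M + 1), ∑ β : Fin d → Fin (M + 1),
    monomial (expo α β) (Polynomial.C (remCoeff α β))

/-- The coefficients of the remainder polynomial. -/
noncomputable def coeffSum (d : ℕ) {M : ℕ} (m : (Fin (M + 1) ⊕ Fin (M + 1)) →₀ ℕ) : ℝ :=
  ∑ α : Fin d → Fin (M + 1), ∑ β : Fin d → Fin (M + 1), if expo α β = m then remCoeff α β else 0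

theorem coeff_remainder (m : (Fin (M + 1) ⊕ Fin (M + 1)) →₀ ℕ) :
    coeff m (remainder d M) = Polynomial.C (coeffSum d m) := by
  simp only [remainder, coeffSum, coeff_sum, coeff_monomial, map_sum]
  refine Finset.sum_congr rfl fun α _ => Finset.sum_congr rfl fun β _ => ?_
  split_ifs <;> simp

theorem exists_of_coeffSum_ne_zero {m : (Fin (M + 1) ⊕ Fin (M + 1)) →₀ ℕ} (h : coeffSum d m ≠ 0) :
    ∃ α β : Fin d → Fin (M + 1), expo α β = m ∧ excess α β ≠ 0 := by
  by_contra! hn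
  refine h (Finset.sum_eq_zero fun α _ => Finset.sum_eq_zero fun β _ => ?_)
  split_ifs with he
  · simp [remCoeff, hn α β he]
  · rfl

theorem coeffSum_eq_zero {m : (Fin (M + 1) ⊕ Fin (M + 1)) →₀ ℕ}
    (h : ∀ α β : Fin d → Fin (M + 1), expo α β = m → excess α β = 0) : coeffSum d m = 0 := by
  by_contra hn
  obtain ⟨α, β, he, h0⟩ := exists_of_coeffSum_ne_zero hn
  exact h0 (h α β he)

theorem coeffSum_map (π : Equiv.Perm (Fin (M + 1))) {m : (Fin (M + 1) ⊕ Fin (M + 1)) →₀ ℕ}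
    (h : ∀ α β : Fin d → Fin (M + 1), expo α β = m → excess (π ∘ α) (π ∘ β) = excess α β) :
    coeffSum d (m.mapDomain (Sum.map π π)) = coeffSum d m := by
  let Φ : Equiv.Perm (Fin d → Fin (M + 1)) := Equiv.arrowCongr (Equiv.refl (Fin d)) π
  have hΦ : ∀ α, Φ α = π ∘ α := fun α => rfl
  symm
  refine Fintype.sum_equiv Φ _ _ fun α => Fintype.sum_equiv Φ _ _ fun β => ?_
  have hinj : Function.Injective (Finsupp.mapDomain (M := ℕ) (Sum.map π π)) :=
    Finsupp.mapDomain_injective (π.injective.sumMap π.injective)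
  rw [hΦ, hΦ, expo_map]
  by_cases he : expo α β = m
  · rw [if_pos he, if_pos (congrArg _ he), remCoeff, remCoeff, h α β he]
  · rw [if_neg he, if_neg fun e => he (hinj e)]

theorem coeffSum_swap (m : (Fin (M + 1) ⊕ Fin (M + 1)) →₀ ℕ) :
    coeffSum d (m.mapDomain Sum.swap) = coeffSum d m := by
  have hinj : Function.Injective (Finsupp.mapDomain (M := ℕ)
      (Sum.swap : Fin (M + 1) ⊕ Fin (M + 1) → _)) :=
    Finsupp.mapDomain_injective Sum.swap_leftInverse.injective
  rw [coeffSum, coeffSum, Finset.sum_comm]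
  refine Finset.sum_congr rfl fun α _ => Finset.sum_congr rfl fun β _ => ?_
  rw [expo_swap]
  by_cases he : expo α β = m
  · rw [if_pos he, if_pos (congrArg _ he), remCoeff, remCoeff, excess_swap]
  · rw [if_neg he, if_neg fun e => he (hinj e)]

theorem monomial_expo (α β : Fin d → Fin (M + 1)) (c : Polynomial ℝ) :
    monomial (expo α β) c = C c * ∏ j, (ToyPoly.b (α j) * ToyPoly.bbar (β j)) := by
  have h : ∀ j, (ToyPoly.b (α j) * ToyPoly.bbar (β j) : ToyPoly (M + 1)) =
      monomial (Finsupp.single (Sum.inl (α j)) 1 + Finsupp.single (Sum.inr (β j)) 1) 1 := fun j => by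
    rw [ToyPoly.b, ToyPoly.bbar, X, X, monomial_mul, one_mul]
  simp only [h]
  rw [← monomial_sum_one, C_mul_monomial, mul_one]
  rfl

theorem value_remainder (z : Fin (M + 1) → ℂ) : (remainder d M).value z =
    ∑ α : Fin d → Fin (M + 1), ∑ β : Fin d → Fin (M + 1),
      (remCoeff α β : ℂ) * ((∏ j, z (α j)) * ∏ j, (starRingEnd ℂ) (z (β j))) := by
  rw [ToyPoly.value, remainder]
  simp only [monomial_expo, ← coe_eval₂Hom, map_sum, map_mul, map_prod]
  refine Finset.sum_congr rfl fun α _ => Finset.sum_congr rfl fun β _ => ?_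
  rw [← Finset.prod_mul_distrib]
  congr 1
  · simp
  · exact Finset.prod_congr rfl fun j _ => by simp [ToyPoly.b, ToyPoly.bbar]

/-- The remainder has bidegree (d, d) in b and b̄. The weights (1, 1), (1, 0), (0, 1) yield ordinary
homogeneity and the two Euler identities. -/
theorem isWeightedHomogeneous_remainder (w : Fin (M + 1) ⊕ Fin (M + 1) → ℕ) {p q : ℕ}
    (hp : ∀ l, w (Sum.inl l) = p) (hq : ∀ l, w (Sum.inr l) = q) :
    (remainder d M).IsWeightedHomogeneous w (d * (p + q)) := by
  refine IsWeightedHomogeneous.sum _ _ _ fun α _ => IsWeightedHomogeneous.sum _ _ _ fun β _ => ?_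
  refine isWeightedHomogeneous_monomial _ _ _ ?_
  simp [expo, map_sum, Finsupp.weight_single, hp, hq]

theorem isHomogeneous_remainder : (remainder d M).IsHomogeneous (2 * d) := by
  have := isWeightedHomogeneous_remainder (d := d) (M := M) 1 (p := 1) (q := 1)
    (fun _ => rfl) (fun _ => rfl)
  rwa [mul_comm 2 d]

theorem pderiv_mass_inl (j : Fin (M + 1)) :
    pderiv (Sum.inl j) (ToyPoly.mass (M + 1)) = ToyPoly.bbar j := by
  simp [ToyPoly.mass, ToyPoly.b, ToyPoly.bbar, pderiv_X, Pi.single_apply, map_sum, Derivation.leibniz]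

theorem pderiv_mass_inr (j : Fin (M + 1)) :
    pderiv (Sum.inr j) (ToyPoly.mass (M + 1)) = ToyPoly.b j := by
  simp [ToyPoly.mass, ToyPoly.b, ToyPoly.bbar, pderiv_X, Pi.single_apply, map_sum, Derivation.leibniz]

/-- The bracket with the mass is ∑ b_j ∂P/∂b_j − ∑ b̄_j ∂P/∂b̄_j, and by Euler's identity both sums
equal d P. -/
theorem poisson_remainder_mass : ToyPoly.poisson (remainder d M) (ToyPoly.mass (M + 1)) = 0 := by
  have h1 := (isWeightedHomogeneous_remainder (d := d) (M := M) (Sum.elim 1 0) (p := 1) (q := 0)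
    (fun _ => rfl) (fun _ => rfl)).sum_weight_X_mul_pderiv
  have h2 := (isWeightedHomogeneous_remainder (d := d) (M := M) (Sum.elim 0 1) (p := 0) (q := 1)
    (fun _ => rfl) (fun _ => rfl)).sum_weight_X_mul_pderiv
  simp only [Fintype.sum_sum_type, Sum.elim_inl, Sum.elim_inr, Pi.one_apply, Pi.zero_apply,
    one_smul, zero_smul, Finset.sum_const_zero, add_zero, zero_add] at h1 h2
  simp only [ToyPoly.poisson, pderiv_mass_inl, pderiv_mass_inr, Finset.sum_sub_distrib]
  rw [sub_eq_zero]
  simpa only [ToyPoly.b, ToyPoly.bbar, mul_comm] using h1.trans h2.symm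

theorem rename_swap_remainder : rename Sum.swap (remainder d M) = remainder d M := by
  simp only [remainder, map_sum, rename_monomial, ← expo_swap]
  rw [Finset.sum_comm]
  refine Finset.sum_congr rfl fun α _ => Finset.sum_congr rfl fun β _ => ?_
  rw [remCoeff, remCoeff, excess_swap]

theorem mem_image_of_expo_eq {α β α' β' : Fin d → Fin (M + 1)} (h : expo α β = expo α' β')
    (j : Fin d) : α j ∈ Finset.univ.image α' ∧ β j ∈ Finset.univ.image β' := by
  constructor
  · have h1 := DFunLike.congr_fun h (Sum.inl (α j))
    rw [expo_inl, expo_inl] at h1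
    obtain ⟨k, hk⟩ : (Finset.univ.filter fun k => α' k = α j).Nonempty := by
      rw [← Finset.card_pos, ← h1, Finset.card_pos]
      exact ⟨j, by simp⟩
    exact Finset.mem_image.2 ⟨k, Finset.mem_univ _, (Finset.mem_filter.1 hk).2⟩
  · have h1 := DFunLike.congr_fun h (Sum.inr (β j))
    rw [expo_inr, expo_inr] at h1
    obtain ⟨k, hk⟩ : (Finset.univ.filter fun k => β' k = β j).Nonempty := by
      rw [← Finset.card_pos, ← h1, Finset.card_pos]
      exact ⟨j, by simp⟩
    exact Finset.mem_image.2 ⟨k, Finset.mem_univ _, (Finset.mem_filter.1 hk).2⟩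

/-- The bound of the coefficients of the remainder polynomial. -/
noncomputable def coeffBound (d : ℕ) : ℝ :=
  (d ^ d) * (d ^ d) * (excessBound d / (d.factorial * (d * (d - 1))))

theorem excessBound_nonneg : 0 ≤ excessBound d := by
  rw [excessBound]; positivity

theorem abs_remCoeff_le (hd : 2 ≤ d) (α β : Fin d → Fin (M + 1)) :
    |remCoeff α β| ≤ excessBound d / (d.factorial * (d * (d - 1))) := by
  have hd1 : (0 : ℝ) < d * (d - 1) := by
    have : (2 : ℝ) ≤ d := by exact_mod_cast hd
    nlinarith
  have hf : (0 : ℝ) < d.factorial := by exact_mod_cast d.factorial_pos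
  have hpow : (0 : ℝ) < (2 ^ M) ^ (d - 2) := by positivity
  rw [remCoeff, abs_div, abs_of_pos (by positivity : (0:ℝ) < (2 ^ M) ^ (d - 2) *
    (d.factorial * (d * (d - 1)))), div_le_div_iff₀ (by positivity) (by positivity)]
  have := abs_excess_le hd α β
  calc _ ≤ excessBound d * (2 ^ M) ^ (d - 2) * (d.factorial * (d * (d - 1))) := by gcongr
    _ = _ := by ring

theorem abs_coeffSum_le (hd : 2 ≤ d) (m : (Fin (M + 1) ⊕ Fin (M + 1)) →₀ ℕ) :
    |coeffSum d m| ≤ coeffBound d := by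
  classical
  have hd1 : (0 : ℝ) < d * (d - 1) := by
    have : (2 : ℝ) ≤ d := by exact_mod_cast hd
    nlinarith
  set B := excessBound d / (d.factorial * (d * (d - 1)) : ℝ) with hB
  have hB0 : 0 ≤ B := by
    have := excessBound_nonneg (d := d)
    positivity
  by_cases h : ∃ α β : Fin d → Fin (M + 1), expo α β = m
  · obtain ⟨α₀, β₀, rfl⟩ := h
    -- Index tuples with a prescribed monomial take values in the at most d generations of that
    -- monomial. So at most d^d choices of α and of β are collected, whatever N is.
    let A := Fintype.piFinset fun _ : Fin d => Finset.univ.image α₀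
    let A' := Fintype.piFinset fun _ : Fin d => Finset.univ.image β₀
    have hcard : ∀ γ : Fin d → Fin (M + 1),
        (Fintype.piFinset fun _ : Fin d => Finset.univ.image γ).card ≤ d ^ d := fun γ => by
      rw [Fintype.card_piFinset_const]
      gcongr
      exact Finset.card_image_le.trans (by simp)
    calc |coeffSum d (expo α₀ β₀)|
        ≤ ∑ α : Fin d → Fin (M + 1), ∑ β : Fin d → Fin (M + 1),
            |if expo α β = expo α₀ β₀ then remCoeff α β else 0| :=
          (Finset.abs_sum_le_sum_abs _ _).trans
            (Finset.sum_le_sum fun α _ => Finset.abs_sum_le_sum_abs _ _)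
      _ ≤ ∑ α : Fin d → Fin (M + 1), ∑ β : Fin d → Fin (M + 1),
            (if α ∈ A then 1 else 0) * ((if β ∈ A' then 1 else 0) * B) := by
          refine Finset.sum_le_sum fun α _ => Finset.sum_le_sum fun β _ => ?_
          split_ifs with he ha hb hb
          · simpa using abs_remCoeff_le hd α β
          · exact absurd (Fintype.mem_piFinset.2 fun j => (mem_image_of_expo_eq he j).2) hb
          · exact absurd (Fintype.mem_piFinset.2 fun j => (mem_image_of_expo_eq he j).1) ha
          · exact absurd (Fintype.mem_piFinset.2 fun j => (mem_image_of_expo_eq he j).1) ha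
          all_goals simp [hB0]
      _ = A.card * (A'.card * B) := by
          simp only [← Finset.mul_sum, ← Finset.sum_mul, Finset.sum_boole, Finset.filter_mem_eq_inter,
            Finset.univ_inter]
      _ ≤ (d ^ d : ℕ) * ((d ^ d : ℕ) * B) := by
          gcongr
          · exact hcard α₀
          · exact hcard β₀
      _ = coeffBound d := by
          rw [coeffBound, hB]; push_cast; ring
  · rw [coeffSum_eq_zero fun α β he => absurd ⟨α, β, he⟩ h, abs_zero, coeffBound]
    positivity

theorem even_of_mem_support {m : (Fin (M + 1) ⊕ Fin (M + 1)) →₀ ℕ}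
    (hm : m ∈ (remainder d M).support) (i : Fin (M + 1)) : Even (m (Sum.inl i) + m (Sum.inr i)) := by
  rw [mem_support_iff, coeff_remainder, Ne, Polynomial.C_eq_zero] at hm
  obtain ⟨α, β, rfl, h⟩ := exists_of_coeffSum_ne_zero hm
  rw [expo_inl, expo_inr]
  simpa [Finset.sum_add_distrib, Finset.sum_boole] using even_of_excess_ne_zero h i

/-! ### The monomials in two generations -/

/-- The exponents of `|b_j|^{2d-2} |b_i|²`. -/
noncomputable def expoDiag (d : ℕ) (i j : Fin (M + 1)) : (Fin (M + 1) ⊕ Fin (M + 1)) →₀ ℕ :=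
  (d - 1) • (Finsupp.single (Sum.inl j) 1 + Finsupp.single (Sum.inr j) 1) +
    (Finsupp.single (Sum.inl i) 1 + Finsupp.single (Sum.inr i) 1)

/-- The exponents of `|b_j|^{2d-4} b_i² b̄_j²`. -/
noncomputable def expoOff (d : ℕ) (i j : Fin (M + 1)) : (Fin (M + 1) ⊕ Fin (M + 1)) →₀ ℕ :=
  (d - 2) • (Finsupp.single (Sum.inl j) 1 + Finsupp.single (Sum.inr j) 1) +
    (2 • Finsupp.single (Sum.inl i) 1 + 2 • Finsupp.single (Sum.inr j) 1)

/-- The exponents of `|b_j|^{2d-4} b̄_i² b_j²`. -/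
noncomputable def expoOff' (d : ℕ) (i j : Fin (M + 1)) : (Fin (M + 1) ⊕ Fin (M + 1)) →₀ ℕ :=
  (d - 2) • (Finsupp.single (Sum.inl j) 1 + Finsupp.single (Sum.inr j) 1) +
    (2 • Finsupp.single (Sum.inr i) 1 + 2 • Finsupp.single (Sum.inl j) 1)

theorem expoDiag_map (π : Equiv.Perm (Fin (M + 1))) (i j : Fin (M + 1)) :
    expoDiag d (π i) (π j) = (expoDiag d i j).mapDomain (Sum.map π π) := by
  simp only [expoDiag, Finsupp.mapDomain_add, Finsupp.mapDomain_smul, Finsupp.mapDomain_single,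
    Sum.map_inl, Sum.map_inr]

theorem expoOff_map (π : Equiv.Perm (Fin (M + 1))) (i j : Fin (M + 1)) :
    expoOff d (π i) (π j) = (expoOff d i j).mapDomain (Sum.map π π) := by
  simp only [expoOff, Finsupp.mapDomain_add, Finsupp.mapDomain_smul, Finsupp.mapDomain_single,
    Sum.map_inl, Sum.map_inr]

theorem expoOff_swap (i j : Fin (M + 1)) :
    expoOff' d i j = (expoOff d i j).mapDomain Sum.swap := by
  simp only [expoOff, expoOff', Finsupp.mapDomain_add, Finsupp.mapDomain_smul,
    Finsupp.mapDomain_single, Sum.swap_inl, Sum.swap_inr]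
  rw [add_comm (Finsupp.single (Sum.inl j) 1)]

theorem eq_or_eq_of_expo {α β : Fin d → Fin (M + 1)} {m : (Fin (M + 1) ⊕ Fin (M + 1)) →₀ ℕ}
    (h : expo α β = m) {i j : Fin (M + 1)}
    (hm : ∀ l, l ≠ i → l ≠ j → m (Sum.inl l) = 0 ∧ m (Sum.inr l) = 0) :
    (∀ k, α k = i ∨ α k = j) ∧ ∀ k, β k = i ∨ β k = j := by
  subst h
  constructor
  · intro k
    by_contra! hn
    have := (hm _ hn.1 hn.2).1
    rw [expo_inl, Finset.card_eq_zero] at this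
    exact Finset.notMem_empty k (this ▸ Finset.mem_filter.2 ⟨Finset.mem_univ k, rfl⟩)
  · intro k
    by_contra! hn
    have := (hm _ hn.1 hn.2).2
    rw [expo_inr, Finset.card_eq_zero] at this
    exact Finset.notMem_empty k (this ▸ Finset.mem_filter.2 ⟨Finset.mem_univ k, rfl⟩)

theorem expoDiag_off {i j l : Fin (M + 1)} (hi : l ≠ i) (hj : l ≠ j) :
    expoDiag d i j (Sum.inl l) = 0 ∧ expoDiag d i j (Sum.inr l) = 0 := by
  simp [expoDiag, hi.symm, hj.symm]

theorem expoOff_off {i j l : Fin (M + 1)} (hi : l ≠ i) (hj : l ≠ j) :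
    expoOff d i j (Sum.inl l) = 0 ∧ expoOff d i j (Sum.inr l) = 0 := by
  simp [expoOff, hi.symm, hj.symm]

/-- Exactly one factor b_i and one factor b̄_i occur, so `excess_map_of_single` applies to every
index tuple with this monomial. -/
theorem coeffSum_expoDiag_map (π : Equiv.Perm (Fin (M + 1))) {i j : Fin (M + 1)} (hij : i ≠ j) :
    coeffSum d (expoDiag d (π i) (π j)) = coeffSum d (expoDiag d i j) := by
  rw [expoDiag_map]
  refine coeffSum_map π fun α β h => ?_
  obtain ⟨hα, hβ⟩ := eq_or_eq_of_expo h fun l => expoDiag_off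
  have h1 : (Finset.univ.filter fun k => α k = i).card = 1 := by
    rw [← expo_inl α β, h]; simp [expoDiag, hij.symm]
  have h2 : (Finset.univ.filter fun k => β k = i).card = 1 := by
    rw [← expo_inr α β, h]; simp [expoDiag, hij.symm]
  obtain ⟨p, hp⟩ := Finset.card_eq_one.1 h1
  obtain ⟨q, hq⟩ := Finset.card_eq_one.1 h2
  refine excess_map_of_single π hα hβ (p := p) (q := q) (fun k => ?_) fun k => ?_
  · simpa using Finset.ext_iff.1 hp k
  · simpa using Finset.ext_iff.1 hq k

theorem coeffSum_expoOff_map {m m' : Fin M} (π : Equiv.Perm (Fin (M + 1))) {i j : Fin (M + 1)}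
    (h : Adjacent m i j) (h' : Adjacent m' (π i) (π j)) :
    coeffSum d (expoOff d (π i) (π j)) = coeffSum d (expoOff d i j) := by
  rw [expoOff_map]
  refine coeffSum_map π fun α β he => ?_
  obtain ⟨hα, hβ⟩ := eq_or_eq_of_expo he fun l => expoOff_off
  exact excess_map_adjacent h h' hα hβ

theorem coeffSum_expoOff_eq_zero {i j : Fin (M + 1)} (hij : i ≠ j) (h : ∀ m, ¬ Adjacent m i j) :
    coeffSum d (expoOff d i j) = 0 := by
  refine coeffSum_eq_zero fun α β he => excess_eq_zero_of_not_isRel fun v v' => ?_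
  obtain ⟨hα, hβ⟩ := eq_or_eq_of_expo he fun l => expoOff_off
  have h1 : (Finset.univ.filter fun k => α k = i).card = 2 := by
    rw [← expo_inl α β, he]; simp [expoOff, hij.symm]
  have h2 : (Finset.univ.filter fun k => β k = i).card = 0 := by
    rw [← expo_inr α β, he]; simp [expoOff, hij.symm]
  obtain ⟨p, q, hpq, hp⟩ := Finset.card_eq_two.1 h1
  refine not_isRel_of_not_adjacent h hα (fun k => (hβ k).resolve_left fun e => ?_) hpq (fun k => ?_)
    hij v v'
  · exact Finset.notMem_empty k (Finset.card_eq_zero.1 h2 ▸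
      Finset.mem_filter.2 ⟨Finset.mem_univ k, e⟩)
  · simpa using Finset.ext_iff.1 hp k

theorem exists_perm_pair {X : Type*} [DecidableEq X] {a b i j : X} (hab : a ≠ b) (hij : i ≠ j) :
    ∃ π : Equiv.Perm X, π a = i ∧ π b = j := by
  refine ⟨Equiv.swap (Equiv.swap a i b) j * Equiv.swap a i, ?_, by simp⟩
  have h : i ≠ Equiv.swap a i b := fun e => hab <| by
    have := congrArg (Equiv.swap a i) e
    simpa using this
  rw [Equiv.Perm.mul_apply, Equiv.swap_apply_left, Equiv.swap_apply_of_ne_of_ne h hij]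

theorem adjacent_iff {i j : Fin (M + 1)} :
    (∃ m : Fin M, Adjacent m i j) ↔ (i : ℕ) + 1 = j ∨ (j : ℕ) + 1 = i := by
  constructor
  · rintro ⟨m, ⟨rfl, rfl⟩ | ⟨rfl, rfl⟩⟩ <;> simp
  · rintro (h | h)
    · exact ⟨⟨i, by omega⟩, Or.inl ⟨rfl, Fin.ext h.symm⟩⟩
    · exact ⟨⟨j, by omega⟩, Or.inr ⟨Fin.ext h.symm, rfl⟩⟩

/-- The degrees d in b and d in b̄ fix the exponents of generation j once b_i, b̄_i are known, and 2
= 1 + 1 = 2 + 0 = 0 + 2. -/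
theorem eq_of_coeffSum_ne_zero (hd : 2 ≤ d) {i j : Fin (M + 1)} (hij : i ≠ j)
    {m : (Fin (M + 1) ⊕ Fin (M + 1)) →₀ ℕ} (h : coeffSum d m ≠ 0)
    (hm : ∀ l, l ≠ i → l ≠ j → m (Sum.inl l) = 0 ∧ m (Sum.inr l) = 0)
    (hm2 : m (Sum.inl i) + m (Sum.inr i) = 2) :
    m = expoDiag d i j ∨ m = expoOff d i j ∨ m = expoOff' d i j := by
  obtain ⟨α, β, he, -⟩ := exists_of_coeffSum_ne_zero h
  have htot : ∀ γ : Fin d → Fin (M + 1), (∀ k, γ k = i ∨ γ k = j) →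
      (Finset.univ.filter fun k => γ k = i).card + (Finset.univ.filter fun k => γ k = j).card = d :=
    fun γ hγ => by
      rw [← Finset.card_union_of_disjoint, ← Finset.filter_or, Finset.filter_true_of_mem
        (fun k _ => hγ k), Finset.card_fin]
      exact Finset.disjoint_filter.2 fun k _ h1 h2 => hij (h1.symm.trans h2)
  obtain ⟨hα, hβ⟩ := eq_or_eq_of_expo he hm
  have h1 := htot α hα
  have h2 := htot β hβ
  rw [← expo_inl α β, ← expo_inl α β, he] at h1
  rw [← expo_inr α β, ← expo_inr α β, he] at h2
  have hext : ∀ m' : (Fin (M + 1) ⊕ Fin (M + 1)) →₀ ℕ,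
      (∀ l, l ≠ i → l ≠ j → m' (Sum.inl l) = 0 ∧ m' (Sum.inr l) = 0) →
      m (Sum.inl i) = m' (Sum.inl i) → m (Sum.inr i) = m' (Sum.inr i) →
      m (Sum.inl j) = m' (Sum.inl j) → m (Sum.inr j) = m' (Sum.inr j) → m = m' := by
    intro m' h0 e1 e2 e3 e4
    ext (l | l) <;> by_cases hi : l = i
    · rw [hi, e1]
    · by_cases hj : l = j
      · rw [hj, e3]
      · rw [(hm l hi hj).1, (h0 l hi hj).1]
    · rw [hi, e2]
    · by_cases hj : l = j
      · rw [hj, e4]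
      · rw [(hm l hi hj).2, (h0 l hi hj).2]
  have hcases : m (Sum.inl i) = 1 ∨ m (Sum.inl i) = 2 ∨ m (Sum.inl i) = 0 := by omega
  rcases hcases with e | e | e
  · left
    refine hext _ (fun l => expoDiag_off) ?_ ?_ ?_ ?_ <;>
      simp [expoDiag, hij, hij.symm] <;> omega
  · right; left
    refine hext _ (fun l => expoOff_off) ?_ ?_ ?_ ?_ <;>
      simp [expoOff, hij, hij.symm] <;> omega
  · right; right
    refine hext _ (fun l hi hj => by simp [expoOff', hi.symm, hj.symm])
      ?_ ?_ ?_ ?_ <;>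
      simp [expoOff', hij, hij.symm] <;> omega

theorem pairPart_remainder (hd : 2 ≤ d) {i j : Fin (M + 1)} (hij : i ≠ j) :
    (remainder d M).pairPart i j =
      monomial (expoDiag d i j) (Polynomial.C (coeffSum d (expoDiag d i j))) +
      (monomial (expoOff d i j) (Polynomial.C (coeffSum d (expoOff d i j))) +
        monomial (expoOff' d i j) (Polynomial.C (coeffSum d (expoOff d i j)))) := by
  classical
  have h1 : expoDiag d i j (Sum.inl i) = 1 := by
    simp [expoDiag, hij.symm]
  have h2 : expoOff d i j (Sum.inl i) = 2 := by
    simp [expoOff, hij.symm]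
  have h3 : expoOff' d i j (Sum.inl i) = 0 := by
    simp [expoOff', hij.symm]
  have h1' : expoDiag d i j (Sum.inr i) = 1 := by
    simp [expoDiag, hij.symm]
  have h2' : expoOff d i j (Sum.inr i) = 0 := by
    simp [expoOff, hij.symm]
  have h3' : expoOff' d i j (Sum.inr i) = 2 := by
    simp [expoOff', hij.symm]
  have n12 : expoDiag d i j ≠ expoOff d i j := fun e => by rw [e, h2] at h1; omega
  have n13 : expoDiag d i j ≠ expoOff' d i j := fun e => by rw [e, h3] at h1; omega
  have n23 : expoOff d i j ≠ expoOff' d i j := fun e => by rw [e, h3] at h2; omega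
  have hsw : coeffSum d (expoOff' d i j) = coeffSum d (expoOff d i j) := by
    rw [expoOff_swap, coeffSum_swap]
  rw [show monomial (expoOff' d i j) (Polynomial.C (coeffSum d (expoOff d i j))) =
    monomial (expoOff' d i j) (Polynomial.C (coeffSum d (expoOff' d i j))) by rw [hsw]]
  have hoff' : ∀ l, l ≠ i → l ≠ j → expoOff' d i j (Sum.inl l) = 0 ∧ expoOff' d i j (Sum.inr l) = 0 :=
    fun l hi hj => by simp [expoOff', hi.symm, hj.symm]
  simp only [← coeff_remainder]
  have hcoef : ∀ m, coeff m ((remainder d M).pairPart i j) =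
      if ((∀ l, l ≠ i → l ≠ j → m (Sum.inl l) = 0 ∧ m (Sum.inr l) = 0) ∧
        m (Sum.inl i) + m (Sum.inr i) = 2) then coeff m (remainder d M) else 0 := fun m => by
    rw [ToyPoly.pairPart, coeff_sum]
    simp only [coeff_monomial, Finset.sum_filter]
    by_cases hms : m ∈ (remainder d M).support
    · rw [Finset.sum_eq_single m]
      · simp
      · intro m' _ hne
        simp [hne]
      · exact fun h => absurd hms h
    · rw [Finset.sum_eq_zero, notMem_support_iff.1 hms, ite_self]
      intro m' hm'
      have : m' ≠ m := fun e => hms (e ▸ hm')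
      simp [this]
  ext1 m
  rw [hcoef]
  simp only [coeff_add, coeff_monomial]
  by_cases e1 : expoDiag d i j = m
  · subst e1
    rw [if_pos ⟨fun l => expoDiag_off, by omega⟩]
    simp [n12.symm, n13.symm]
  by_cases e2 : expoOff d i j = m
  · subst e2
    rw [if_pos ⟨fun l => expoOff_off, by omega⟩]
    simp [n12, n23.symm]
  by_cases e3 : expoOff' d i j = m
  · subst e3
    rw [if_pos ⟨hoff', by omega⟩]
    simp [n13, n23]
  simp only [e1, e2, e3, if_false, add_zero]
  split_ifs with hc
  · by_contra hne
    rw [coeff_remainder, ← Ne, Ne, Polynomial.C_eq_zero] at hne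
    rcases eq_of_coeffSum_ne_zero hd hij hne hc.1 hc.2 with e | e | e
    exacts [e1 e.symm, e2 e.symm, e3 e.symm]
  · rfl

/-- All coefficients are compared with those of the pair (0, 1) by a permutation of the generations.
The diagonal coefficient is invariant under every permutation; the off-diagonal one under those
between consecutive pairs, and it vanishes for pairs that are not consecutive. -/
theorem pairPart_remainder_eq (hd : 2 ≤ d) :
    ∃ χ ρ : Polynomial ℝ, ∀ i j : Fin (M + 1), i ≠ j →
      (remainder d M).pairPart i j =
        C χ * (ToyPoly.b j * ToyPoly.bbar j) ^ (d - 1) * (ToyPoly.b i * ToyPoly.bbar i) +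
          if (i : ℕ) + 1 = j ∨ (j : ℕ) + 1 = i then
            C (Polynomial.C (1 / 2) * ρ) * (ToyPoly.b j * ToyPoly.bbar j) ^ (d - 2) *
              (ToyPoly.b i ^ 2 * ToyPoly.bbar j ^ 2 + ToyPoly.bbar i ^ 2 * ToyPoly.b j ^ 2)
          else 0 := by
  rcases M with _ | M
  · exact ⟨0, 0, fun i j hij => absurd (Fin.ext (by omega)) hij⟩
  have h01 : Adjacent (0 : Fin (M + 1)) (0 : Fin (M + 2)) 1 := Or.inl ⟨rfl, rfl⟩
  refine ⟨Polynomial.C (coeffSum d (expoDiag d (0 : Fin (M + 2)) 1)),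
    -- The factor 2 compensates Re x = (x + x̄) / 2.
    Polynomial.C (2 * coeffSum d (expoOff d (0 : Fin (M + 2)) 1)), fun i j hij => ?_⟩
  obtain ⟨π, rfl, rfl⟩ := exists_perm_pair (zero_ne_one (α := Fin (M + 2))) hij
  rw [pairPart_remainder hd hij, coeffSum_expoDiag_map π zero_ne_one]
  congr 1
  · simp only [expoDiag, ToyPoly.b, ToyPoly.bbar, X, monomial_mul, monomial_pow, C_mul_monomial,
      one_pow, mul_one]
  · rw [← Polynomial.C_mul, one_div, inv_mul_cancel_left₀ (two_ne_zero' ℝ)]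
    split_ifs with h
    · obtain ⟨m, hm⟩ := adjacent_iff.2 h
      rw [coeffSum_expoOff_map π h01 hm]
      simp only [expoOff, expoOff', ToyPoly.b, ToyPoly.bbar, X, monomial_mul, monomial_pow,
        C_mul_monomial, one_pow, mul_one, mul_add]
    · rw [coeffSum_expoOff_eq_zero hij fun m hm => h (adjacent_iff.1 ⟨m, hm⟩)]
      simp

end Remainder

/-! ### Centres and second moments -/

section Moments

variable {X : Type*} [Fintype X]

/-- The centre `∑ μ_x f_x` of the integer weights `μ`. -/
noncomputable def cen (f : X → ℂ) : (X → ℤ) →+ ℂ where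
  toFun μ := ∑ x, (μ x : ℂ) * f x
  map_zero' := by simp
  map_add' μ ν := by simp [add_mul, Finset.sum_add_distrib]

/-- The second moment `∑ μ_x |f_x|²` of the integer weights `μ`. -/
noncomputable def sec (f : X → ℂ) : (X → ℤ) →+ ℝ where
  toFun μ := ∑ x, (μ x : ℝ) * Complex.normSq (f x)
  map_zero' := by simp
  map_add' μ ν := by simp [add_mul, Finset.sum_add_distrib]

theorem cen_apply (f : X → ℂ) (μ : X → ℤ) : cen f μ = ∑ x, (μ x : ℂ) * f x := rfl

theorem sec_apply (f : X → ℂ) (μ : X → ℤ) : sec f μ = ∑ x, (μ x : ℝ) * Complex.normSq (f x) := rfl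

theorem cen_single [DecidableEq X] (f : X → ℂ) (x : X) : cen f (Pi.single x 1) = f x := by
  rw [cen_apply, Finset.sum_eq_single x] <;> simp +contextual

theorem sec_single [DecidableEq X] (f : X → ℂ) (x : X) :
    sec f (Pi.single x 1) = Complex.normSq (f x) := by
  rw [sec_apply, Finset.sum_eq_single x] <;> simp +contextual

theorem cen_congr {f f' : X → ℂ} {μ : X → ℤ} (h : ∀ x, μ x ≠ 0 → f x = f' x) :
    cen f μ = cen f' μ := by
  refine Finset.sum_congr rfl fun x _ => ?_
  by_cases hx : μ x = 0
  · simp [hx]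
  · rw [h x hx]

theorem sec_congr {f f' : X → ℂ} {μ : X → ℤ} (h : ∀ x, μ x ≠ 0 → f x = f' x) :
    sec f μ = sec f' μ := by
  refine Finset.sum_congr rfl fun x _ => ?_
  by_cases hx : μ x = 0
  · simp [hx]
  · rw [h x hx]

end Moments

/-! ### Finitely many exceptional parameters -/

theorem finite_quadratic {a b c : ℝ} (h : ¬ (a = 0 ∧ b = 0 ∧ c = 0)) :
    {τ : ℚ | a * (τ : ℝ) ^ 2 + b * τ + c = 0}.Finite := by
  open Polynomial in
  have hp : (C a * X ^ 2 + C b * X + C c : ℝ[X]) ≠ 0 := by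
    intro h0
    refine h ⟨?_, ?_, ?_⟩
    · simpa [coeff_X, coeff_C] using congrArg (fun p => coeff p 2) h0
    · simpa [coeff_X, coeff_C, coeff_X_pow] using congrArg (fun p => coeff p 1) h0
    · simpa [coeff_X, coeff_C] using congrArg (fun p => coeff p 0) h0
  have hfin := Polynomial.finite_setOfPred_isRoot hp
  refine (hfin.preimage (f := fun τ : ℚ => (τ : ℝ)) Rat.cast_injective.injOn).subset fun τ hτ => ?_
  simpa [Polynomial.IsRoot] using hτ

theorem exists_rat_avoiding {B : Set ℚ} (hB : B.Finite) (c : ℚ) {ε : ℝ} (hε : 0 < ε) :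
    ∃ τ : ℚ, |(τ : ℝ) - c| < ε ∧ τ ∉ B := by
  obtain ⟨δ, h0, hδ⟩ := exists_rat_btwn hε
  have h0' : (0 : ℚ) < δ := by exact_mod_cast h0
  obtain ⟨τ, hτ, hn⟩ := ((Set.Ioo_infinite (lt_add_of_pos_right c h0')).sdiff hB).nonempty
  refine ⟨τ, ?_, hn⟩
  have h1 : (c : ℝ) < τ := by exact_mod_cast hτ.1
  have h2 : (τ : ℝ) < c + δ := by exact_mod_cast hτ.2
  rw [abs_of_pos (by linarith)]
  linarith

theorem finite_bounded {X : Type*} [Fintype X] (C : ℤ) :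
    {μ : X → ℤ | ∀ x, |μ x| ≤ C}.Finite := by
  classical
  refine (Set.finite_Icc (fun _ : X => -C) fun _ => C).subset fun μ hμ => ?_
  exact ⟨fun x => (abs_le.1 (hμ x)).1, fun x => (abs_le.1 (hμ x)).2⟩

/-- Real shifts of finitely many points which avoid all unexpected relations. -/
theorem exists_generic_shift {X : Type*} [Fintype X] [DecidableEq X] (p : X → ℂ) {ε : ℝ} (hε : 0 < ε)
    (C : ℤ) : ∃ u : X → ℚ, (∀ x, |(u x : ℝ)| < ε) ∧ ∀ μ : X → ℤ, (∀ x, |μ x| ≤ C) →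
      ((cen (fun x => p x + (u x : ℂ)) μ).re = 0 → μ = 0) ∧
      (∑ x, μ x = 1 → Complex.normSq (cen (fun x => p x + (u x : ℂ)) μ) =
        sec (fun x => p x + (u x : ℂ)) μ → ∃ x, μ = Pi.single x 1) := by
  -- Induction on the set of points that may carry coefficients: one more shift is chosen at each
  -- step, and the earlier positions stay fixed.
  suffices h : ∀ T : Finset X, ∃ u : X → ℚ, (∀ x, |(u x : ℝ)| < ε) ∧ ∀ μ : X → ℤ,
      (∀ x, |μ x| ≤ C) → (∀ x, x ∉ T → μ x = 0) →
      ((cen (fun x => p x + (u x : ℂ)) μ).re = 0 → μ = 0) ∧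
      (∑ x, μ x = 1 → Complex.normSq (cen (fun x => p x + (u x : ℂ)) μ) =
        sec (fun x => p x + (u x : ℂ)) μ → ∃ x, μ = Pi.single x 1) by
    obtain ⟨u, hu, h⟩ := h Finset.univ
    exact ⟨u, hu, fun μ hμ => h μ hμ fun x hx => absurd (Finset.mem_univ x) hx⟩
  intro T
  induction T using Finset.induction_on with
  | empty =>
    refine ⟨0, fun _ => by simpa using hε, fun μ _ h => ?_⟩
    obtain rfl : μ = 0 := funext fun x => h x (Finset.notMem_empty x)
    exact ⟨fun _ => rfl, fun h => by simp at h⟩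
  | insert y T hy ih =>
    obtain ⟨u, hu, ih⟩ := ih
    set f : X → ℂ := fun x => p x + (u x : ℂ) with hf
    let f' : ℚ → X → ℂ := fun τ x => p x + (Function.update u y τ x : ℂ)
    have hff : ∀ τ x, x ≠ y → f' τ x = f x := fun τ x hx => by simp [f', f, hx]
    have hfy : ∀ τ, f' τ y = p y + (τ : ℂ) := fun τ => by simp [f']
    let Good : ℚ → (X → ℤ) → Prop := fun τ μ =>
      (∀ x, x ∉ insert y T → μ x = 0) → ((cen (f' τ) μ).re = 0 → μ = 0) ∧
        (∑ x, μ x = 1 → Complex.normSq (cen (f' τ) μ) = sec (f' τ) μ → ∃ x, μ = Pi.single x 1)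
    have hbad : ∀ μ ∈ {μ : X → ℤ | ∀ x, |μ x| ≤ C}, {τ : ℚ | ¬ Good τ μ}.Finite := by
      intro μ hμ
      by_cases hs : ∀ x, x ∉ insert y T → μ x = 0
      swap
      · have : {τ : ℚ | ¬ Good τ μ} = ∅ := Set.eq_empty_of_forall_notMem fun τ h =>
          h fun h' => absurd h' hs
        rw [this]; exact Set.finite_empty
      set ν : X → ℤ := Function.update μ y 0 with hν
      have hνb : ∀ x, |ν x| ≤ C := fun x => by
        by_cases hx : x = y
        · subst hx
          simpa [hν] using (abs_nonneg _).trans (hμ x)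
        · simpa [hν, hx] using hμ x
      have hνs : ∀ x, x ∉ T → ν x = 0 := fun x hx => by
        by_cases hxy : x = y
        · subst hxy; simp [hν]
        · simpa [hν, hxy] using hs x (by simp [hxy, hx])
      have hνy : ν y = 0 := by simp [hν]
      have hne : ∀ x, ν x ≠ 0 → x ≠ y := fun x hx e => hx (e ▸ hνy)
      have hμν : μ = ν + μ y • Pi.single y 1 := by
        funext x
        by_cases hx : x = y
        · subst hx; simp [hν]
        · simp [hν, hx]
      obtain ⟨ih1, ih2⟩ := ih ν hνb hνs
      set B := cen f ν with hB
      set Q := sec f ν with hQ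
      have hcen : ∀ τ, cen (f' τ) μ = B + μ y * (p y + (τ : ℂ)) := fun τ => by
        rw [hμν, map_add, map_zsmul, cen_single, hfy, zsmul_eq_mul,
          cen_congr (f' := f) fun x hx => hff τ x (hne x hx)]
        simp [hνy, hB]
      have hsec : ∀ τ, sec (f' τ) μ = Q + μ y * Complex.normSq (p y + (τ : ℂ)) := fun τ => by
        rw [hμν, map_add, map_zsmul, sec_single, hfy, zsmul_eq_mul,
          sec_congr (f' := f) fun x hx => hff τ x (hne x hx)]
        simp [hνy, hQ]
      by_cases ha : μ y = 0
      · have hμ' : μ = ν := by rw [hμν, ha]; simp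
        have : {τ : ℚ | ¬ Good τ μ} = ∅ := Set.eq_empty_of_forall_notMem fun τ h => h fun _ => by
          rw [hcen, hsec, ha, hμ']
          simpa using And.intro ih1 ih2
        rw [this]; exact Set.finite_empty
      · have haR : (μ y : ℝ) ≠ 0 := by exact_mod_cast ha
        have h1 : {τ : ℚ | (0 : ℝ) * (τ : ℝ) ^ 2 + μ y * τ + (B.re + μ y * (p y).re) = 0}.Finite :=
          finite_quadratic fun h => haR h.2.1
        -- As a polynomial in the new shift, the resonance condition has leading coefficient a² − a
        -- with a = μ y. For a ≠ 0 it is identically zero only if a = 1 and Re B = 0. The inductive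
        -- claim on the real part of the centre then gives ν = 0, so μ is the point mass at y; this
        -- is why that claim concerns the real part only.
        by_cases h01 : μ y = 1 ∧ B.re = 0
        · have hν0 : ν = 0 := ih1 h01.2
          refine h1.subset fun τ hτ => ?_
          by_contra hn
          refine hτ fun _ => ⟨fun h0 => absurd ?_ hn, fun _ _ => ⟨y, ?_⟩⟩
          · rw [hcen] at h0
            simp at h0
            simp only [Set.mem_ofPred_eq]
            linarith
          · rw [hμν, hν0, zero_add]; simp [h01.1]
        · have h2 : {τ : ℚ | ((μ y : ℝ) ^ 2 - μ y) * (τ : ℝ) ^ 2 +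
              (2 * μ y * B.re + 2 * (μ y ^ 2 - μ y) * (p y).re) * τ +
              (Complex.normSq (B + μ y * p y) - Q - μ y * Complex.normSq (p y)) = 0}.Finite := by
            refine finite_quadratic fun h => h01 ?_
            have e1 : (μ y : ℝ) = 1 := by
              have : (μ y : ℝ) * (μ y - 1) = 0 := by linarith [h.1]
              linarith [(mul_eq_zero.1 this).resolve_left haR]
            refine ⟨by exact_mod_cast e1, ?_⟩
            have := h.2.1
            rw [e1] at this
            linarith
          refine (h1.union h2).subset fun τ hτ => ?_
          by_contra hn
          rw [Set.mem_union, not_or] at hn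
          refine hτ fun _ => ⟨fun h0 => absurd ?_ hn.1, fun _ h0 => absurd ?_ hn.2⟩
          · rw [hcen] at h0
            simp at h0
            simp only [Set.mem_ofPred_eq]
            linarith
          · rw [hcen, hsec] at h0
            simp only [Complex.normSq_apply, Complex.add_re, Complex.add_im, Complex.mul_re,
              Complex.mul_im, Complex.intCast_re, Complex.intCast_im, Complex.ratCast_re,
              Complex.ratCast_im] at h0
            simp only [Set.mem_ofPred_eq, Complex.normSq_apply, Complex.add_re, Complex.add_im,
              Complex.mul_re, Complex.mul_im, Complex.intCast_re, Complex.intCast_im]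
            linear_combination h0
    obtain ⟨τ, hτ, hτB⟩ := exists_rat_avoiding ((finite_bounded C).biUnion hbad) 0 hε
    refine ⟨Function.update u y τ, fun x => ?_, fun μ hμ hs => ?_⟩
    · by_cases hx : x = y
      · subst hx; simpa using hτ
      · simpa [hx] using hu x
    · have : Good τ μ := by
        by_contra hn
        exact hτB (Set.mem_biUnion hμ hn)
      exact this hs

/-! ### Rotations -/

/-- The rational parametrization of the circle. -/
noncomputable def rot (t : ℝ) : ℂ := ⟨(1 - t ^ 2) / (1 + t ^ 2), 2 * t / (1 + t ^ 2)⟩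

theorem normSq_rot (t : ℝ) : Complex.normSq (rot t) = 1 := by
  have : 1 + t ^ 2 ≠ 0 := by positivity
  rw [Complex.normSq_apply, rot]
  field_simp
  ring

theorem rot_ne_zero (t : ℝ) : rot t ≠ 0 := fun h => by
  have := normSq_rot t
  rw [h] at this
  simp at this

theorem rot_injective : Function.Injective rot := fun s t h => by
  have h1 := congrArg Complex.re h
  have h2 := congrArg Complex.im h
  simp only [rot] at h1 h2
  have hs : 1 + s ^ 2 ≠ 0 := by positivity
  have ht : 1 + t ^ 2 ≠ 0 := by positivity
  have h1' : (1 - s ^ 2) / (1 + s ^ 2) = 2 / (1 + s ^ 2) - 1 := by field_simp; ring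
  have h1'' : (1 - t ^ 2) / (1 + t ^ 2) = 2 / (1 + t ^ 2) - 1 := by field_simp; ring
  rw [h1', h1''] at h1
  have h3 : 2 / (1 + s ^ 2) = 2 / (1 + t ^ 2) := by linarith
  rw [div_eq_div_iff hs ht] at h3 h2
  have h4 : 1 + s ^ 2 = 1 + t ^ 2 := by linarith
  rw [h4] at h2
  have := mul_right_cancel₀ ht h2
  linarith

theorem finite_linear_rot {B D : ℂ} (hD : D ≠ 0) : {τ : ℚ | B + rot τ * D = 0}.Finite := by
  refine Set.Subsingleton.finite fun s hs t ht => ?_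
  have h : rot s * D = rot t * D := by
    have h1 : B + rot s * D = 0 := hs
    have h2 : B + rot t * D = 0 := ht
    linear_combination h1 - h2
  exact_mod_cast rot_injective (mul_right_cancel₀ hD h)

/-- Multiplication by 1 + τ² turns the equation into a quadratic one whose coefficients all vanish
only for w = 0. -/
theorem finite_re_rot {c : ℝ} {w : ℂ} (hw : w ≠ 0) : {τ : ℚ | c + (w * rot τ).re = 0}.Finite := by
  have h : {τ : ℚ | (c - w.re) * (τ : ℝ) ^ 2 + (-2 * w.im) * τ + (c + w.re) = 0}.Finite :=
    finite_quadratic fun h => hw <| Complex.ext (by simp; linarith [h.1, h.2.2])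
      (by simp; linarith [h.2.1])
  refine h.subset fun τ hτ => ?_
  have hp : (1 : ℝ) + τ ^ 2 ≠ 0 := by positivity
  have h1 : c + (w * rot τ).re = 0 := hτ
  rw [Complex.mul_re, rot] at h1
  field_simp at h1
  simp only [Set.mem_ofPred_eq]
  linear_combination h1

/-- Since |z| = 1, the quadratic terms in z are constant, and the resonance condition becomes linear
in z. For a, D ≠ 0 its coefficient vanishes only if (a − 1) m + B = 0. -/
theorem normSq_rotation_expand (B m D z : ℂ) (a S : ℝ) (hz : Complex.normSq z = 1) :
    Complex.normSq (B + a * (m + z * D)) - (S + a * Complex.normSq (m + z * D)) =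
      (Complex.normSq (B + a * m) + a ^ 2 * Complex.normSq D - S -
        a * (Complex.normSq m + Complex.normSq D)) +
      ((2 * a : ℝ) * ((starRingEnd ℂ) ((a - 1) * m + B) * D) * z).re := by
  simp only [Complex.normSq_apply, Complex.add_re, Complex.add_im, Complex.mul_re, Complex.mul_im,
    Complex.ofReal_re, Complex.ofReal_im, Complex.conj_re, Complex.conj_im, Complex.sub_re,
    Complex.sub_im, Complex.one_re, Complex.one_im] at hz ⊢
  linear_combination ((a ^ 2 - a) * (D.re * D.re + D.im * D.im)) * hz

/-! ### Nuclear families -/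

section Config

variable {M : ℕ}

/-- The nuclear families, each represented by the parent with the label `0` in the direction of
the family. -/
abbrev Fam (M : ℕ) : Type := {p : Fin M × Cube M // p.2 p.1 = 0}

/-- The family of which `(m, v)` is a parent. -/
def famOf (m : Fin M) (v : Cube M) : Fam M := ⟨(m, Function.update v m 0), by simp⟩

theorem famOf_add_dir (m : Fin M) (v : Cube M) : famOf m (v + dir m) = famOf m v := by
  refine Subtype.ext (Prod.ext rfl (funext fun k => ?_))
  by_cases hk : k = m
  · subst hk; simp [famOf]
  · simp [famOf, dir, hk]

theorem famOf_eq_iff {φ : Fam M} {m : Fin M} {v : Cube M} :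
    famOf m v = φ ↔ m = φ.1.1 ∧ (v = φ.1.2 ∨ v = φ.1.2 + dir φ.1.1) := by
  obtain ⟨⟨k, w⟩, hw⟩ := φ
  have hw' : w k = 0 := hw
  constructor
  · intro h
    have h1 := congrArg Subtype.val h
    simp only [famOf, Prod.mk.injEq] at h1
    obtain ⟨rfl, h2⟩ := h1
    refine ⟨rfl, ?_⟩
    have hv : ∀ l, l ≠ m → v l = w l := fun l hl => by rw [← h2]; simp [hl]
    have h01 : ∀ a : ZMod 2, a = 0 ∨ a = 1 := by decide
    rcases h01 (v m) with h0 | h1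
    · left
      funext l
      by_cases hl : l = m
      · subst hl; exact h0.trans hw'.symm
      · exact hv l hl
    · right
      funext l
      by_cases hl : l = m
      · subst hl; simp [dir, h1, hw']
      · simp [dir, hl, hv l hl]
  · rintro ⟨h1, h2⟩
    obtain rfl : m = k := h1
    have h3 : famOf m w = ⟨(m, w), hw⟩ :=
      Subtype.ext (Prod.ext rfl (Function.update_eq_self_iff.2 hw'.symm))
    rcases h2 with h2 | h2
    · have h2 : v = w := h2
      rw [h2, h3]
    · have h2 : v = w + dir m := h2
      rw [h2, famOf_add_dir, h3]

/-- The positions of the points of the `l`-th generation, for given positions `g` of the first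
generation: the children of a family are obtained by rotating the parents about their centre. -/
noncomputable def place (g : Cube M → ℂ) (t : Fam M → ℝ) : ℕ → Cube M → ℂ
  | 0, v => g v
  | m + 1, v =>
    if h : m < M then
      (place g t m v + place g t m (v + dir ⟨m, h⟩)) / 2 +
        rot (t (famOf ⟨m, h⟩ v)) * ((place g t m v - place g t m (v + dir ⟨m, h⟩)) / 2)
    else 0

/-- The positions of the points. -/
noncomputable def config (g : Cube M → ℂ) (t : Fam M → ℝ) (x : Pt M) : ℂ := place g t x.1 x.2

theorem config_succ (g : Cube M → ℂ) (t : Fam M → ℝ) (m : Fin M) (v : Cube M) :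
    config g t (m.succ, v) = (config g t (m.castSucc, v) + config g t (m.castSucc, v + dir m)) / 2 +
      rot (t (famOf m v)) * ((config g t (m.castSucc, v) - config g t (m.castSucc, v + dir m)) / 2) := by
  simp only [config, Fin.val_succ, Fin.val_castSucc, place, m.2, dif_pos]

theorem config_succ_add_dir (g : Cube M → ℂ) (t : Fam M → ℝ) (m : Fin M) (v : Cube M) :
    config g t (m.succ, v + dir m) =
      (config g t (m.castSucc, v) + config g t (m.castSucc, v + dir m)) / 2 -
      rot (t (famOf m v)) * ((config g t (m.castSucc, v) - config g t (m.castSucc, v + dir m)) / 2) := by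
  rw [config_succ, famOf_add_dir, add_dir_add_dir]
  ring

theorem config_family (g : Cube M → ℂ) (t : Fam M → ℝ) (m : Fin M) (v : Cube M) :
    config g t (m.castSucc, v) + config g t (m.castSucc, v + dir m) =
      config g t (m.succ, v) + config g t (m.succ, v + dir m) := by
  rw [config_succ, config_succ_add_dir]
  ring

/-- Parents and children are endpoints of two segments with the same centre and the same length, the
diagonals of a rectangle. -/
theorem normSq_config_family (g : Cube M → ℂ) (t : Fam M → ℝ) (m : Fin M) (v : Cube M) :
    Complex.normSq (config g t (m.castSucc, v)) +
        Complex.normSq (config g t (m.castSucc, v + dir m)) =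
      Complex.normSq (config g t (m.succ, v)) + Complex.normSq (config g t (m.succ, v + dir m)) := by
  rw [config_succ, config_succ_add_dir]
  have hz := normSq_rot (t (famOf m v))
  set z := rot (t (famOf m v))
  set p := config g t (m.castSucc, v)
  set q := config g t (m.castSucc, v + dir m)
  obtain ⟨D, hD⟩ : ∃ D, p = q + 2 * D := ⟨(p - q) / 2, by ring⟩
  rw [hD, show (q + 2 * D + q) / 2 = q + D by ring, show (q + 2 * D - q) / 2 = D by ring]
  simp only [Complex.normSq_apply, Complex.add_re, Complex.add_im, Complex.mul_re, Complex.mul_im,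
    Complex.sub_re, Complex.sub_im, Complex.re_ofNat, Complex.im_ofNat] at hz ⊢
  linear_combination (-2 * (D.re * D.re + D.im * D.im)) * hz

theorem cen_of_isRel (g : Cube M → ℂ) (t : Fam M → ℝ) {μ : Pt M → ℤ} (h : IsRel μ) :
    cen (config g t) μ = 0 :=
  h.sum_eq_zero (config_family g t)

theorem sec_of_isRel (g : Cube M → ℂ) (t : Fam M → ℝ) {μ : Pt M → ℤ} (h : IsRel μ) :
    sec (config g t) μ = 0 :=
  h.sum_eq_zero (φ := fun x => Complex.normSq (config g t x)) (normSq_config_family g t)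

theorem place_congr {g : Cube M → ℂ} {t t' : Fam M → ℝ} {k : ℕ}
    (h : ∀ φ : Fam M, (φ.1.1 : ℕ) < k → t φ = t' φ) (v : Cube M) : place g t k v = place g t' k v := by
  induction k generalizing v with
  | zero => rfl
  | succ m ih =>
    have ih' := ih fun φ hφ => h φ (by omega)
    by_cases hm : m < M
    · simp only [place, hm, dif_pos, ih']
      rw [h (famOf ⟨m, hm⟩ v) (by simp [famOf])]
    · simp [place, hm]

/-- The points whose positions do not depend on families outside `S`. -/
def Active (S : Finset (Fam M)) (x : Pt M) : Prop := ∀ m : Fin M, x.1 = m.succ → famOf m x.2 ∈ S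

/-- Up to the size `C`, all additive relations and all resonances of the points in `S` are
consequences of the family relations. -/
def GenericOn (S : Finset (Fam M)) (C : ℤ) (f : Pt M → ℂ) : Prop :=
  ∀ μ : Pt M → ℤ, (∀ x, |μ x| ≤ C) → (∀ x, μ x ≠ 0 → Active S x) →
    (cen f μ = 0 → IsRel μ) ∧
      (∑ x, μ x = 1 → Complex.normSq (cen f μ) = sec f μ → ∃ x, IsRel (μ - Pi.single x 1))

theorem config_update {g : Cube M → ℂ} {t : Fam M → ℝ} {S : Finset (Fam M)} {φ : Fam M}
    (hφ : φ ∉ S) (hS : ∀ ψ ∈ S, ψ.1.1 ≤ φ.1.1) (τ : ℝ) {x : Pt M} (hx : Active S x) :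
    config g (Function.update t φ τ) x = config g t x := by
  obtain ⟨l, v⟩ := x
  rcases Fin.eq_zero_or_eq_succ l with rfl | ⟨m, rfl⟩
  · rfl
  · have hm := hx m rfl
    have hle : m ≤ φ.1.1 := hS _ hm
    have hne : famOf m v ≠ φ := fun e => hφ (e ▸ hm)
    have hc : ∀ w, config g (Function.update t φ τ) (m.castSucc, w) = config g t (m.castSucc, w) :=
      fun w => place_congr (fun ψ hψ => Function.update_of_ne (fun e => by
        subst e
        have : (ψ.1.1 : ℕ) < m := hψ
        have hle' : (m : ℕ) ≤ ψ.1.1 := hle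
        omega) _ _) w
    rw [config_succ, config_succ, hc, hc, Function.update_of_ne hne]

theorem sum_family (m : Fin M) (v : Cube M) : ∑ x, family m v x = 0 := by
  simpa using (isRel_family m v).sum_eq_zero (φ := fun _ : Pt M => (1 : ℤ)) fun _ _ => rfl

/-- The new family adds two children, one of which is eliminated by the family relation. What
remains is an old vector plus a multiple a of the child c₁, whose position is affine in a point of
the circle. Both conditions then have finitely many solutions, except in a degenerate case that
reduces to a relation of the old points; passing to this relation costs the enlargement of C to 6C +
2. -/
theorem finite_not_genericOn_insert {g : Cube M → ℂ} {t : Fam M → ℝ} {S : Finset (Fam M)} {φ : Fam M}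
    (hφ : φ ∉ S) (hS : ∀ ψ ∈ S, ψ.1.1 ≤ φ.1.1) (hlow : ∀ ψ : Fam M, ψ.1.1 < φ.1.1 → ψ ∈ S)
    {C : ℤ} (hC : 0 ≤ C) (h : GenericOn S (6 * C + 2) (config g t)) :
    {τ : ℚ | ¬ GenericOn (insert φ S) C (config g (Function.update t φ (τ : ℝ)))}.Finite := by
  obtain ⟨⟨m, w⟩, hw⟩ := φ
  have hw0 : w m = 0 := hw
  set φ : Fam M := ⟨(m, w), hw⟩ with hφdef
  have hfam : famOf m w = φ := famOf_eq_iff.2 ⟨rfl, Or.inl rfl⟩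
  set f := config g t with hf
  let F : ℚ → Pt M → ℂ := fun τ => config g (Function.update t φ (τ : ℝ))
  set p₁ : Pt M := (m.castSucc, w) with hp₁
  set p₂ : Pt M := (m.castSucc, w + dir m) with hp₂
  set c₁ : Pt M := (m.succ, w) with hc₁
  set c₂ : Pt M := (m.succ, w + dir m) with hc₂
  have hlt : m.castSucc ≠ m.succ := (Fin.castSucc_lt_succ).ne
  have hwd : w + dir m ≠ w := add_dir_ne w m
  have n12 : c₁ ≠ c₂ := fun e => hwd (congrArg Prod.snd e).symm
  have npp : p₁ ≠ p₂ := fun e => hwd (congrArg Prod.snd e).symm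
  have n1 : p₁ ≠ c₁ := fun e => hlt (congrArg Prod.fst e)
  have n2 : p₁ ≠ c₂ := fun e => hlt (congrArg Prod.fst e)
  have n3 : p₂ ≠ c₁ := fun e => hlt (congrArg Prod.fst e)
  have n4 : p₂ ≠ c₂ := fun e => hlt (congrArg Prod.fst e)
  have hFS : ∀ τ x, Active S x → F τ x = f x := fun τ x hx => config_update hφ hS _ hx
  have hpar : ∀ v, Active S (m.castSucc, v) := fun v k hk =>
    hlow _ (by
      have h1 : (m : ℕ) = k + 1 := congrArg Fin.val hk
      exact Fin.lt_def.2 (show (k : ℕ) < m by omega))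
  set mid := (f p₁ + f p₂) / 2 with hmid
  set D := (f p₁ - f p₂) / 2 with hD
  have hF1 : ∀ τ, F τ c₁ = mid + rot τ * D := fun τ => by
    have := config_succ g (Function.update t φ (τ : ℝ)) m w
    rw [hfam, Function.update_self] at this
    rw [hmid, hD, ← hFS τ p₁ (hpar _), ← hFS τ p₂ (hpar _)]
    exact this
  have hF2 : ∀ τ, F τ c₂ = mid - rot τ * D := fun τ => by
    have := config_succ_add_dir g (Function.update t φ (τ : ℝ)) m w
    rw [hfam, Function.update_self] at this
    rw [hmid, hD, ← hFS τ p₁ (hpar _), ← hFS τ p₂ (hpar _)]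
    exact this
  have hact : ∀ x, Active (insert φ S) x → Active S x ∨ x = c₁ ∨ x = c₂ := fun x hx => by
    by_cases hxa : Active S x
    · exact Or.inl hxa
    right
    simp only [Active, not_forall] at hxa
    obtain ⟨k, hk, hkS⟩ := hxa
    have := (Finset.mem_insert.1 (hx k hk)).resolve_right hkS
    obtain ⟨h1, h2⟩ := famOf_eq_iff.1 this
    have h1 : k = m := h1
    subst h1
    exact h2.imp (fun e => Prod.ext hk e) fun e => Prod.ext hk e
  -- Coinciding parents would be an additive relation of two old points, hence a trivial one.
  have hD0 : D ≠ 0 := fun h0 => by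
    have hr : IsRel (Pi.single p₁ 1 - Pi.single p₂ 1) := by
      refine (h _ (fun x => ?_) fun x hx => ?_).1 ?_
      · simp only [Pi.sub_apply, Pi.single_apply]
        split_ifs <;> simp <;> linarith
      · by_cases e1 : x = p₁
        · rw [e1]; exact hpar _
        · by_cases e2 : x = p₂
          · rw [e2]; exact hpar _
          · simp [e1, e2] at hx
      · rw [map_sub, cen_single, cen_single]
        linear_combination 2 * h0
    exact npp (IsRelOn.eq_of_two hr fun _ _ => Set.mem_univ _)
  have hRel : ∀ τ ν, IsRel ν → cen (F τ) ν = 0 ∧ sec (F τ) ν = 0 := fun τ ν hν =>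
    ⟨cen_of_isRel _ _ hν, sec_of_isRel _ _ hν⟩
  have hbad : ∀ μ ∈ {μ : Pt M → ℤ | ∀ x, |μ x| ≤ C}, {τ : ℚ | ¬ ((∀ x, μ x ≠ 0 → Active (insert φ S) x) →
      (cen (F τ) μ = 0 → IsRel μ) ∧ (∑ x, μ x = 1 → Complex.normSq (cen (F τ) μ) = sec (F τ) μ →
        ∃ x, IsRel (μ - Pi.single x 1)))}.Finite := by
    intro μ hμ
    by_cases hs : ∀ x, μ x ≠ 0 → Active (insert φ S) x
    swap
    · refine Set.finite_empty.subset fun τ hτ => hτ fun h' => absurd h' hs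
    -- Adding μ c₂ times the family removes c₂ and leaves the coefficient a at c₁; ν is the
    -- remaining part, on points placed before.
    set a : ℤ := μ c₁ - μ c₂ with ha
    set ν : Pt M → ℤ := μ + μ c₂ • family m w - a • Pi.single c₁ 1 with hν
    have hνe : ∀ x, ν x = μ x + μ c₂ * ((if x = p₁ then 1 else 0) + (if x = p₂ then 1 else 0) -
        (if x = c₁ then 1 else 0) - if x = c₂ then 1 else 0) - a * if x = c₁ then 1 else 0 :=
      fun x => by
        simp only [hν, family, Pi.sub_apply, Pi.add_apply, Pi.smul_apply, smul_eq_mul,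
          Pi.single_apply, ← hp₁, ← hp₂, ← hc₁, ← hc₂]
    have hν1 : ν c₁ = 0 := by
      rw [hνe]; simp [n1.symm, n3.symm, n12, ha]
    have hν2 : ν c₂ = 0 := by
      rw [hνe]; simp [n2.symm, n4.symm, n12.symm]
    have hνp1 : ν p₁ = μ p₁ + μ c₂ := by rw [hνe]; simp [n1, n2, npp]
    have hνp2 : ν p₂ = μ p₂ + μ c₂ := by rw [hνe]; simp [n3, n4, npp.symm]
    have hνo : ∀ x, x ≠ c₁ → x ≠ c₂ → x ≠ p₁ → x ≠ p₂ → ν x = μ x := fun x h1 h2 h3 h4 => by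
      rw [hνe]; simp [h1, h2, h3, h4]
    have hνs : ∀ x, ν x ≠ 0 → Active S x := fun x hx => by
      by_cases e1 : x = p₁
      · rw [e1]; exact hpar _
      by_cases e2 : x = p₂
      · rw [e2]; exact hpar _
      have e3 : x ≠ c₁ := fun e => hx (e ▸ hν1)
      have e4 : x ≠ c₂ := fun e => hx (e ▸ hν2)
      rw [hνo x e3 e4 e1 e2] at hx
      exact (hact x (hs x hx)).resolve_right (by simp [e3, e4])
    have hνb : ∀ x, |ν x| ≤ 2 * C := fun x => by
      have b1 := abs_le.1 (hμ c₂)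
      have b2 := abs_le.1 (hμ x)
      by_cases e1 : x = p₁
      · subst e1; rw [hνp1, abs_le]; constructor <;> linarith [b1.1, b1.2, b2.1, b2.2]
      by_cases e2 : x = p₂
      · subst e2; rw [hνp2, abs_le]; constructor <;> linarith [b1.1, b1.2, b2.1, b2.2]
      by_cases e3 : x = c₁
      · rw [e3, hν1, abs_zero]; linarith
      by_cases e4 : x = c₂
      · rw [e4, hν2, abs_zero]; linarith
      rw [hνo x e3 e4 e1 e2]
      linarith [hμ x]
    have hμν : μ = ν - μ c₂ • family m w + a • Pi.single c₁ 1 := by rw [hν]; abel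
    have hrF := isRel_family m w
    set B := cen f ν with hB
    set Q := sec f ν with hQ
    have hcen : ∀ τ, cen (F τ) μ = B + a * (mid + rot τ * D) := fun τ => by
      rw [hμν, map_add, map_sub, map_zsmul, map_zsmul, (hRel τ _ hrF).1, cen_single, hF1,
        cen_congr (f' := f) fun x hx => hFS τ x (hνs x hx)]
      simp [hB]
      ring
    have hsec : ∀ τ, sec (F τ) μ = Q + a * Complex.normSq (mid + rot τ * D) := fun τ => by
      rw [hμν, map_add, map_sub, map_zsmul, map_zsmul, (hRel τ _ hrF).2, sec_single, hF1,
        sec_congr (f' := f) fun x hx => hFS τ x (hνs x hx)]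
      simp [hQ]
    have hνs1 : a = 0 → ∑ x, μ x = 1 → ∑ x, ν x = 1 := fun ha0 h1 => by
      have : ν = μ + μ c₂ • family m w := by rw [hν, ha0]; simp
      rw [this]
      simp [Finset.sum_add_distrib, ← Finset.mul_sum, sum_family, h1]
    -- In this case neither condition depends on the new angle, and both are inherited from the old
    -- points.
    by_cases ha0 : a = 0
    · obtain ⟨g1, g2⟩ := h ν (fun x => by linarith [hνb x]) hνs
      refine Set.finite_empty.subset fun τ hτ => hτ fun _ => ?_
      have hμν' : μ = ν - μ c₂ • family m w := by
        conv_lhs => rw [hμν, ha0]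
        simp
      refine ⟨fun h0 => ?_, fun h1 h0 => ?_⟩
      · rw [hcen, ha0] at h0
        rw [hμν']
        exact (g1 (by simpa using h0)).sub (hrF.smul _)
      · rw [hcen, hsec, ha0] at h0
        obtain ⟨x, hx⟩ := g2 (hνs1 ha0 h1) (by simpa using h0)
        refine ⟨x, ?_⟩
        rw [hμν', sub_right_comm]
        exact hx.sub (hrF.smul _)
    have haC : (a : ℂ) ≠ 0 := by exact_mod_cast ha0
    have haR : (a : ℝ) ≠ 0 := by exact_mod_cast ha0
    have hfin1 : {τ : ℚ | (B + a * mid) + rot τ * (a * D) = 0}.Finite :=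
      finite_linear_rot (mul_ne_zero haC hD0)
    have hsub1 : ∀ τ : ℚ, (B + a * mid) + rot τ * (a * D) ≠ 0 → cen (F τ) μ = 0 → IsRel μ :=
      fun τ h1 h0 => absurd (by rw [hcen] at h0; linear_combination h0) h1
    -- The coefficient of the rotation in `normSq_rotation_expand`. If it vanishes, the resonance
    -- condition does not depend on the angle and must be resolved algebraically.
    by_cases hB' : ((a : ℝ) - 1 : ℂ) * mid + B = 0
    · refine hfin1.subset fun τ hτ => ?_
      by_contra hn
      refine hτ fun _ => ⟨hsub1 τ hn, fun h1 h0 => ?_⟩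
      -- Doubling replaces the midpoint by the sum of the parents. The coefficients are at most 2 ·
      -- 2C + 2C + 1, which the hypothesis on the old points covers.
      have hr : IsRel ((2 : ℤ) • ν + (a - 1) • (Pi.single p₁ 1 + Pi.single p₂ 1)) := by
        refine (h _ (fun x => ?_) fun x hx => ?_).1 ?_
        · have b1 := abs_le.1 (hμ c₂)
          have b2 := abs_le.1 (hμ c₁)
          have b3 := abs_le.1 (hνb x)
          simp only [Pi.add_apply, Pi.smul_apply, smul_eq_mul, Pi.single_apply]
          rw [abs_le]
          split_ifs with e1 e2 e2
          · exact absurd (e1.symm.trans e2) npp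
          all_goals constructor <;> linarith [b1.1, b1.2, b2.1, b2.2, b3.1, b3.2]
        · by_cases e1 : x = p₁
          · rw [e1]; exact hpar _
          by_cases e2 : x = p₂
          · rw [e2]; exact hpar _
          refine hνs x fun h0 => hx ?_
          simp [e1, e2, h0]
        · rw [map_add, map_zsmul, map_zsmul, map_add, cen_single, cen_single, ← hB, zsmul_eq_mul,
            zsmul_eq_mul, show f p₁ + f p₂ = 2 * mid by rw [hmid]; ring]
          push_cast at hB' ⊢
          linear_combination 2 * hB'
      -- Trading the parents for the children shows that, modulo relations, 2μ is supported on the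
      -- two children.
      obtain ⟨ρ, hρr, h2μ⟩ : ∃ ρ, IsRel ρ ∧
          (2 : ℤ) • μ = ρ + ((a + 1) • Pi.single c₁ 1 - (a - 1) • Pi.single c₂ 1) := by
        refine ⟨_, hr.sub (hrF.smul (a - 1 + 2 * μ c₂)), ?_⟩
        conv_lhs => rw [hμν]
        simp only [family, ← hp₁, ← hp₂, ← hc₁, ← hc₂]
        module
      have e1 : 2 * cen (F τ) μ = (a + 1) * F τ c₁ - (a - 1) * F τ c₂ := by
        have := congrArg (cen (F τ)) h2μ
        rw [map_zsmul, map_add, map_sub, map_zsmul, map_zsmul, (hRel τ _ hρr).1, cen_single,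
          cen_single, zsmul_eq_mul, zsmul_eq_mul, zsmul_eq_mul] at this
        push_cast at this
        linear_combination this
      have e2 : 2 * sec (F τ) μ =
          (a + 1) * Complex.normSq (F τ c₁) - (a - 1) * Complex.normSq (F τ c₂) := by
        have := congrArg (sec (F τ)) h2μ
        rw [map_zsmul, map_add, map_sub, map_zsmul, map_zsmul, (hRel τ _ hρr).2, sec_single,
          sec_single, zsmul_eq_mul, zsmul_eq_mul, zsmul_eq_mul] at this
        push_cast at this
        linear_combination this
      -- The centre lies on the line through the children, at the affine parameter (a + 1)/2. The
      -- second moment matches the squared length only at the children themselves, that is for a =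
      -- ±1.
      have e3 : ((a : ℝ) ^ 2 - 1) * Complex.normSq (F τ c₁ - F τ c₂) = 0 := by
        have e1r := congrArg Complex.re e1
        have e1i := congrArg Complex.im e1
        simp only [Complex.mul_re, Complex.mul_im, Complex.sub_re, Complex.sub_im, Complex.add_re,
          Complex.add_im, Complex.intCast_re, Complex.intCast_im, Complex.one_re, Complex.one_im,
          Complex.re_ofNat, Complex.im_ofNat] at e1r e1i
        simp only [Complex.normSq_apply, Complex.sub_re, Complex.sub_im] at e2 h0 ⊢
        generalize (cen (F τ) μ).re = X at *
        generalize (cen (F τ) μ).im = Y at *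
        generalize sec (F τ) μ = Z at *
        have hX : 2 * X = (a + 1) * (F τ c₁).re - (a - 1) * (F τ c₂).re := by linarith
        have hY : 2 * Y = (a + 1) * (F τ c₁).im - (a - 1) * (F τ c₂).im := by linarith
        linear_combination 4 * h0 + 2 * e2 -
          (2 * X + ((a + 1) * (F τ c₁).re - (a - 1) * (F τ c₂).re)) * hX -
          (2 * Y + ((a + 1) * (F τ c₁).im - (a - 1) * (F τ c₂).im)) * hY
      have e4 : F τ c₁ - F τ c₂ ≠ 0 := by
        rw [hF1, hF2, show mid + rot τ * D - (mid - rot τ * D) = 2 * (rot τ * D) by ring]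
        exact mul_ne_zero two_ne_zero (mul_ne_zero (rot_ne_zero _) hD0)
      have e5 : (a : ℝ) ^ 2 - 1 = 0 :=
        (mul_eq_zero.1 e3).resolve_right fun h => e4 (Complex.normSq_eq_zero.1 h)
      have e6 : (a - 1) * (a + 1) = 0 := by
        have : ((a : ℝ) - 1) * (a + 1) = 0 := by linear_combination e5
        exact_mod_cast this
      rcases mul_eq_zero.1 e6 with e | e
      · refine ⟨c₁, IsRel.of_smul two_ne_zero ?_⟩
        rw [smul_sub, h2μ, show a = 1 by linarith]
        simpa using hρr
      · refine ⟨c₂, IsRel.of_smul two_ne_zero ?_⟩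
        rw [smul_sub, h2μ, show a = -1 by linarith]
        simpa using hρr
    · have hw' : ((2 * (a : ℝ) : ℝ) : ℂ) * ((starRingEnd ℂ) (((a : ℝ) - 1 : ℂ) * mid + B) * D) ≠ 0 := by
        refine mul_ne_zero ?_ (mul_ne_zero ?_ hD0)
        · exact_mod_cast mul_ne_zero two_ne_zero haR
        · exact (map_ne_zero _).2 hB'
      have hfin2 := finite_re_rot (c := Complex.normSq (B + (a : ℝ) * mid) +
        (a : ℝ) ^ 2 * Complex.normSq D - Q - a * (Complex.normSq mid + Complex.normSq D)) hw'
      refine (hfin1.union hfin2).subset fun τ hτ => ?_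
      by_contra hn
      rw [Set.mem_union, not_or] at hn
      refine hτ fun _ => ⟨hsub1 τ hn.1, fun _ h0 => absurd ?_ hn.2⟩
      rw [hcen, hsec] at h0
      have := normSq_rotation_expand B mid D (rot τ) a Q (normSq_rot _)
      simp only [Set.mem_ofPred_eq]
      rw [← this]
      push_cast
      linear_combination h0
  refine ((finite_bounded C).biUnion hbad).subset fun τ hτ => ?_
  by_contra hn
  refine hτ fun μ hμ hs => ?_
  by_contra hc
  exact hn (Set.mem_biUnion hμ fun hh => hc (hh hs))

end Config

/-! ### Generic configurations near the prototype -/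

section Existence

variable {M : ℕ}

theorem genericOn_empty {g : Cube M → ℂ} {t : Fam M → ℝ} {C : ℤ}
    (h : ∀ μ : Cube M → ℤ, (∀ x, |μ x| ≤ C) → ((cen g μ).re = 0 → μ = 0) ∧
      (∑ x, μ x = 1 → Complex.normSq (cen g μ) = sec g μ → ∃ x, μ = Pi.single x 1)) :
    GenericOn ∅ C (config g t) := by
  intro μ hμ hs
  have hz : ∀ l : Fin (M + 1), l ≠ 0 → ∀ v, μ (l, v) = 0 := fun l hl v => by
    by_contra hn
    obtain ⟨m, rfl⟩ := Fin.exists_succ_eq.2 hl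
    exact Finset.notMem_empty _ (hs _ hn m rfl)
  have hsum : ∀ {A : Type} [AddCommMonoid A] (G : ℤ → Pt M → A), (∀ x, G 0 x = 0) →
      ∑ x, G (μ x) x = ∑ v, G (μ (0, v)) (0, v) := fun G hG => by
    rw [Fintype.sum_prod_type]
    refine Fintype.sum_eq_single 0 fun l hl => Finset.sum_eq_zero fun v _ => ?_
    rw [hz l hl, hG]
  have hcen : cen (config g t) μ = cen g fun v => μ (0, v) :=
    hsum (fun a x => (a : ℂ) * config g t x) fun x => by simp
  have hsec : sec (config g t) μ = sec g fun v => μ (0, v) :=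
    hsum (fun a x => (a : ℝ) * Complex.normSq (config g t x)) fun x => by simp
  obtain ⟨h1, h2⟩ := h (fun v => μ (0, v)) fun v => hμ _
  constructor
  · intro h0
    have hμ0 : μ = 0 := funext fun ⟨l, v⟩ => by
      by_cases hl : l = 0
      · subst hl
        exact congrFun (h1 (by rw [← hcen, h0, Complex.zero_re])) v
      · exact hz l hl v
    exact hμ0 ▸ isRel_zero
  · intro hs1 h0
    rw [hsum (fun a _ => a) fun _ => rfl] at hs1
    rw [hcen, hsec] at h0
    obtain ⟨w, hw⟩ := h2 hs1 h0
    refine ⟨(0, w), ?_⟩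
    have hμ0 : μ = Pi.single (0, w) 1 := funext fun ⟨l, v⟩ => by
      by_cases hl : l = 0
      · subst hl
        have := congrFun hw v
        rw [this]
        simp [Pi.single_apply]
      · rw [hz l hl v, Pi.single_eq_of_ne]
        exact fun e => hl (congrArg Prod.fst e)
    rw [hμ0, sub_self]
    exact isRel_zero

/-- The families are added in the order of their generations, so that their parents are already
placed and no earlier point moves. -/
theorem exists_genericOn (p : Cube M → ℂ) {ε : ℝ} (hε : 0 < ε) {C : ℤ} (hC : 0 ≤ C) :
    ∃ (u : Cube M → ℚ) (t : Fam M → ℚ), (∀ v, |(u v : ℝ)| < ε) ∧ (∀ φ, |(t φ : ℝ) - 1| < ε) ∧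
      GenericOn Finset.univ C (config (fun v => p v + (u v : ℂ)) fun φ => (t φ : ℝ)) := by
  classical
  suffices h : ∀ S : Finset (Fam M), (∀ φ ∈ S, ∀ ψ : Fam M, ψ.1.1 < φ.1.1 → ψ ∈ S) →
      ∀ C : ℤ, 0 ≤ C →
      ∃ (u : Cube M → ℚ) (t : Fam M → ℚ), (∀ v, |(u v : ℝ)| < ε) ∧ (∀ φ, |(t φ : ℝ) - 1| < ε) ∧
        GenericOn S C (config (fun v => p v + (u v : ℂ)) fun φ => (t φ : ℝ)) from
    h Finset.univ (fun _ _ _ _ => Finset.mem_univ _) C hC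
  intro S
  induction S using Finset.induction_on_max_value (fun φ : Fam M => φ.1.1) with
  | empty =>
    intro _ C _
    obtain ⟨u, hu, h⟩ := exists_generic_shift p hε C
    exact ⟨u, fun _ => 1, hu, fun _ => by simpa using hε, genericOn_empty h⟩
  | insert φ S hφ hmax ih =>
    intro hlow C hC
    have hlow' : ∀ χ ∈ S, ∀ ψ : Fam M, ψ.1.1 < χ.1.1 → ψ ∈ S := fun χ hχ ψ hψ =>
      (Finset.mem_insert.1 (hlow χ (Finset.mem_insert_of_mem hχ) ψ hψ)).resolve_left fun e =>
        (hψ.trans_le (hmax χ hχ)).ne (by rw [e])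
    -- The size C is universally quantified in the induction, so the loss of one step can be
    -- prepared in the previous one.
    obtain ⟨u, t, hu, ht, h⟩ := ih hlow' (6 * C + 2) (by linarith)
    have hl : ∀ ψ : Fam M, ψ.1.1 < φ.1.1 → ψ ∈ S := fun ψ hψ =>
      (Finset.mem_insert.1 (hlow φ (Finset.mem_insert_self _ _) ψ hψ)).resolve_left fun e =>
        hψ.ne (by rw [e])
    obtain ⟨τ, hτ, hτB⟩ := exists_rat_avoiding (finite_not_genericOn_insert hφ hmax hl hC h) 1 hε
    refine ⟨u, Function.update t φ τ, hu, fun ψ => ?_, ?_⟩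
    · by_cases hψ : ψ = φ
      · subst hψ; simpa using hτ
      · simpa [hψ] using ht ψ
    · have h1 : (fun ψ => ((Function.update t φ τ ψ : ℚ) : ℝ)) =
          Function.update (fun ψ => (t ψ : ℝ)) φ (τ : ℝ) := by
        funext ψ
        by_cases hψ : ψ = φ
        · subst hψ; simp
        · simp [hψ]
      rw [h1]
      by_contra hn
      exact hτB hn

/-- The factors of the prototype positions. -/
noncomputable def protoFactor (passed : Prop) [Decidable passed] (a : ZMod 2) : ℂ :=
  if passed then (if a = 0 then 1 + Complex.I else 0) else if a = 0 then 1 else Complex.I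

/-- The prototype of the first generation. -/
noncomputable def proto (v : Cube M) : ℂ := ∏ m, if v m = 0 then 1 else Complex.I

theorem rot_one : rot 1 = Complex.I := by
  apply Complex.ext <;> norm_num [rot]

/-- A right-angle rotation about the centre sends the couple 1, i to 1 + i, 0. Only the factor of
the direction just passed changes. -/
theorem place_proto {l : ℕ} (hl : l ≤ M) (v : Cube M) :
    place proto (fun _ : Fam M => 1) l v = ∏ m : Fin M, protoFactor ((m : ℕ) < l) (v m) := by
  induction l generalizing v with
  | zero => simp [place, proto, protoFactor]
  | succ l ih =>
    have hlM : l < M := hl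
    set m : Fin M := ⟨l, hlM⟩ with hm
    have e1 : ∀ (k : ℕ) (w : Cube M), ∏ j : Fin M, protoFactor ((j : ℕ) < k) (w j) =
        protoFactor (l < k) (w m) *
          ∏ j ∈ Finset.univ.erase m, protoFactor ((j : ℕ) < k) (w j) := fun k w =>
      (Finset.mul_prod_erase _ _ (Finset.mem_univ m)).symm
    have e2 : ∏ j ∈ Finset.univ.erase m, protoFactor ((j : ℕ) < l) ((v + dir m) j) =
        ∏ j ∈ Finset.univ.erase m, protoFactor ((j : ℕ) < l) (v j) :=
      Finset.prod_congr rfl fun j hj => by simp [dir, Finset.ne_of_mem_erase hj]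
    have e3 : ∏ j ∈ Finset.univ.erase m, protoFactor ((j : ℕ) < l + 1) (v j) =
        ∏ j ∈ Finset.univ.erase m, protoFactor ((j : ℕ) < l) (v j) :=
      Finset.prod_congr rfl fun j hj => by
        have hne : (j : ℕ) ≠ l := fun e => Finset.ne_of_mem_erase hj (Fin.ext e)
        have : (j : ℕ) < l + 1 ↔ (j : ℕ) < l := by omega
        simp only [protoFactor, this]
    rw [place, dif_pos hlM, ih hlM.le, ih hlM.le, e1 l, e1 l, e1 (l + 1), e2, e3, rot_one]
    have e4 : (v + dir m) m = v m + 1 := by simp [dir]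
    rw [e4]
    have h01 : ∀ a : ZMod 2, a = 0 ∨ a = 1 := by decide
    have h11 : (1 : ZMod 2) + 1 = 0 := by decide
    set R := ∏ j ∈ Finset.univ.erase m, protoFactor ((j : ℕ) < l) (v j)
    rcases h01 (v m) with h | h <;> rw [h] <;> simp [protoFactor, h11]
    · linear_combination (-R / 2) * Complex.I_mul_I
    · linear_combination (R / 2) * Complex.I_mul_I

theorem normSq_protoFactor (q : Prop) [Decidable q] (a : ZMod 2) :
    Complex.normSq (protoFactor q a) = if q then (if a = 0 then 2 else 0) else 1 := by
  rw [protoFactor]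
  split_ifs <;> norm_num [Complex.normSq_apply]

/-- The Sobolev sums of the generations. -/
noncomputable def sobolev (s : ℝ) (g : Cube M → ℂ) (t : Fam M → ℝ) (l : ℕ) : ℝ :=
  ∑ v, Complex.normSq (place g t l v) ^ s

/-- The sum over the cube factorizes: a passed direction contributes 2^s + 0, where 0^s = 0 uses s >
0, and any other contributes 1 + 1. -/
theorem sobolev_proto {s : ℝ} (hs : 0 < s) {l : ℕ} (hl : l ≤ M) :
    sobolev s proto (fun _ : Fam M => 1) l = ((2 : ℝ) ^ s) ^ l * 2 ^ (M - l) := by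
  have h : ∀ v : Cube M, Complex.normSq (place proto (fun _ : Fam M => 1) l v) ^ s =
      ∏ m : Fin M, (if (m : ℕ) < l then (if v m = 0 then 2 else 0) else 1 : ℝ) ^ s := fun v => by
    rw [place_proto hl, map_prod, ← Real.finsetProd_rpow _ _ fun m _ => Complex.normSq_nonneg _]
    simp only [normSq_protoFactor]
  have h2 : ∀ m : Fin M, ∑ a : ZMod 2, (if (m : ℕ) < l then (if a = 0 then 2 else 0) else 1 : ℝ) ^ s =
      if (m : ℕ) < l then (2 : ℝ) ^ s else 2 := fun m => by
    have : ∀ F : ZMod 2 → ℝ, ∑ a, F a = F 0 + F 1 := fun F => Fin.sum_univ_two F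
    have h10 : (1 : ZMod 2) ≠ 0 := by decide
    rw [this]
    by_cases hm : (m : ℕ) < l
    · simp [hm, hs.ne', h10]
    · simp only [hm, if_false, Real.one_rpow]
      norm_num
  simp only [sobolev, h]
  have h3 := (Finset.prod_univ_sum (fun _ : Fin M => (Finset.univ : Finset (ZMod 2)))
    fun m a => (if (m : ℕ) < l then (if a = 0 then 2 else 0) else 1 : ℝ) ^ s).symm
  rw [Fintype.piFinset_univ] at h3
  rw [h3]
  simp only [h2]
  rw [Finset.prod_ite, Finset.prod_const, Finset.prod_const]
  have h4 : (Finset.univ.filter fun m : Fin M => (m : ℕ) < l).card = l := by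
    rw [Fin.card_filter_val_lt, min_eq_right hl]
  have h5 := Finset.card_filter_add_card_filter_not (s := (Finset.univ : Finset (Fin M)))
    fun m : Fin M => (m : ℕ) < l
  rw [h4, Finset.card_fin] at h5
  rw [h4]
  congr 2
  omega

/-! ### Stability of the norm explosion under perturbation of the prototype -/

theorem continuous_rot : Continuous rot := by
  have h : rot = fun t => (((1 - t ^ 2) / (1 + t ^ 2) : ℝ) : ℂ) +
      ((2 * t / (1 + t ^ 2) : ℝ) : ℂ) * Complex.I := by
    funext t
    rw [rot, Complex.mk_eq_add_mul_I]
  have h0 : ∀ t : ℝ, 1 + t ^ 2 ≠ 0 := fun t => by positivity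
  rw [h]
  refine (Complex.continuous_ofReal.comp ?_).add
    ((Complex.continuous_ofReal.comp ?_).mul continuous_const)
  · exact Continuous.div (by fun_prop) (by fun_prop) h0
  · exact Continuous.div (by fun_prop) (by fun_prop) h0

theorem continuous_place (p : Cube M → ℂ) (l : ℕ) (v : Cube M) :
    Continuous fun x : (Cube M → ℝ) × (Fam M → ℝ) => place (fun w => p w + (x.1 w : ℂ)) x.2 l v := by
  induction l generalizing v with
  | zero =>
    simp only [place]
    exact continuous_const.add (Complex.continuous_ofReal.comp
      ((continuous_apply v).comp continuous_fst))
  | succ m ih =>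
    by_cases hm : m < M
    · simp only [place, hm, dif_pos]
      refine (((ih v).add (ih _)).div_const _).add
        ((continuous_rot.comp ((continuous_apply _).comp continuous_snd)).mul
          (((ih v).sub (ih _)).div_const _))
    · simp only [place, hm, dif_neg, not_false_eq_true]
      exact continuous_const

theorem continuous_sobolev (p : Cube M → ℂ) {s : ℝ} (hs : 0 ≤ s) (l : ℕ) :
    Continuous fun x : (Cube M → ℝ) × (Fam M → ℝ) => sobolev s (fun w => p w + (x.1 w : ℂ)) x.2 l :=
  continuous_finsetSum _ fun v _ =>
    (Complex.continuous_normSq.comp (continuous_place p l v)).rpow_const fun _ => Or.inr hs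

/-- The prototype has the quotient 2^((M−4)(s−1)), larger than required by the factor 2^(s−1) > 1.
Continuity at the prototype yields the radius ε. -/
theorem exists_explosion {s : ℝ} (hs : 1 < s) (hM : 4 ≤ M) :
    ∃ ε : ℝ, 0 < ε ∧ ∀ (u : Cube M → ℝ) (t : Fam M → ℝ), (∀ v, |u v| < ε) → (∀ φ, |t φ - 1| < ε) →
      (2 : ℝ) ^ (((M : ℝ) - 5) * (s - 1)) < sobolev s (fun w => proto w + (u w : ℂ)) t (M - 2) /
        sobolev s (fun w => proto w + (u w : ℂ)) t 2 := by
  have hs0 : 0 < s := by linarith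
  set x₀ : (Cube M → ℝ) × (Fam M → ℝ) := (0, fun _ => 1) with hx₀
  have e0 : ∀ l, sobolev s (fun w : Cube M => proto w + (x₀.1 w : ℂ)) x₀.2 l =
      sobolev s proto (fun _ : Fam M => 1) l := fun l => by simp [hx₀]
  have hpos : ∀ l ≤ M, (0 : ℝ) < sobolev s proto (fun _ : Fam M => 1) l := fun l hl => by
    rw [sobolev_proto hs0 hl]; positivity
  have hc : ContinuousAt (fun x : (Cube M → ℝ) × (Fam M → ℝ) =>
      sobolev s (fun w => proto w + (x.1 w : ℂ)) x.2 (M - 2) /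
        sobolev s (fun w => proto w + (x.1 w : ℂ)) x.2 2) x₀ :=
    (continuous_sobolev proto hs0.le _).continuousAt.div
      (continuous_sobolev proto hs0.le _).continuousAt (by
        rw [e0]; exact (hpos 2 (by omega)).ne')
  have hval : (2 : ℝ) ^ (((M : ℝ) - 5) * (s - 1)) <
      sobolev s (fun w : Cube M => proto w + (x₀.1 w : ℂ)) x₀.2 (M - 2) /
        sobolev s (fun w : Cube M => proto w + (x₀.1 w : ℂ)) x₀.2 2 := by
    obtain ⟨m, rfl⟩ : ∃ m, M = m + 4 := ⟨M - 4, by omega⟩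
    rw [e0, e0, sobolev_proto hs0 (by omega), sobolev_proto hs0 (by omega),
      show m + 4 - 2 = m + 2 by omega, show m + 4 - (m + 2) = 2 by omega,
      lt_div_iff₀ (by positivity), ← Real.rpow_natCast, ← Real.rpow_natCast, ← Real.rpow_natCast,
      ← Real.rpow_natCast, ← Real.rpow_mul two_pos.le, ← Real.rpow_mul two_pos.le,
      ← Real.rpow_add two_pos, ← Real.rpow_add two_pos, ← Real.rpow_add two_pos]
    refine Real.rpow_lt_rpow_of_exponent_lt one_lt_two ?_
    push_cast
    nlinarith
  obtain ⟨ε, hε, h⟩ := Metric.eventually_nhds_iff.1 (hc.eventually (lt_mem_nhds hval))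
  refine ⟨ε, hε, fun u t hu ht => h (y := (u, t)) ?_⟩
  rw [Prod.dist_eq, max_lt_iff, dist_pi_lt_iff hε, dist_pi_lt_iff hε]
  exact ⟨fun v => by simpa [hx₀, Real.dist_eq] using hu v, fun φ => by
    simpa [hx₀, Real.dist_eq] using ht φ⟩

end Existence

/-! ### Frequency sets -/

section FamilySet

variable {M : ℕ}

/-- The frequencies `k` have, up to the size `C`, exactly the relations and resonances of the
family structure. -/
structure IsFamilySet (C : ℤ) (k : Pt M → ℤ × ℤ) : Prop where
  injective : Function.Injective k
  sum_eq_zero : ∀ μ, IsRel μ → ∑ x, μ x • k x = 0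
  sum_normSq_eq_zero : ∀ μ, IsRel μ → ∑ x, μ x * modeNormSq (k x) = 0
  isRel : ∀ μ : Pt M → ℤ, (∀ x, |μ x| ≤ C) → ∑ x, μ x • k x = 0 → IsRel μ
  closed : ∀ μ : Pt M → ℤ, (∀ x, |μ x| ≤ C) → ∑ x, μ x = 1 →
    modeNormSq (∑ x, μ x • k x) = ∑ x, μ x * modeNormSq (k x) → ∃ x, IsRel (μ - Pi.single x 1)

/-- The frequencies as complex numbers. -/
noncomputable def toComplex : ℤ × ℤ →+ ℂ where
  toFun k := k.1 + k.2 * Complex.I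
  map_zero' := by simp
  map_add' k l := by push_cast [Prod.fst_add, Prod.snd_add]; ring

theorem toComplex_apply (k : ℤ × ℤ) : toComplex k = k.1 + k.2 * Complex.I := rfl

theorem normSq_toComplex (k : ℤ × ℤ) : Complex.normSq (toComplex k) = modeNormSq k := by
  simp [toComplex_apply, Complex.normSq_apply, modeNormSq, sq]

theorem toComplex_eq_zero {k : ℤ × ℤ} : toComplex k = 0 ↔ k = 0 := by
  refine ⟨fun h => ?_, fun h => by rw [h, map_zero]⟩
  have h1 := congrArg Complex.re h
  have h2 := congrArg Complex.im h
  simp [toComplex_apply] at h1 h2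
  exact Prod.ext h1 h2

/-- Scaling by c multiplies the centre by c and the second moment by c², so both conditions pass to
the integer points. -/
theorem isFamilySet_of_genericOn {C : ℤ} (hC : 1 ≤ C) {g : Cube M → ℂ} {t : Fam M → ℝ}
    (h : GenericOn Finset.univ C (config g t)) {c : ℝ} (hc : c ≠ 0) {k : Pt M → ℤ × ℤ}
    (hk : ∀ x, toComplex (k x) = c * config g t x) : IsFamilySet C k := by
  have hcC : (c : ℂ) ≠ 0 := by exact_mod_cast hc
  have hcen : ∀ μ : Pt M → ℤ, toComplex (∑ x, μ x • k x) = c * cen (config g t) μ := fun μ => by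
    simp only [map_sum, map_zsmul, hk, cen_apply, Finset.mul_sum]
    refine Finset.sum_congr rfl fun x _ => ?_
    rw [zsmul_eq_mul]
    ring
  have hsec : ∀ μ : Pt M → ℤ, ((∑ x, μ x * modeNormSq (k x) : ℤ) : ℝ) =
      c ^ 2 * sec (config g t) μ := fun μ => by
    rw [sec_apply, Finset.mul_sum, Int.cast_sum]
    refine Finset.sum_congr rfl fun x _ => ?_
    rw [Int.cast_mul, ← normSq_toComplex, hk, Complex.normSq_mul, Complex.normSq_ofReal]
    ring
  have hact : ∀ (μ : Pt M → ℤ) x, μ x ≠ 0 → Active Finset.univ x :=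
    fun _ _ _ _ _ => Finset.mem_univ _
  have hrel : ∀ μ : Pt M → ℤ, (∀ x, |μ x| ≤ C) → ∑ x, μ x • k x = 0 → IsRel μ := fun μ hμ h0 => by
    refine (h μ hμ (hact μ)).1 ?_
    have := hcen μ
    rw [h0, map_zero] at this
    exact (mul_eq_zero.1 this.symm).resolve_left hcC
  refine ⟨fun x y hxy => ?_, fun μ hμ => ?_, fun μ hμ => ?_, hrel, fun μ hμ h1 h2 => ?_⟩
  · have hr : IsRel (Pi.single x 1 - Pi.single y 1) := by
      refine hrel _ (fun z => ?_) ?_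
      · simp only [Pi.sub_apply, Pi.single_apply]
        split_ifs <;> simp <;> linarith
      · simp [Pi.single_apply, sub_smul, Finset.sum_sub_distrib, hxy]
    exact IsRelOn.eq_of_two hr fun _ _ => Set.mem_univ _
  · rw [← toComplex_eq_zero, hcen, cen_of_isRel _ _ hμ, mul_zero]
  · have := hsec μ
    rw [sec_of_isRel _ _ hμ, mul_zero] at this
    exact_mod_cast this
  · refine (h μ hμ (hact μ)).2 h1 ?_
    have h3 := hsec μ
    rw [← h2, ← normSq_toComplex, hcen, Complex.normSq_mul, Complex.normSq_ofReal, ← sq] at h3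
    exact mul_left_cancel₀ (pow_ne_zero 2 hc) h3

/-- The points `rot τ` with rational τ have rational coordinates, so all generations remain
rational. -/
theorem config_rational {p : Cube M → ℂ} {u : Cube M → ℚ} {t : Fam M → ℚ}
    (hp : ∀ v, ∃ a b : ℚ, p v = a + b * Complex.I) (l : ℕ) (v : Cube M) :
    ∃ a b : ℚ, place (fun v => p v + (u v : ℂ)) (fun φ => (t φ : ℝ)) l v = a + b * Complex.I := by
  induction l generalizing v with
  | zero =>
    obtain ⟨a, b, h⟩ := hp v
    refine ⟨a + u v, b, ?_⟩
    simp only [place, h]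
    push_cast
    ring
  | succ m ih =>
    by_cases hm : m < M
    · obtain ⟨a, b, h⟩ := ih v
      obtain ⟨a', b', h'⟩ := ih (v + dir ⟨m, hm⟩)
      set τ : ℚ := t (famOf ⟨m, hm⟩ v) with hτ
      refine ⟨(a + a') / 2 + (1 - τ ^ 2) / (1 + τ ^ 2) * ((a - a') / 2) -
          2 * τ / (1 + τ ^ 2) * ((b - b') / 2),
        (b + b') / 2 + (1 - τ ^ 2) / (1 + τ ^ 2) * ((b - b') / 2) +
          2 * τ / (1 + τ ^ 2) * ((a - a') / 2), ?_⟩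
      simp only [place, hm, dif_pos, h, h', rot, ← hτ]
      rw [Complex.mk_eq_add_mul_I]
      push_cast
      linear_combination (2 * (τ : ℂ) / (1 + (τ : ℂ) ^ 2) * ((b - b') / 2)) * Complex.I_mul_I
    · exact ⟨0, 0, by simp [place, hm]⟩

theorem proto_rational (v : Cube M) : ∃ a b : ℚ, proto v = a + b * Complex.I := by
  unfold proto
  induction (Finset.univ : Finset (Fin M)) using Finset.induction_on with
  | empty => exact ⟨1, 0, by simp⟩
  | insert m T hm ih =>
    obtain ⟨a, b, h⟩ := ih
    rw [Finset.prod_insert hm, h]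
    split_ifs
    · exact ⟨a, b, by ring⟩
    · refine ⟨-b, a, ?_⟩
      push_cast
      linear_combination (b : ℂ) * Complex.I_mul_I

theorem exists_common_denominator {X : Type*} [Fintype X] (r : X → ℚ) :
    ∃ q : ℕ, q ≠ 0 ∧ ∀ x, ∃ n : ℤ, (q : ℚ) * r x = n := by
  refine ⟨∏ x, (r x).den, Finset.prod_ne_zero_iff.2 fun x _ => (r x).den_nz, fun x => ?_⟩
  obtain ⟨m, hm⟩ := Finset.dvd_prod_of_mem (fun x => (r x).den) (Finset.mem_univ x)
  refine ⟨m * (r x).num, ?_⟩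
  rw [hm]
  push_cast
  rw [mul_comm ((r x).den : ℚ), mul_assoc, mul_comm ((r x).den : ℚ), Rat.mul_den_eq_num]

/-- The generations of a frequency set. -/
def gens (k : Pt M → ℤ × ℤ) (i : Fin (M + 1)) : Finset (ℤ × ℤ) :=
  Finset.univ.image fun v => k (i, v)

theorem sum_gens {k : Pt M → ℤ × ℤ} (hk : Function.Injective k) (i : Fin (M + 1))
    {A : Type*} [AddCommMonoid A] (G : ℤ × ℤ → A) : ∑ x ∈ gens k i, G x = ∑ v, G (k (i, v)) :=
  Finset.sum_image fun _ _ _ _ h => congrArg Prod.snd (hk h)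

theorem normExplosion_gens {s : ℝ} {g : Cube M → ℂ} {t : Fam M → ℝ} {c : ℝ}
    (hc : c ≠ 0) {k : Pt M → ℤ × ℤ} (hinj : Function.Injective k)
    (hk : ∀ x, toComplex (k x) = c * config g t x)
    (h : (2 : ℝ) ^ (((M : ℝ) - 5) * (s - 1)) < sobolev s g t (M - 2) / sobolev s g t 2) :
    NormExplosion (M + 1) s (gens k) := by
  intro i j hi hj
  have hsum : ∀ i : Fin (M + 1), ∑ x ∈ gens k i, (modeNormSq x : ℝ) ^ s =
      (c ^ 2) ^ s * sobolev s g t i := fun i => by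
    rw [sum_gens hinj, sobolev, Finset.mul_sum]
    refine Finset.sum_congr rfl fun v _ => ?_
    rw [← normSq_toComplex, hk, Complex.normSq_mul, Complex.normSq_ofReal, ← sq,
      Real.mul_rpow (sq_nonneg _) (Complex.normSq_nonneg _)]
    rfl
  have hc2 : (c ^ 2) ^ s ≠ 0 := (Real.rpow_pos_of_pos (by positivity) _).ne'
  -- With indices from 0 and N = M + 1, generation N − 2 has the index M − 2, generation 3 the index
  -- 2, and N − 6 = M − 5. The scale cancels in the quotient.
  rw [hsum, hsum, mul_div_mul_left _ _ hc2, show (i : ℕ) = M - 2 by omega,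
    show (j : ℕ) = 2 by omega]
  refine lt_of_eq_of_lt ?_ h
  push_cast
  ring_nf

theorem exists_familySets {s : ℝ} (hs : 1 < s) (hM : 4 ≤ M) {C : ℤ} (hC : 1 ≤ C) :
    ∃ k : ℕ → Pt M → ℤ × ℤ, (∀ j, IsFamilySet C (k j) ∧ NormExplosion (M + 1) s (gens (k j))) ∧
      Function.Injective fun j => Set.range (k j) := by
  obtain ⟨ε, hε, hexp⟩ := exists_explosion (M := M) hs hM
  obtain ⟨u, t, hu, ht, hgen⟩ := exists_genericOn (M := M) proto hε (zero_le_one.trans hC)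
  set g : Cube M → ℂ := fun v => proto v + (u v : ℂ) with hg
  set t' : Fam M → ℝ := fun φ => (t φ : ℝ) with ht'
  have hrat : ∀ x : Pt M, ∃ a b : ℚ, config g t' x = a + b * Complex.I := fun x =>
    config_rational proto_rational x.1 x.2
  choose a b hab using hrat
  obtain ⟨q, hq, hq'⟩ := exists_common_denominator (Sum.elim a b)
  choose n hn using hq'
  set k₀ : Pt M → ℤ × ℤ := fun x => (n (Sum.inl x), n (Sum.inr x)) with hk₀
  have hk0 : ∀ x, toComplex (k₀ x) = ((q : ℝ) : ℂ) * config g t' x := fun x => by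
    have h1 : ((n (Sum.inl x) : ℚ) : ℂ) = ((q * a x : ℚ) : ℂ) := by rw [← hn]; rfl
    have h2 : ((n (Sum.inr x) : ℚ) : ℂ) = ((q * b x : ℚ) : ℂ) := by rw [← hn]; rfl
    push_cast at h1 h2
    rw [toComplex_apply, hk₀, h1, h2, hab]
    push_cast
    ring
  -- Integer multiples of one family set; they are told apart by the total of the squared lengths,
  -- which scales with (j + 1)².
  let k : ℕ → Pt M → ℤ × ℤ := fun j x => ((j : ℤ) + 1) • k₀ x
  have hk : ∀ j x, toComplex (k j x) = (((j + 1) * q : ℝ) : ℂ) * config g t' x := fun j x => by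
    rw [map_zsmul, hk0, zsmul_eq_mul]
    push_cast
    ring
  have hc : ∀ j : ℕ, ((j + 1) * q : ℝ) ≠ 0 := fun j =>
    mul_ne_zero (by positivity) (by exact_mod_cast hq)
  have hfam : ∀ j, IsFamilySet C (k j) := fun j => isFamilySet_of_genericOn hC hgen (hc j) (hk j)
  have hexp' : (2 : ℝ) ^ (((M : ℝ) - 5) * (s - 1)) < sobolev s g t' (M - 2) / sobolev s g t' 2 := by
    have := hexp (fun v => (u v : ℝ)) t' hu ht
    simpa only [Complex.ofReal_ratCast] using this
  refine ⟨k, fun j => ⟨hfam j, normExplosion_gens (hc j) (hfam j).injective (hk j) hexp'⟩, ?_⟩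
  intro j j' hjj
  have hrange : ∀ j, Set.range (k j) = (Finset.univ.image (k j) : Finset (ℤ × ℤ)) := fun j => by simp
  have himg : Finset.univ.image (k j) = Finset.univ.image (k j') := by
    have h : Set.range (k j) = Set.range (k j') := hjj
    rw [hrange, hrange] at h
    exact_mod_cast h
  have hsum : ∀ j, ∑ x ∈ Finset.univ.image (k j), modeNormSq x =
      ((j : ℤ) + 1) ^ 2 * ∑ x, modeNormSq (k₀ x) := fun j => by
    rw [Finset.sum_image fun x _ y _ h => (hfam j).injective h, Finset.mul_sum]
    refine Finset.sum_congr rfl fun x _ => ?_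
    simp only [k, modeNormSq, Prod.smul_fst, Prod.smul_snd, smul_eq_mul]
    ring
  have hpos : 0 < ∑ x, modeNormSq (k₀ x) := by
    have hnn : ∀ z, 0 ≤ modeNormSq z := fun z => by rw [modeNormSq]; positivity
    refine (Finset.sum_nonneg fun x _ => hnn _).lt_of_ne' fun h0 => ?_
    have hz := (Finset.sum_eq_zero_iff_of_nonneg fun x _ => hnn _).1 h0
    have hz' : ∀ x, k₀ x = 0 := fun x => by
      rw [← toComplex_eq_zero, ← Complex.normSq_eq_zero, normSq_toComplex, hz x (Finset.mem_univ x)]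
      simp
    have : ((0, 0) : Pt M) = (Fin.last M, 0) :=
      (hfam 0).injective (by simp only [k, hz'])
    have := congrArg Fin.val (congrArg Prod.fst this)
    simp at this
    omega
  have h := hsum j
  rw [himg, hsum j'] at h
  have h2 := mul_right_cancel₀ hpos.ne' h
  have h3 := (pow_left_inj₀ (by positivity) (by positivity) two_ne_zero).1 h2
  omega

end FamilySet

/-! ### Resonances of a frequency set -/

section Resonances

variable {M d : ℕ}

/-- The alternating sum of the point masses of the entries in `T` of a tuple. -/
def altSum (T : Finset (Fin (2 * d))) (p : Fin (2 * d) → Pt M) : Pt M → ℤ :=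
  ∑ j ∈ T, (-1 : ℤ) ^ (j : ℕ) • Pi.single (p j) 1

theorem altSum_apply (T : Finset (Fin (2 * d))) (p : Fin (2 * d) → Pt M) (x : Pt M) :
    altSum T p x = ∑ j ∈ T, (-1 : ℤ) ^ (j : ℕ) * if p j = x then 1 else 0 := by
  simp [altSum, Finset.sum_apply, Pi.single_apply, eq_comm]

theorem sum_altSum_smul {A : Type*} [AddCommGroup A] (T : Finset (Fin (2 * d)))
    (p : Fin (2 * d) → Pt M) (F : Pt M → A) :
    ∑ x, altSum T p x • F x = ∑ j ∈ T, (-1 : ℤ) ^ (j : ℕ) • F (p j) := by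
  simp only [altSum_apply, Finset.sum_smul]
  rw [Finset.sum_comm]
  refine Finset.sum_congr rfl fun j _ => ?_
  rw [Finset.sum_eq_single (p j)]
  · simp
  · intro x _ hx
    simp [Ne.symm hx]
  · simp

theorem abs_altSum_le (T : Finset (Fin (2 * d))) (p : Fin (2 * d) → Pt M) (x : Pt M) :
    |altSum T p x| ≤ 2 * d := by
  rw [altSum_apply]
  refine (Finset.abs_sum_le_sum_abs _ _).trans ?_
  refine (Finset.sum_le_card_nsmul T _ 1 fun j _ => ?_).trans ?_
  · rw [abs_mul, abs_pow, abs_neg, abs_one, one_pow, one_mul]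
    split_ifs <;> simp
  · have := Finset.card_le_univ T
    rw [Fintype.card_fin] at this
    simpa using by exact_mod_cast this

/-- The positions of the factors `r`. -/
def evenSlot (j : Fin d) : Fin (2 * d) := ⟨2 * j, by omega⟩

/-- The positions of the factors `r̄`. -/
def oddSlot (j : Fin d) : Fin (2 * d) := ⟨2 * j + 1, by omega⟩

/-- The division of the positions into those of `r` and those of `r̄`. -/
noncomputable def slotEquiv (d : ℕ) : Fin d ⊕ Fin d ≃ Fin (2 * d) :=
  Equiv.ofBijective (Sum.elim evenSlot oddSlot) <| by
    rw [Fintype.bijective_iff_injective_and_card]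
    refine ⟨?_, by simp [two_mul]⟩
    rintro (a | a) (b | b) h <;> have h := congrArg Fin.val h <;>
      simp only [Sum.elim_inl, Sum.elim_inr, evenSlot, oddSlot] at h
    · exact congrArg _ (Fin.ext (by omega))
    · omega
    · omega
    · exact congrArg _ (Fin.ext (by omega))

theorem sum_slots {A : Type*} [AddCommMonoid A] (F : Fin (2 * d) → A) :
    ∑ i, F i = ∑ j, (F (evenSlot j) + F (oddSlot j)) := by
  rw [← Equiv.sum_comp (slotEquiv d), Fintype.sum_sum_type, Finset.sum_add_distrib]
  rfl

theorem prod_slots {A : Type*} [CommMonoid A] (F : Fin (2 * d) → A) :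
    ∏ i, F i = (∏ j, F (evenSlot j)) * ∏ j, F (oddSlot j) := by
  rw [← Equiv.prod_comp (slotEquiv d), Fintype.prod_sum_type]
  rfl

theorem even_evenSlot (j : Fin d) : Even (evenSlot j : ℕ) := even_two_mul _

theorem not_even_oddSlot (j : Fin d) : ¬ Even (oddSlot j : ℕ) := by
  simp [oddSlot]

theorem altSum_univ (p : Fin (2 * d) → Pt M) :
    altSum Finset.univ p = vec (p ∘ evenSlot) (p ∘ oddSlot) := by
  rw [altSum, sum_slots, vec]
  refine Finset.sum_congr rfl fun j _ => ?_
  rw [(even_evenSlot j).neg_one_pow, (Nat.not_even_iff_odd.1 (not_even_oddSlot j)).neg_one_pow]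
  simp [sub_eq_add_neg]

theorem sum_tuples {X A : Type*} [Fintype X] [AddCommMonoid A] (G : (Fin d → X) → (Fin d → X) → A) :
    ∑ p : Fin (2 * d) → X, G (p ∘ evenSlot) (p ∘ oddSlot) = ∑ y, ∑ y', G y y' := by
  rw [← Fintype.sum_prod_type' G]
  exact Fintype.sum_equiv (((slotEquiv d).arrowCongr (Equiv.refl X)).symm.trans
    (Equiv.sumArrowEquivProdArrow _ _ _)) _ _ fun p => rfl

theorem sum_neg_one_pow_slots : ∑ i : Fin (2 * d), (-1 : ℤ) ^ (i : ℕ) = 0 := by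
  rw [sum_slots]
  refine Finset.sum_eq_zero fun j _ => ?_
  rw [(even_evenSlot j).neg_one_pow, (Nat.not_even_iff_odd.1 (not_even_oddSlot j)).neg_one_pow]
  rfl

variable {k : Pt M → ℤ × ℤ}

/-- The linear condition alone already forces a relation, by genericity; the quadratic condition
then holds automatically. -/
theorem isResonance_iff (hk : IsFamilySet (2 * d) k) (p : Fin (2 * d) → Pt M) :
    IsResonance d (k ∘ p) ↔ IsRel (altSum Finset.univ p) := by
  have h1 := sum_altSum_smul Finset.univ p k
  have h2 := sum_altSum_smul Finset.univ p fun x => modeNormSq (k x)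
  simp only [smul_eq_mul] at h2
  constructor
  · rintro ⟨e1, -⟩
    exact hk.isRel _ (abs_altSum_le _ _) (h1.trans e1)
  · intro h
    exact ⟨h1.symm.trans (hk.sum_eq_zero _ h), h2.symm.trans (hk.sum_normSq_eq_zero _ h)⟩

/-- At an odd position the entry is the alternating sum of the others, with weights of total 1, and
its squared length is the same combination of theirs. This is the situation of `IsFamilySet.closed`.
-/
theorem IsResonance.mem_range (hk : IsFamilySet (2 * d) k) {l : Fin (2 * d) → ℤ × ℤ}
    (hl : IsResonance d l) {i : Fin (2 * d)} (hi : ¬ Even (i : ℕ))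
    (h : ∀ j, j ≠ i → l j ∈ Set.range k) : l i ∈ Set.range k := by
  have hex : ∀ j, ∃ x, j ≠ i → k x = l j := fun j => by
    by_cases hj : j = i
    · exact ⟨0, fun h => absurd hj h⟩
    · obtain ⟨x, hx⟩ := h j hj
      exact ⟨x, fun _ => hx⟩
  choose p hp using hex
  have hi1 : (-1 : ℤ) ^ (i : ℕ) = -1 := (Nat.not_even_iff_odd.1 hi).neg_one_pow
  have hT : ∀ {A : Type} [AddCommGroup A] (F : Fin (2 * d) → A),
      ∑ j : Fin (2 * d), (-1 : ℤ) ^ (j : ℕ) • F j = 0 →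
      ∑ j ∈ Finset.univ.erase i, (-1 : ℤ) ^ (j : ℕ) • F j = F i := fun F hF => by
    rw [← Finset.add_sum_erase _ _ (Finset.mem_univ i), hi1, neg_one_smul] at hF
    exact (neg_add_eq_zero.1 hF).symm
  have hpk : ∀ {A : Type} [AddCommGroup A] (F : ℤ × ℤ → A),
      ∑ j : Fin (2 * d), (-1 : ℤ) ^ (j : ℕ) • F (l j) = 0 →
      ∑ x, altSum (Finset.univ.erase i) p x • F (k x) = F (l i) := fun F hF => by
    rw [sum_altSum_smul _ _ fun x => F (k x), ← hT (fun j => F (l j)) hF]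
    exact Finset.sum_congr rfl fun j hj => by rw [hp j (Finset.ne_of_mem_erase hj)]
  have h1 := hpk (fun x => x) hl.1
  have h2 := hpk modeNormSq (by simpa only [smul_eq_mul] using hl.2)
  have h3 : ∑ x, altSum (Finset.univ.erase i) p x = 1 := by
    have := hpk (fun _ => (1 : ℤ)) (by simpa using sum_neg_one_pow_slots)
    simpa using this
  simp only [smul_eq_mul] at h2
  obtain ⟨x, hx⟩ := hk.closed _ (abs_altSum_le _ _) h3 (by rw [h1, h2])
  have h4 := hk.sum_eq_zero _ hx
  simp only [Pi.sub_apply, sub_smul, Finset.sum_sub_distrib, h1] at h4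
  refine ⟨x, ?_⟩
  rw [sub_eq_zero] at h4
  rw [h4]
  simp [Pi.single_apply]

open Classical in
/-- A sum over resonances all of whose contributing members lie in the frequency set. -/
theorem tsum_resonance_eq (hk : IsFamilySet (2 * d) k) (F : (Fin (2 * d) → ℤ × ℤ) → ℂ)
    (hF : ∀ l, IsResonance d l → F l ≠ 0 → ∀ j, l j ∈ Set.range k) :
    ∑' l : {l // IsResonance d l}, F l.1 =
      ∑ p : Fin (2 * d) → Pt M, if IsRel (altSum Finset.univ p) then F (k ∘ p) else 0 := by
  let ι : {p : Fin (2 * d) → Pt M // IsRel (altSum Finset.univ p)} → {l // IsResonance d l} :=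
    fun p => ⟨k ∘ p.1, (isResonance_iff hk p.1).2 p.2⟩
  have hι : Function.Injective ι := fun p q h =>
    Subtype.ext (hk.injective.comp_left (congrArg Subtype.val h))
  rw [← hι.tsum_eq, tsum_fintype, ← Finset.sum_filter]
  · exact (Finset.sum_subtype _ (fun p => by simp) fun p => F (k ∘ p)).symm
  · rintro ⟨l, hl⟩ hs
    choose p hp using hF l hl hs
    have hkp : k ∘ p = l := funext hp
    exact ⟨⟨p, (isResonance_iff hk p).1 (hkp ▸ hl)⟩, Subtype.ext hkp⟩

/-! ### Generations of a frequency set and the gradient at points of equal modes -/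

theorem mem_gens_iff (hk : Function.Injective k) {x : Pt M} {i : Fin (M + 1)} :
    k x ∈ gens k i ↔ x.1 = i := by
  simp only [gens, Finset.mem_image, Finset.mem_univ, true_and, hk.eq_iff]
  exact ⟨fun ⟨v, hv⟩ => by rw [← hv], fun h => ⟨x.2, by rw [← h]⟩⟩

theorem disjoint_gens (hk : Function.Injective k) (i j : Fin (M + 1)) (hij : i ≠ j) :
    Disjoint (gens k i) (gens k j) := by
  refine Finset.disjoint_left.2 fun x hx hx' => ?_
  obtain ⟨v, -, rfl⟩ := Finset.mem_image.1 hx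
  exact hij ((mem_gens_iff hk).1 hx')

theorem nonempty_gens (k : Pt M → ℤ × ℤ) (i : Fin (M + 1)) : (gens k i).Nonempty :=
  Finset.univ_nonempty.image _

theorem card_gens (hk : Function.Injective k) (i : Fin (M + 1)) :
    (gens k i).card = genCard (M + 1) := by
  rw [gens, Finset.card_image_of_injective _ fun v w h => congrArg Prod.snd (hk h),
    Finset.card_univ, Cube.card]
  rfl

theorem iUnion_gens (k : Pt M → ℤ × ℤ) : ⋃ i, (gens k i : Set (ℤ × ℤ)) = Set.range k := by
  ext x
  simp [gens]

theorem fromGen_gens (hk : Function.Injective k) (z : Fin (M + 1) → ℂ) (x : Pt M) :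
    fromGen (gens k) z (k x) = z x.1 :=
  fromGen_apply_of_mem (disjoint_gens hk) z ((mem_gens_iff hk).2 rfl)

theorem fromGen_gens_eq_zero (z : Fin (M + 1) → ℂ) {l : ℤ × ℤ} (hl : l ∉ Set.range k) :
    fromGen (gens k) z l = 0 :=
  fromGen_apply_of_notMem z fun i hi => hl (by
    obtain ⟨v, -, h⟩ := Finset.mem_image.1 hi
    exact ⟨_, h⟩)

theorem slots_gens (hk : Function.Injective k) (z : Fin (M + 1) → ℂ) (j : Fin (2 * d)) (x : Pt M) :
    slots d (fromGen (gens k) z) j (k x) =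
      if Even (j : ℕ) then z x.1 else (starRingEnd ℂ) (z x.1) := by
  rw [slots_apply, fromGen_gens hk]

theorem mem_range_of_slots_ne_zero {z : Fin (M + 1) → ℂ} {j : Fin (2 * d)} {l : ℤ × ℤ}
    (h : slots d (fromGen (gens k) z) j l ≠ 0) : l ∈ Set.range k := by
  by_contra hn
  refine h ?_
  rw [slots_apply, fromGen_gens_eq_zero z hn]
  simp

open Classical in
theorem HRes_gens (hd : 0 < d) (hk : IsFamilySet (2 * d) k) (z : Fin (M + 1) → ℂ) :
    HRes d (fromGen (gens k) z) = ∑ y : Fin d → Pt M, ∑ y' : Fin d → Pt M,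
      if IsRel (vec y y') then (∏ j, z (y j).1) * ∏ j, (starRingEnd ℂ) (z (y' j).1) else 0 := by
  rw [HRes_eq_resForm hd, resForm_apply, tsum_resonance_eq hk
    (fun l => ∏ j, slots d (fromGen (gens k) z) j (l j)) fun l _ h0 j =>
      mem_range_of_slots_ne_zero (Finset.prod_ne_zero_iff.1 h0 j (Finset.mem_univ j)),
    ← sum_tuples]
  refine Finset.sum_congr rfl fun p _ => ?_
  rw [altSum_univ]
  simp only [Function.comp_apply, slots_gens hk.injective]
  rw [prod_slots]
  simp only [even_evenSlot, not_even_oddSlot, if_true, if_false]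

open Classical in
theorem wirtingerBar_gens (hd : 0 < d) (hk : IsFamilySet (2 * d) k) (z : Fin (M + 1) → ℂ)
    (κ : ℤ × ℤ) :
    wirtingerBar (HRes d) (modeVector κ) (fromGen (gens k) z) =
      ∑ i : Fin (2 * d) with ¬ Even (Fin.val i), ∑ p : Fin (2 * d) → Pt M,
        if IsRel (altSum Finset.univ p) then (if k (p i) = κ then 1 else 0) *
          ∏ j ∈ Finset.univ.erase i, if Even (j : ℕ) then z (p j).1 else (starRingEnd ℂ) (z (p j).1)
        else 0 := by
  rw [wirtingerBar_HRes_mode hd]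
  refine Finset.sum_congr rfl fun i hi => ?_
  rw [tsum_resonance_eq hk (fun l => modeVector κ (l i) *
    ∏ j ∈ Finset.univ.erase i, slots d (fromGen (gens k) z) j (l j)) fun l hl h0 => ?_]
  · refine Finset.sum_congr rfl fun p _ => ?_
    simp only [Function.comp_apply, slots_gens hk.injective, modeVector_apply]
  · have h1 : ∀ j, j ≠ i → l j ∈ Set.range k := fun j hj =>
      mem_range_of_slots_ne_zero (Finset.prod_ne_zero_iff.1 (right_ne_zero_of_mul h0) j
        (Finset.mem_erase.2 ⟨hj, Finset.mem_univ j⟩))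
    intro j
    by_cases hj : j = i
    · subst hj
      exact hl.mem_range hk (Finset.mem_filter.1 hi).2 h1
    · exact h1 j hj

/-- A contributing resonance would have a single entry outside the generations of A. The generation
of that entry would occur once, contradicting the parity of relations. -/
theorem wirtingerBar_gens_eq_zero (hd : 0 < d) (hk : IsFamilySet (2 * d) k) {A : Set (Fin (M + 1))}
    {z : Fin (M + 1) → ℂ} (hz : ∀ i, i ∉ A → z i = 0) {κ : ℤ × ℤ} (hκ : ∀ i ∈ A, κ ∉ gens k i) :
    wirtingerBar (HRes d) (modeVector κ) (fromGen (gens k) z) = 0 := by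
  classical
  rw [wirtingerBar_gens hd hk]
  refine Finset.sum_eq_zero fun i hi => Finset.sum_eq_zero fun p _ => ?_
  split_ifs with hr he
  · by_contra h0
    have hA : ∀ j, j ≠ i → (p j).1 ∈ A := fun j hj => by
      by_contra hn
      refine Finset.prod_ne_zero_iff.1 (right_ne_zero_of_mul h0) j
        (Finset.mem_erase.2 ⟨hj, Finset.mem_univ j⟩) ?_
      rw [hz _ hn]
      simp
    have hi' : (p i).1 ∉ A := fun h => hκ _ h (he ▸ (mem_gens_iff hk.injective).2 rfl)
    have h1 := hr.even_sum (p i).1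
    have h2 : ∑ v, altSum Finset.univ p ((p i).1, v) = (-1 : ℤ) ^ (i : ℕ) := by
      simp only [altSum_apply]
      rw [Finset.sum_comm, Finset.sum_eq_single i]
      · rw [← Finset.mul_sum, Finset.sum_eq_single (p i).2]
        · simp
        · intro v _ hv
          rw [if_neg]
          exact fun e => hv (congrArg Prod.snd e).symm
        · simp
      · intro j _ hj
        refine Finset.sum_eq_zero fun v _ => ?_
        rw [if_neg, mul_zero]
        intro e
        exact hi' (by have := hA j hj; rwa [e] at this)
      · simp
    rw [h2] at h1
    have := (Nat.not_even_iff_odd.1 (Finset.mem_filter.1 hi).2)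
    rw [this.neg_one_pow] at h1
    exact absurd h1 (by decide)
  · simp
  · rfl

theorem isRel_translate {μ ν : Pt M → ℤ} (c : Cube M) (h : ∀ l v, ν (l, v + c) = μ (l, v))
    (hμ : IsRel μ) : IsRel ν := by
  have hv : ∀ l v, ν (l, v) = μ (l, v - c) := fun l v => by rw [← h, sub_add_cancel]
  have hp : ∀ m v, psum ν m v = psum μ m (v - c) := fun m v =>
    Finset.sum_congr rfl fun l _ => hv l v
  refine ⟨fun m hm v => ?_, fun v => ?_⟩
  · rw [hp, hp, add_sub_right_comm, hμ.1 m hm]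
  · simp only [hv, hμ.2]

/-- Translations of the cube of labels act transitively on each generation and preserve relations
and generations, so they permute the contributing tuples. -/
theorem wirtingerBar_gens_congr (hd : 0 < d) (hk : IsFamilySet (2 * d) k) (z : Fin (M + 1) → ℂ)
    (i : Fin (M + 1)) {κ κ' : ℤ × ℤ} (hκ : κ ∈ gens k i) (hκ' : κ' ∈ gens k i) :
    wirtingerBar (HRes d) (modeVector κ) (fromGen (gens k) z) =
      wirtingerBar (HRes d) (modeVector κ') (fromGen (gens k) z) := by
  classical
  obtain ⟨v, -, rfl⟩ := Finset.mem_image.1 hκ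
  obtain ⟨v', -, rfl⟩ := Finset.mem_image.1 hκ'
  rw [wirtingerBar_gens hd hk, wirtingerBar_gens hd hk]
  refine Finset.sum_congr rfl fun a _ => ?_
  let Θ : Equiv.Perm (Pt M) := (Equiv.refl _).prodCongr (Equiv.addRight (v' - v))
  have hΘ : ∀ l w, Θ (l, w) = (l, w + (v' - v)) := fun l w => rfl
  have hΘ1 : ∀ x, (Θ x).1 = x.1 := fun x => rfl
  refine Fintype.sum_equiv (Equiv.arrowCongr (Equiv.refl _) Θ) _ _ fun p => ?_
  have hp : (Equiv.arrowCongr (Equiv.refl (Fin (2 * d))) Θ) p = Θ ∘ p := rfl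
  rw [hp]
  have hsum : ∀ x, altSum Finset.univ (Θ ∘ p) (Θ x) = altSum Finset.univ p x := fun x => by
    simp only [altSum_apply, Function.comp_apply, Θ.injective.eq_iff]
  have hr : IsRel (altSum Finset.univ (Θ ∘ p)) ↔ IsRel (altSum Finset.univ p) :=
    ⟨fun h => isRel_translate (-(v' - v)) (fun l w => by
        rw [← hsum, hΘ, neg_add_cancel_right]) h,
      fun h => isRel_translate (v' - v) (fun l w => by rw [← hΘ, hsum]) h⟩
  have hv : Θ (i, v) = (i, v') := by rw [hΘ, add_sub_cancel]
  have he : k (Θ (p a)) = k (i, v') ↔ k (p a) = k (i, v) := by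
    rw [hk.injective.eq_iff, hk.injective.eq_iff, ← hv, Θ.injective.eq_iff]
  by_cases h1 : IsRel (altSum Finset.univ p)
  · rw [if_pos h1, if_pos (hr.2 h1)]
    simp only [Function.comp_apply, he, hΘ1]
  · rw [if_neg h1, if_neg fun h => h1 (hr.1 h)]

/-! ### The restricted Hamiltonian -/

theorem sum_pts {A : Type*} [AddCommMonoid A] (G : (Fin d → Pt M) → A) :
    ∑ y, G y = ∑ α : Fin d → Fin (M + 1), ∑ v : Fin d → Cube M, G (pts α v) := by
  rw [← Fintype.sum_prod_type' fun α v => G (pts α v)]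
  exact Fintype.sum_equiv (Equiv.arrowProdEquivProdArrow (Fin d) (fun _ => Fin (M + 1))
    fun _ => Cube M) _ _ fun y => rfl

theorem sum_defect (u c : Fin (M + 1) → ℂ) :
    ∑ y : Fin d → Pt M, ∑ y' : Fin d → Pt M, (defect y y' : ℂ) *
        ((∏ j, u (y j).1) * ∏ j, c (y' j).1) =
      ∑ α : Fin d → Fin (M + 1), ∑ β : Fin d → Fin (M + 1), (excess α β : ℂ) *
        ((∏ j, u (α j)) * ∏ j, c (β j)) := by
  rw [sum_pts]
  refine Finset.sum_congr rfl fun α _ => ?_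
  simp only [sum_pts (d := d) (M := M) fun y' => _]
  rw [Finset.sum_comm]
  refine Finset.sum_congr rfl fun β _ => ?_
  simp only [excess, Complex.ofReal_sum, Finset.sum_mul]
  rfl

theorem sum_consecutive (F : Fin (M + 1) → Fin (M + 1) → ℝ) :
    ∑ p : Fin (M + 1) × Fin (M + 1) with (p.1 : ℕ) + 1 = (p.2 : ℕ), F p.1 p.2 =
      ∑ m : Fin M, F m.castSucc m.succ := by
  symm
  refine Finset.sum_bij (fun m _ => (m.castSucc, m.succ)) (fun m _ => by simp)
    (fun a _ b _ h => Fin.castSucc_injective _ (congrArg Prod.fst h)) (fun p hp => ?_) fun _ _ => rfl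
  have h := (Finset.mem_filter.1 hp).2
  exact ⟨⟨p.1, by omega⟩, Finset.mem_univ _, Prod.ext (Fin.ext rfl) (Fin.ext h)⟩

/-- The indicator of relations is split into weight and defect: the former sums to the explicit
part, the latter, grouped by generations, to the remainder. -/
theorem HRes_gens_eq (hd : 2 ≤ d) (hk : IsFamilySet (2 * d) k) (z : Fin (M + 1) → ℂ) :
    HRes d (fromGen (gens k) z) = (genCard (M + 1) : ℂ) * toyHam d (remainder d M) z := by
  classical
  set c : Fin (M + 1) → ℂ := fun i => (starRingEnd ℂ) (z i) with hc
  have h1 : HRes d (fromGen (gens k) z) =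
      ∑ y : Fin d → Pt M, ∑ y' : Fin d → Pt M, (weight y y' : ℂ) *
        ((∏ j, z (y j).1) * ∏ j, c (y' j).1) +
      ∑ y : Fin d → Pt M, ∑ y' : Fin d → Pt M, (defect y y' : ℂ) *
        ((∏ j, z (y j).1) * ∏ j, c (y' j).1) := by
    rw [HRes_gens (by omega) hk, ← Finset.sum_add_distrib]
    refine Finset.sum_congr rfl fun y _ => ?_
    rw [← Finset.sum_add_distrib]
    refine Finset.sum_congr rfl fun y' _ => ?_
    rw [← add_mul, ← Complex.ofReal_add, defect, add_sub_cancel]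
    split_ifs <;> simp [hc]
  have hN : (genCard (M + 1) : ℂ) = 2 ^ M := by simp [genCard]
  have hN0 : (2 : ℂ) ^ M ≠ 0 := pow_ne_zero _ two_ne_zero
  have hd1 : (d : ℂ) - 1 ≠ 0 := by
    rw [sub_ne_zero]; exact_mod_cast (by omega : d ≠ 1)
  have hd0 : (d : ℂ) ≠ 0 := by exact_mod_cast (by omega : d ≠ 0)
  have hf : (d.factorial : ℂ) ≠ 0 := by exact_mod_cast d.factorial_ne_zero
  -- In n · h the remainder has the prefactor n · n^(d−2) d! d(d−1) / n, which is the normalization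
  -- chosen in `remCoeff`.
  have h2 : ∑ α : Fin d → Fin (M + 1), ∑ β : Fin d → Fin (M + 1), (excess α β : ℂ) *
        ((∏ j, z (α j)) * ∏ j, c (β j)) =
      (2 ^ M) ^ (d - 2) * (d.factorial * (d * (d - 1))) * (remainder d M).value z := by
    rw [value_remainder, Finset.mul_sum]
    refine Finset.sum_congr rfl fun α _ => ?_
    rw [Finset.mul_sum]
    refine Finset.sum_congr rfl fun β _ => ?_
    rw [remCoeff]
    simp only [hc]
    push_cast
    field_simp
  have hsq : ∀ i, ((‖z i‖ ^ 2 : ℝ) : ℂ) = z i * c i := fun i => by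
    rw [hc, Complex.mul_conj, Complex.normSq_eq_norm_sq]
  have hJ : ((∑ i, ‖z i‖ ^ 2 : ℝ) : ℂ) = ∑ i, z i * c i := by
    rw [Complex.ofReal_sum]
    simp only [hsq]
  have hquad : ((-(1 / 4) * ∑ i, ‖z i‖ ^ 4 +
      ∑ p : Fin (M + 1) × Fin (M + 1) with (p.1 : ℕ) + 1 = (p.2 : ℕ),
        (z p.1 ^ 2 * (starRingEnd ℂ) (z p.2) ^ 2).re : ℝ) : ℂ) =
      1 / 4 * (2 * ∑ m : Fin M, ((z m.castSucc * c m.succ) ^ 2 +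
        (c m.castSucc * z m.succ) ^ 2) - ∑ l, (z l * c l) ^ 2) := by
    rw [sum_consecutive fun i j => (z i ^ 2 * (starRingEnd ℂ) (z j) ^ 2).re]
    rw [Complex.ofReal_add, Complex.ofReal_mul, Complex.ofReal_sum, Complex.ofReal_sum]
    have e1 : ∀ i, ((‖z i‖ ^ 4 : ℝ) : ℂ) = (z i * c i) ^ 2 := fun i => by
      rw [← hsq, ← Complex.ofReal_pow, ← pow_mul]
    have e2 : ∀ m : Fin M, (((z m.castSucc ^ 2 * (starRingEnd ℂ) (z m.succ) ^ 2).re : ℝ) : ℂ) =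
        1 / 2 * ((z m.castSucc * c m.succ) ^ 2 + (c m.castSucc * z m.succ) ^ 2) := fun m => by
      rw [Complex.re_eq_add_conj]
      simp only [map_mul, map_pow, Complex.conj_conj, hc]
      ring
    simp only [e1, e2, ← Finset.mul_sum]
    push_cast
    ring
  rw [h1, sum_weight hd, sum_defect, h2, toyHam, hJ, hquad, hN]
  obtain ⟨e, rfl⟩ : ∃ e, d = e + 2 := ⟨d - 2, by omega⟩
  simp only [Nat.add_sub_cancel, show e + 2 - 1 = e + 1 by omega]
  field_simp
  ring

/-- Only tuples within the two generations contribute, and their relations are carried over by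
moving the generations and exchanging the two directions. As `Adjacent` is unordered, this covers
both the translation and the exchange of a pair. -/
theorem HRes_twoModes (hd : 0 < d) (hk : IsFamilySet (2 * d) k) {m m' : Fin M}
    {i j i' j' : Fin (M + 1)} (h : Adjacent m i j) (h' : Adjacent m' i' j') (x y : ℂ) :
    HRes d (fromGen (gens k) (twoModes i j x y)) = HRes d (fromGen (gens k) (twoModes i' j' x y)) := by
  classical
  have hne : ∀ {m : Fin M} {i j : Fin (M + 1)}, Adjacent m i j → i ≠ j := fun {m i j} h => by
    have h1 : m.castSucc ≠ m.succ := (Fin.castSucc_lt_succ).ne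
    rcases h with ⟨rfl, rfl⟩ | ⟨rfl, rfl⟩
    · exact h1
    · exact h1.symm
  obtain ⟨π, rfl, rfl⟩ := exists_perm_pair (hne h) (hne h')
  rw [HRes_gens hd hk, HRes_gens hd hk]
  have hz : ∀ l, twoModes (π i) (π j) x y (π l) = twoModes i j x y l := fun l => by
    simp [twoModes, Pi.single_apply]
  have hoff : ∀ l, twoModes i j x y l ≠ 0 → l = i ∨ l = j := fun l hl => by
    by_contra! hn
    exact hl (by simp [twoModes, hn.1, hn.2])
  let Θ : Equiv.Perm (Pt M) := π.prodCongr (swapDir m m')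
  have hΘ : ∀ y : Fin d → Pt M, Θ ∘ y = actPt π (swapDir m m') ∘ y := fun y => rfl
  let Φ : Equiv.Perm (Fin d → Pt M) := Equiv.arrowCongr (Equiv.refl _) Θ
  have hΦ : ∀ y, Φ y = Θ ∘ y := fun y => rfl
  refine Fintype.sum_equiv Φ _ _ fun a => Fintype.sum_equiv Φ _ _ fun b => ?_
  have hprod : (∏ l, twoModes (π i) (π j) x y (Φ a l).1) *
      ∏ l, (starRingEnd ℂ) (twoModes (π i) (π j) x y (Φ b l).1) =
      (∏ l, twoModes i j x y (a l).1) * ∏ l, (starRingEnd ℂ) (twoModes i j x y (b l).1) := by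
    congr 1
    · exact Finset.prod_congr rfl fun l _ => hz _
    · exact Finset.prod_congr rfl fun l _ => congrArg _ (hz _)
  rw [hprod]
  by_cases h0 : (∏ l, twoModes i j x y (a l).1) *
      ∏ l, (starRingEnd ℂ) (twoModes i j x y (b l).1) = 0
  · rw [h0, ite_self, ite_self]
  · have ha : ∀ l, (a l).1 = i ∨ (a l).1 = j := fun l => hoff _
      (Finset.prod_ne_zero_iff.1 (left_ne_zero_of_mul h0) l (Finset.mem_univ l))
    have hb : ∀ l, (b l).1 = i ∨ (b l).1 = j := fun l => hoff _ fun e =>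
      Finset.prod_ne_zero_iff.1 (right_ne_zero_of_mul h0) l (Finset.mem_univ l) (by rw [e, map_zero])
    have hr := isRel_vec_map_adjacent h h' (α := fun l => (a l).1) (β := fun l => (b l).1) ha hb
      (fun l => (a l).2) fun l => (b l).2
    have hr' : IsRel (vec (Φ a) (Φ b)) ↔ IsRel (vec a b) := hr
    by_cases hrel : IsRel (vec a b)
    · rw [if_pos hrel, if_pos (hr'.2 hrel)]
    · rw [if_neg hrel, if_neg fun e => hrel (hr'.1 e)]

theorem twoModes_swap (i j : Fin (M + 1)) (x y : ℂ) : twoModes i j y x = twoModes j i x y :=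
  add_comm _ _

end Resonances

/-! ### Acceptable sets -/

section Acceptable

variable {M d : ℕ} {k : Pt M → ℤ × ℤ}

theorem isResInvariant_gens (hd : 0 < d) (hk : IsFamilySet (2 * d) k) (A : Set (Fin (M + 1))) :
    IsResInvariant d (fromGen (gens k) '' {z | ∀ i, i ∉ A → z i = 0}) :=
  isResInvariant_fromGen hd (disjoint_gens hk.injective) (nonempty_gens k) A
    (fun _ hz _ hκ => wirtingerBar_gens_eq_zero hd hk hz hκ)
    fun z i _ hκ _ hκ' => wirtingerBar_gens_congr hd hk z i hκ hκ'

theorem isResOrbit_gens_iff (hd : 2 ≤ d) (hk : IsFamilySet (2 * d) k) (I : Set ℝ)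
    (z : ℝ → Fin (M + 1) → ℂ) :
    IsResOrbit d (fun t => fromGen (gens k) (z t)) I ↔ IsToyOrbit (toyHam d (remainder d M)) z I := by
  have hd0 : 0 < d := by omega
  exact isResOrbit_fromGen_iff hd0 (pow_ne_zero _ two_ne_zero) (disjoint_gens hk.injective)
    (card_gens hk.injective) (HRes_gens_eq hd hk)
    (fun z κ hκ => wirtingerBar_gens_eq_zero hd0 hk (A := Set.univ)
      (fun i hi => absurd (Set.mem_univ i) hi) fun i _ => hκ i)
    (fun z i κ hκ κ' hκ' => wirtingerBar_gens_congr hd0 hk z i hκ hκ') I z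

theorem isToyRemainder_remainder (hd : 2 ≤ d) (hk : IsFamilySet (2 * d) k) :
    IsToyRemainder d (M + 1) (coeffBound d) (gens k) (remainder d M) where
  homogeneous := isHomogeneous_remainder
  bounded m q := by
    rw [coeff_remainder, Polynomial.coeff_C]
    split_ifs
    · exact abs_coeffSum_le hd m
    · rw [abs_zero]
      exact (abs_nonneg _).trans (abs_coeffSum_le hd m)
  real := rename_swap_remainder
  gauge := poisson_remainder_mass
  even _ hm i := even_of_mem_support hm i
  -- The invariance is first obtained for H_Res, with all generations but i allowed, and then
  -- transferred through the equivalence of orbits.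
  zero_invariant i := by
    have h := isToyInvariant_of_isResInvariant (disjoint_gens hk.injective) (nonempty_gens k)
      (isResOrbit_gens_iff hd hk) (isResInvariant_gens (by omega) hk {i}ᶜ)
    simpa using h
  pair_invariant j j' _ := by
    have h := isResInvariant_gens (by omega) hk {j, j'}
    simpa using h
  pair_translation j j' l l' hj hl x y := by
    obtain ⟨m, hm⟩ := adjacent_iff.2 (Or.inl hj)
    obtain ⟨m', hm'⟩ := adjacent_iff.2 (Or.inl hl)
    exact HRes_twoModes (by omega) hk hm hm' x y
  pair_symmetric j j' hj x y := by
    obtain ⟨m, hm⟩ := adjacent_iff.2 (Or.inl hj)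
    obtain ⟨m', hm'⟩ := adjacent_iff.2 (Or.inr hj)
    rw [twoModes_swap j j' x y]
    exact HRes_twoModes (by omega) hk hm hm' x y
  pair_monomials := pairPart_remainder_eq hd

theorem isAcceptable_range (hd : 2 ≤ d) (hk : IsFamilySet (2 * d) k) {s : ℝ}
    (hs : NormExplosion (M + 1) s (gens k)) :
    IsAcceptable d (M + 1) s (coeffBound d) (Set.range k) := by
  refine ⟨gens k, (iUnion_gens k).symm, disjoint_gens hk.injective, card_gens hk.injective, hs, ?_,
    remainder d M, fun T₁ T₂ z => isResOrbit_gens_iff hd hk _ z, HRes_gens_eq hd hk,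
    isToyRemainder_remainder hd hk⟩
  choose rep hrep using nonempty_gens k
  rw [equalModes_eq_range (disjoint_gens hk.injective) hrep]
  exact isResInvariant_gens (by omega) hk Set.univ

end Acceptable

theorem mainTheorem3 (d : ℕ) (hd : 2 ≤ d) :
    ∃ K : ℝ, ∀ s : ℝ, 1 < s → ∃ N₀ : ℕ, ∀ N : ℕ, N₀ ≤ N →
      {S : Set (ℤ × ℤ) | IsAcceptable d N s K S}.Infinite := by
  -- The bound depends on d only. N ≥ 5 gives M ≥ 4, as the norm explosion requires, and genericity
  -- up to 2d covers all tuples of length 2d.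
  refine ⟨coeffBound d, fun s hs => ⟨5, fun N hN => ?_⟩⟩
  obtain ⟨M, rfl⟩ : ∃ M, N = M + 1 := ⟨N - 1, by omega⟩
  obtain ⟨k, hk, hinj⟩ := exists_familySets (M := M) hs (by omega) (C := 2 * d)
    (by exact_mod_cast (by omega : 1 ≤ 2 * d))
  exact Set.infinite_of_injective_forall_mem hinj fun j => isAcceptable_range hd (hk j).1 (hk j).2
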